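/- **Setting.** Let $\alpha\in\mathbb Z$ and let $Q\subset\mathbb C$ be a finite set, $Q^\times=Q\setminus\{0\}$, such that (1) $\{0,1\}\subseteq Q$; (2) $Q\cap(0,1)=\varnothing$; (3) $\Re(u)>0$ and $|u-1/4|>1/4$ for all $u\in Q^\times$; (4) $2\Re(u/v)<\Re(v)$ for all $u\in Q$, $v\in Q^\times$ with $u\ne v$. **Iterated integrals.** For a path $\gamma$ on $(0,1)$ and $1$-forms $\omega_1,\dots,\omega_k$ along $\gamma$, there is a unique polynomial $P$ such that the iterated integral $\int_{z<t_1<\cdots<t_k<1-z}\gamma^*\omega_1(t_1)\cdots\gamma^*\omega_k(t_k)$ equals $P(\log z)+O(z(\log z)^J)$ for some $J$ as $z\to+0$ (for all the words below such a $P$ exists), and $I_\gamma(\omega_1\cdots\omega_k):=P(0)$. Write $e_a=dx/(x-a)$ and $e_\infty=0$. Let $\beta$ be the (homotopy class of the) loop based at $0$ which runs from $0$ along $(0,1)$ to near $1$, once counterclockwise around $1$ inside $|y-1|<1$ (this punctured disc contains no $a/b$ with $a\in Q$, $b\in Q^\times$), and back to $0$ along $(0,1)$, with $\beta'(0)=1$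 and $\beta'(1)=-1$. **Refined symmetric multiple polylogarithms.** For $z_1,\dots,z_r\in Q$ and positive integers $k_1,\dots,k_r$ put, in $\mathbb C[[t]]$, $$\mathcal L_{RS,\alpha}\binom{z_1,\dots,z_r}{k_1,\dots,k_r}=\frac{(-1)^r}{2\pi i}\sum_{u\in Q^\times}u^\alpha\sum_{n\ge0}I_\beta\bigl(e_{u/z_1}e_0^{k_1-1}\cdots e_{u/z_r}e_0^{k_r-1}e_ue_0^n\bigr)t^n,$$ and, for $r\ge1$, $$\mathcal L^\star_{RS,\alpha}\binom{z_1,\dots,z_r}{k_1,\dots,k_r}=\sum_{d=0}^{r-1}\ \sum_{0=i_0<i_1<\cdots<i_{d+1}=r}\mathcal L_{RS,\alpha}\binom{z_{i_0+1},\dots,z_{i_d+1}}{k_{i_0+1}+\cdots+k_{i_1},\dots,k_{i_d+1}+\cdots+k_{i_{d+1}}}.$$ **Forms along $\eta_u$.** For $u\in Q^\times$ let $\eta_u$ be the path $s\mapsto \frac u2+i\bigl(\frac1s-\frac1{1-s}\bigr)$, $0<s<1$, and let $f_{a,b,t}=(x-a)^{-1}\exp(t\log(x-b))\,dx$, expanded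 as a power series in $t$. Here $\log\eta_u(s)$ is the principal branch, and $\log(\eta_u(s)-u^{-1})$ is the continuous branch on $0<s<1$ with $\lim_{s\to1}\bigl(\log(\eta_u(s)-u^{-1})-\log\eta_u(s)\bigr)=0$. Integrals are taken coefficientwise in $t$. **Statement.** For $r\ge1$, $z_1,\dots,z_r\in Q$ and positive integers $k_1,\dots,k_r$ the regularized integrals above and below exist, and in $\mathbb C[[t]]$ $$\sum_{n=0}^\infty\mathcal L^\star_{RS,\alpha}\binom{z_1,\dots,z_r,\{1\}^n}{k_1,\dots,k_r,\{1\}^n}t^n=\frac{(-1)^{k_1+\cdots+k_r}}{2\pi i}\sum_{u\in Q^\times}u^\alpha I_{\eta_u}\Bigl((e_{z_1/u}-e_0)e_0^{k_1-1}e_{z_2/u}e_0^{k_2-1}\cdots e_{z_r/u}e_0^{k_r-1}(f_{1/u,1/u,t}-f_{0,0,t})\Bigr).$$ -/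

import Mathlib

open Filter Topology Asymptotics
open scoped PowerSeries.WithPiTopology

noncomputable section

namespace SymMPL

/-! ### Iterated integrals and their regularization

A `1`-form along a path `γ : (0,1) → ℂ` is represented by its pull-back `φ(t) dt` to the parameter
interval, i.e. by a function `φ : ℝ → ℂ`; a word in `1`-forms is a list of such functions. -/

/-- The iterated integral `∫_{a < t₁ < ⋯ < tₖ < b} φ₁(t₁) ⋯ φₖ(tₖ) dt₁ ⋯ dtₖ` of the word
`[φ₁, …, φₖ]`, written as an iteration of one-dimensional integrals; it is `1` for the empty
word. -/
def iterInt : List (ℝ → ℂ) → ℝ → ℝ → ℂ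
  | [], _, _ => 1
  | φ :: w, a, b => ∫ s in a..b, φ s * iterInt w s b

/-- `v` is the regularized value as `z → +0` of `F`: there is a polynomial `P` with
`F(z) = P(log z) + O(z (log z)^J)` for some `J`, and `v = P(0)`.
(Such a `P` is unique, hence so is `v`.) -/
def IsRegValue (F : ℝ → ℂ) (v : ℂ) : Prop :=
  ∃ (P : Polynomial ℂ) (J : ℕ),
    ((fun z : ℝ => F z - P.eval (Real.log z : ℂ)) =O[𝓝[>] (0 : ℝ)]
      fun z : ℝ => z * |Real.log z| ^ J) ∧
    P.eval 0 = v

/-- The regularized iterated integral of the word `w` exists. -/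
def RegExists (w : List (ℝ → ℂ)) : Prop :=
  ∃ v : ℂ, IsRegValue (fun z => iterInt w z (1 - z)) v

open Classical in
/-- The regularized iterated integral of the word `w`: the constant term of the asymptotic
expansion in `log z` of the iterated integral over the shortened parameter interval `[z, 1 - z]`
(and `0` if there is no such expansion). -/
def regInt (w : List (ℝ → ℂ)) : ℂ :=
  if h : RegExists w then h.choose else 0

/-- The form `e_a = dx / (x - a)`, pulled back along `γ`. -/
def eForm (γ : ℝ → ℂ) (a : ℂ) : ℝ → ℂ := fun t => deriv γ t / (γ t - a)

/-- The form `e_{u/z}` pulled back along `γ`, where `e_∞ = 0`, that is, it vanishes for `z = 0`. -/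
def eQuot (γ : ℝ → ℂ) (u z : ℂ) : ℝ → ℂ := if z = 0 then 0 else eForm γ (u / z)

/-- The coefficient of `tⁿ` (with `t` the formal variable) in the form
`f_{a,b,t} = (x - a)⁻¹ exp(t log(x - b)) dx`, pulled back along `γ`. The argument `L` is the branch
of `log(x - b)` along `γ`, i.e. `s ↦ log(γ(s) - b)`. -/
def fForm (γ : ℝ → ℂ) (a : ℂ) (L : ℝ → ℂ) (n : ℕ) : ℝ → ℂ :=
  fun s => deriv γ s / (γ s - a) * (L s ^ n / (n.factorial : ℂ))

/-! ### The set `Q` and the loop `β` -/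

/-- The standing assumptions on the finite set `Q` of complex numbers. -/
structure IsAdmissible (Q : Finset ℂ) : Prop where
  zero_mem : (0 : ℂ) ∈ Q
  one_mem : (1 : ℂ) ∈ Q
  not_mem_Ioo : ∀ x : ℝ, 0 < x → x < 1 → (x : ℂ) ∉ Q
  re_pos : ∀ u ∈ Q, u ≠ 0 → 0 < u.re
  norm_sub : ∀ u ∈ Q, u ≠ 0 → 1 / 4 < ‖u - 1 / 4‖
  re_div_lt : ∀ u ∈ Q, ∀ v ∈ Q, v ≠ 0 → u ≠ v → 2 * (u / v).re < v.re

/-- The loop `β = dch · c · dch⁻¹` that goes from `0` to (near) `1` on the real axis, once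
counterclockwise around `1`, and back to `0`. Iterated integrals along `β` only depend on its
homotopy class (with its unit tangent vectors at the end points), and
`β(t) = 1 - (1 - t + t²) exp(2πi (3t² - 2t³))` is a smooth representative of the class:
`β(0) = β(1) = 0`, `β'(0) = 1`, `β'(1) = -1`, and for `0 < t < 1` it runs in the punctured disc
`0 < |y - 1| < 1`, winding once counterclockwise around `1`. For admissible `Q` that punctured disc
contains no quotient `a / b` with `a, b ∈ Q`, `b ≠ 0`. -/
def β (t : ℝ) : ℂ :=
  1 - (1 - t + t ^ 2 : ℂ) * Complex.exp (2 * Real.pi * Complex.I * (3 * t ^ 2 - 2 * t ^ 3))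

/-! ### Refined symmetric multiple polylogarithms

An array `(z₁, …, z_r; k₁, …, k_r)` is represented by the list of its columns `(zᵢ, kᵢ)`. -/

/-- The word `e_{u/z₁} e₀^{k₁-1} ⋯ e_{u/z_r} e₀^{k_r-1} e_u e₀ⁿ` along `β`. -/
def rsWord (u : ℂ) (w : List (ℂ × ℕ)) (n : ℕ) : List (ℝ → ℂ) :=
  w.flatMap (fun p => eQuot β u p.1 :: List.replicate (p.2 - 1) (eForm β 0)) ++
    eForm β u :: List.replicate n (eForm β 0)

/-- The refined symmetric multiple polylogarithm
`(-1)^r / (2πi) ∑_{u ∈ Q, u ≠ 0} u^α ∑_n I_β(e_{u/z₁} e₀^{k₁-1} ⋯ e_{u/z_r} e₀^{k_r-1} e_u e₀ⁿ) tⁿ`,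
a formal power series in `t`. -/
def rs (Q : Finset ℂ) (α : ℤ) (w : List (ℂ × ℕ)) : PowerSeries ℂ :=
  PowerSeries.mk fun n =>
    (-1) ^ w.length / (2 * Real.pi * Complex.I) *
      ∑ u ∈ Q.erase 0, u ^ α * regInt (rsWord u w n)

/-- Merge consecutive columns into one: keep the first `z` and add up the `k`s. -/
def merge (b : List (ℂ × ℕ)) : ℂ × ℕ :=
  ((b.map Prod.fst).headD 0, (b.map Prod.snd).sum)

/-- The star version: the sum of `rs` over all ways to cut a nonempty array into consecutive
nonempty blocks, each block being merged into one column. -/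
def rsStar (Q : Finset ℂ) (α : ℤ) (w : List (ℂ × ℕ)) : PowerSeries ℂ :=
  ∑ c : Composition w.length, rs Q α ((w.splitWrtComposition c).map merge)

/-! ### The integrals along `η_u` -/

/-- The path `η_u(t) = u/2 + i (1/t - 1/(1-t))`, `0 < t < 1`, from `∞` to `∞`: it runs down the
vertical line through `u/2`. -/
def eta (u : ℂ) (t : ℝ) : ℂ := u / 2 + Complex.I * ((t : ℂ)⁻¹ - (1 - (t : ℂ))⁻¹)

/-- `L` is the branch of `t ↦ log(η_u(t) - u⁻¹)` on `(0,1)` such that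
`log(η_u(t) - u⁻¹) - log(η_u(t)) → 0` as `t → 1`. Here `log(η_u(t))` is the principal logarithm,
`η_u` lying in the right half-plane. There is exactly one such branch on `(0,1)`. -/
structure IsLogBranch (u : ℂ) (L : ℝ → ℂ) : Prop where
  continuousOn : ContinuousOn L (Set.Ioo 0 1)
  exp_eq : ∀ t ∈ Set.Ioo (0 : ℝ) 1, Complex.exp (L t) = eta u t - u⁻¹
  tendsto : Tendsto (fun t => L t - Complex.log (eta u t)) (𝓝[<] (1 : ℝ)) (𝓝 0)

/-- The word `(e_{z₁/u} - e₀) e₀^{k₁-1} e_{z₂/u} e₀^{k₂-1} ⋯ e_{z_r/u} e₀^{k_r-1}` along `η_u`. -/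
def etaPrefix (u : ℂ) : List (ℂ × ℕ) → List (ℝ → ℂ)
  | [] => []
  | (z, k) :: w =>
    (eForm (eta u) (z / u) - eForm (eta u) 0) :: List.replicate (k - 1) (eForm (eta u) 0) ++
      w.flatMap (fun p => eForm (eta u) (p.1 / u) :: List.replicate (p.2 - 1) (eForm (eta u) 0))

/-- The coefficient of `tᵐ` in the word
`(e_{z₁/u} - e₀) e₀^{k₁-1} ⋯ e_{z_r/u} e₀^{k_r-1} (f_{1/u,1/u,t} - f_{0,0,t})` along `η_u`, where `L`
is the branch of `log(η_u - u⁻¹)`. -/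
def etaWord (u : ℂ) (L : ℝ → ℂ) (w : List (ℂ × ℕ)) (m : ℕ) : List (ℝ → ℂ) :=
  etaPrefix u w ++
    [fForm (eta u) u⁻¹ L m - fForm (eta u) 0 (fun t => Complex.log (eta u t)) m]

/-- The power series
`I_{η_u}((e_{z₁/u} - e₀) e₀^{k₁-1} ⋯ e_{z_r/u} e₀^{k_r-1} (f_{1/u,1/u,t} - f_{0,0,t}))` in `t`. -/
def etaInt (u : ℂ) (L : ℝ → ℂ) (w : List (ℂ × ℕ)) : PowerSeries ℂ :=
  PowerSeries.mk fun m => regInt (etaWord u L w m)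

end SymMPL

end

noncomputable section

namespace SymMPL

open Set MeasureTheory intervalIntegral

/-! Substitute `x = 1/y`. Along `1/β` the form `e_0` becomes `-e_0` and `e_{u/z}` becomes `e_{z/u} -
e_0` (`eQuot_beta`). The trailing `e_0^n` integrates to `(log x)^n / n!`: since `β'(1) = -1`, the
end point contributes nothing to the constant term (`isRegValue_append_replicate`,
`isRegValue_logInvBeta`). So `e_u e_0^n` becomes `(e_{1/u} - e_0) (log x)^n / n!`. A word that
starts with a difference `e_a - e_0` and ends like this gives a convergent integral.

The star sum is pure algebra. Put `f = -e_0` and `g z = e_{z/u} - e_0`. Merging a column with its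
left neighbour replaces `g z` by `f`, and the sign attached to the number of blocks turns the sum
into `f - g z = -e_{z/u}` at every column but the first (`sum_columnProd_merge`). Hence each star
value is, up to the sign given by the weight, a single integral along `1/β` of `(e_{z₁/u} - e_0)
e_0^{k₁-1} e_{z₂/u} ⋯ (e_{1/u} - e_0) (log x)^m / m!` (`sum_regInt_rsWord`).

Next the contour is deformed. Choose `c` slightly below `Re u / 2`. By admissibility every `z/u`
lies to the left of `Re x = c` or equals `1`, while `1/β` and `η_u` both run inside `Re x > c` slit
along `[1, ∞)`, from infinity above the slit to infinity below it. The map `x = c + (1 - c) cos φ`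
sends the strip `0 < Re φ < π/2` to this domain. There `e_a` is bounded and `e_a - e_0` decays
exponentially far from the real axis, so the iterated integrals are given by holomorphic functions
on the strip that do not depend on the path (`exists_strip_pathTail`, `exists_total_pathTail_eq`).

Finally, with `b = 1/u`, repeated integration by parts writes the coefficient of `t^m` in `f_{b,b,t}
- f_{0,0,t}` as `∑ (-1)^n e_b^n (e_b - e_0) (log x)^{m-n} / (m-n)!` (`tail_logDiff`). The letters
`e_b^n` are exactly what the appended columns `{1}^n` produce, and `regInt_etaWord` matches the two
sides.

Analytically, integration up to the end point `1` acts as an endomorphism of a space `Decay` of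
functions vanishing at `1`, so words become products in a ring. `exists_norm_sub_iterInt_le`
compares these ideal integrals with the truncated ones. -/

/-! ### The logarithmic weight on the unit interval -/

/-- The weight `1 - log t - log (1 - t)`, which is at least `1` on `(0,1)`. -/
def lam (t : ℝ) : ℝ := 1 - Real.log t - Real.log (1 - t)

lemma lam_one_sub (t : ℝ) : lam (1 - t) = lam t := by
  simp only [lam, sub_sub_cancel]; ring

lemma one_le_lam {t : ℝ} (ht : t ∈ Ioo (0 : ℝ) 1) : 1 ≤ lam t := by
  have h1 := Real.log_nonpos ht.1.le ht.2.le
  have h2 := Real.log_nonpos (sub_pos.2 ht.2).le (by linarith [ht.1] : 1 - t ≤ 1)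
  simp only [lam]; linarith

lemma lam_pos {t : ℝ} (ht : t ∈ Ioo (0 : ℝ) 1) : 0 < lam t :=
  lt_of_lt_of_le one_pos (one_le_lam ht)

lemma lam_eq {t : ℝ} (ht : t ∈ Ioo (0 : ℝ) 1) : lam t = 1 - Real.log (t * (1 - t)) := by
  rw [Real.log_mul ht.1.ne' (sub_pos.2 ht.2).ne', lam]; ring

/-- The weight is `1 - log (t (1 - t))`, and on `[z, 1 - z]` the product `t (1 - t)` is smallest at
the end points. -/
lemma lam_le_lam {z s : ℝ} (hz : 0 < z) (hs : s ∈ Icc z (1 - z)) : lam s ≤ lam z := by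
  have hz1 : z ∈ Ioo (0 : ℝ) 1 := ⟨hz, by linarith [hs.1, hs.2]⟩
  have hs1 : s ∈ Ioo (0 : ℝ) 1 := ⟨by linarith [hs.1], by linarith [hs.2]⟩
  rw [lam_eq hz1, lam_eq hs1]
  have : Real.log (z * (1 - z)) ≤ Real.log (s * (1 - s)) := by
    apply Real.log_le_log (mul_pos hz (sub_pos.2 hz1.2))
    nlinarith [hs.1, hs.2]
  linarith

lemma hasDerivAt_lam {t : ℝ} (ht : t ∈ Ioo (0 : ℝ) 1) :
    HasDerivAt lam (-t⁻¹ + (1 - t)⁻¹) t := by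
  have h1 := Real.hasDerivAt_log ht.1.ne'
  have h2 := ((hasDerivAt_id t).const_sub 1).log (sub_pos.2 ht.2).ne'
  have h3 := ((hasDerivAt_const t (1 : ℝ)).sub h1).sub h2
  have h4 : (0 - t⁻¹ - -1 / (1 - id t)) = -t⁻¹ + (1 - t)⁻¹ := by
    simp only [id]; ring
  rw [h4] at h3
  exact h3

lemma continuousOn_lam : ContinuousOn lam (Ioo 0 1) := fun _ ht =>
  (hasDerivAt_lam ht).continuousAt.continuousWithinAt

lemma pow_lam_le {t : ℝ} (ht : t ∈ Ioo (0 : ℝ) 1) {m n : ℕ} (h : m ≤ n) :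
    lam t ^ m ≤ lam t ^ n := pow_le_pow_right₀ (one_le_lam ht) h

/-- A primitive dominating `lam ^ J / t`. -/
def lamMajorant (J : ℕ) (t : ℝ) : ℝ := (1 - t) * (4 * (J + 1) + lam t) ^ (J + 1)

lemma hasDerivAt_lamMajorant (J : ℕ) {t : ℝ} (ht : t ∈ Ioo (0 : ℝ) 1) :
    HasDerivAt (lamMajorant J)
      (-((4 * (J + 1) + lam t) ^ J * ((4 * (J + 1) + lam t) + (J + 1) / t - 2 * (J + 1)))) t := by
  have h1 := ((hasDerivAt_lam ht).const_add (4 * (J + 1 : ℝ))).pow (J + 1)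
  have h2 := ((hasDerivAt_id t).const_sub 1).mul h1
  refine h2.congr_deriv ?_
  have ht0 := ht.1.ne'
  have ht1 := (sub_pos.2 ht.2).ne'
  simp only [Nat.cast_add, Nat.cast_one, Nat.add_sub_cancel, id]
  simp only [Pi.pow_apply]
  generalize lam t = x
  field_simp
  ring

lemma continuousOn_pow_lam_div (J : ℕ) : ContinuousOn (fun t => lam t ^ J / t) (Ioo 0 1) :=
  (continuousOn_lam.pow J).div continuousOn_id fun _ ht => ht.1.ne'

lemma integral_pow_lam_div_le_of_lt (J : ℕ) {s b : ℝ} (hs : 0 < s) (hsb : s ≤ b) (hb : b < 1) :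
    ∫ t in s..b, lam t ^ J / t ≤ lamMajorant J s := by
  have hsub : Icc s b ⊆ Ioo 0 1 := fun t ht => ⟨hs.trans_le ht.1, ht.2.trans_lt hb⟩
  have hderiv : ∀ t ∈ Icc s b, HasDerivAt (lamMajorant J) _ t := fun t ht =>
    hasDerivAt_lamMajorant J (hsub ht)
  have hcont : ContinuousOn (fun t => (-((4 * (J + 1 : ℝ) + lam t) ^ J *
      ((4 * (J + 1) + lam t) + (J + 1) / t - 2 * (J + 1))))) (Icc s b) := by
    have h1 := continuousOn_lam.mono hsub
    have h2 : ContinuousOn (fun t : ℝ => (J + 1 : ℝ) / t) (Icc s b) :=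
      continuousOn_const.div continuousOn_id fun t ht => (hsub ht).1.ne'
    exact (((continuousOn_const.add h1).pow J).mul
      (((continuousOn_const.add h1).add h2).sub continuousOn_const)).neg
  have hint := integral_eq_sub_of_hasDerivAt (a := s) (b := b)
    (fun t ht => hderiv t (by rwa [uIcc_of_le hsb] at ht))
    (ContinuousOn.intervalIntegrable (by rwa [uIcc_of_le hsb]))
  have hmono : ∫ t in s..b, lam t ^ J / t ≤ ∫ t in s..b, ((4 * (J + 1 : ℝ) + lam t) ^ J *
      ((4 * (J + 1) + lam t) + (J + 1) / t - 2 * (J + 1))) := by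
    apply integral_mono_on hsb
    · exact ContinuousOn.intervalIntegrable (by
        rw [uIcc_of_le hsb]; exact (continuousOn_pow_lam_div J).mono hsub)
    · have := hcont.neg
      refine ContinuousOn.intervalIntegrable ?_
      rw [uIcc_of_le hsb]
      exact this.congr fun t _ => (neg_neg _).symm
    · intro t ht
      have hl := one_le_lam (hsub ht)
      have ht0 := (hsub ht).1
      have hJ : (0 : ℝ) ≤ J := Nat.cast_nonneg J
      rw [div_eq_mul_inv]
      -- The shift `4 (J + 1)` in the majorant outweighs the term `-2 (J + 1)` of the derivative, so
      -- the second factor is at least `(J + 1) / t ≥ 1 / t`.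
      apply mul_le_mul _ _ (inv_nonneg.2 ht0.le) (by positivity)
      · exact pow_le_pow_left₀ (by linarith) (by linarith) J
      · have h3 : t⁻¹ ≤ (J + 1) / t := by
          rw [inv_eq_one_div]; gcongr; linarith
        linarith
  have hb0 : 0 ≤ lamMajorant J b := by
    have hl := one_le_lam (hsub (right_mem_Icc.2 hsb))
    exact mul_nonneg (by linarith) (pow_nonneg (by positivity) _)
  rw [intervalIntegral.integral_neg] at hint
  linarith

/-- The bound `lamMajorant J s` is uniform in the upper limit, so an exhaustion of `(s, 1)` gives
integrability up to `1`. -/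
lemma intervalIntegrable_pow_lam_div (J : ℕ) {s : ℝ} (hs : s ∈ Ioo (0 : ℝ) 1) :
    IntervalIntegrable (fun t => lam t ^ J / t) volume s 1 := by
  rw [intervalIntegrable_iff_integrableOn_Ioc_of_le hs.2.le]
  have hs1 : 0 < 1 - s := sub_pos.2 hs.2
  set b : ℕ → ℝ := fun n => 1 - (1 - s) / (n + 1) with hbdef
  have hb1 : ∀ n, b n < 1 := fun n => sub_lt_self _ (by positivity)
  have hbs : ∀ n, s ≤ b n := fun n => by
    have : (1 - s) / (n + 1) ≤ 1 - s := div_le_self hs1.le (by linarith [n.cast_nonneg (α := ℝ)])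
    simp only [hbdef]; linarith
  have hsub : ∀ n, Icc s (b n) ⊆ Ioo 0 1 := fun n t ht =>
    ⟨hs.1.trans_le ht.1, ht.2.trans_lt (hb1 n)⟩
  refine integrableOn_Ioc_of_intervalIntegral_norm_bounded_right (l := atTop) (b := b)
    (I := lamMajorant J s) (fun n => ?_) ?_ (Eventually.of_forall fun n => ?_)
  · exact (((continuousOn_pow_lam_div J).mono (hsub n)).integrableOn_Icc).mono_set
      Ioc_subset_Icc_self
  · have h : Tendsto (fun n : ℕ => 1 / ((n : ℝ) + 1)) atTop (𝓝 0) :=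
      tendsto_one_div_add_atTop_nhds_zero_nat
    have := (h.const_mul (1 - s)).const_sub 1
    simpa [hbdef, div_eq_mul_inv] using this
  · rw [← integral_of_le (hbs n)]
    refine le_trans (le_of_eq ?_) (integral_pow_lam_div_le_of_lt J hs.1 (hbs n) (hb1 n))
    refine integral_congr fun t ht => ?_
    rw [uIcc_of_le (hbs n)] at ht
    have ht' := hsub n ht
    exact Real.norm_of_nonneg (div_nonneg (pow_nonneg (lam_pos ht').le _) ht'.1.le)

/-- As the weight is at least `1`, the shift is absorbed: `4 (J + 1) + lam s ≤ (4 (J + 1) + 1) * lam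
s`. -/
lemma lamMajorant_le (J : ℕ) {s : ℝ} (hs : s ∈ Ioo (0 : ℝ) 1) :
    lamMajorant J s ≤ (4 * (J + 1) + 1) ^ (J + 1) * ((1 - s) * lam s ^ (J + 1)) := by
  have h1 := one_le_lam hs
  have h2 : 0 ≤ 1 - s := sub_nonneg.2 hs.2.le
  rw [lamMajorant, mul_left_comm, ← mul_pow]
  refine mul_le_mul_of_nonneg_left (pow_le_pow_left₀ (by positivity) ?_ _) h2
  nlinarith [(J.cast_nonneg : (0 : ℝ) ≤ J)]

lemma integral_pow_lam_div_le (J : ℕ) {s : ℝ} (hs : s ∈ Ioo (0 : ℝ) 1) :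
    ∫ t in s..1, lam t ^ J / t ≤ (4 * (J + 1) + 1) ^ (J + 1) * ((1 - s) * lam s ^ (J + 1)) := by
  refine le_trans ?_ (lamMajorant_le J hs)
  have hint := intervalIntegrable_pow_lam_div J hs
  have hcont := (continuousOn_primitive_interval' hint left_mem_uIcc) 1 right_mem_uIcc
  have hcont' : Tendsto (fun b => ∫ t in s..b, lam t ^ J / t) (𝓝[<] 1)
      (𝓝 (∫ t in s..1, lam t ^ J / t)) := by
    refine hcont.tendsto.mono_left ?_
    rw [uIcc_of_le hs.2.le]
    exact nhdsWithin_le_of_mem (mem_of_superset (Ioo_mem_nhdsLT hs.2) Ioo_subset_Icc_self)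
  refine le_of_tendsto hcont' ?_
  filter_upwards [Ioo_mem_nhdsLT hs.2] with b hb
  exact integral_pow_lam_div_le_of_lt J hs.1 hb.1.le hb.2

/-! ### Integrands with controlled growth -/

/-- Integrands on `(0,1)` with at most logarithmic growth at `1` and at most a simple pole times
logarithmic growth at `0`. -/
structure IsTail (f : ℝ → ℂ) : Prop where
  cont : ContinuousOn f (Ioo 0 1)
  bound : ∃ (C : ℝ) (J : ℕ), ∀ t ∈ Ioo (0 : ℝ) 1, ‖f t‖ ≤ C * (lam t ^ J / t)

/-- Integrands on `(0,1)` with at most logarithmic growth at both ends. -/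
structure IsHead (f : ℝ → ℂ) : Prop where
  cont : ContinuousOn f (Ioo 0 1)
  bound : ∃ (C : ℝ) (J : ℕ), ∀ t ∈ Ioo (0 : ℝ) 1, ‖f t‖ ≤ C * lam t ^ J

lemma IsHead.isTail {f : ℝ → ℂ} (hf : IsHead f) : IsTail f := by
  obtain ⟨C, J, h⟩ := hf.bound
  refine ⟨hf.cont, |C|, J, fun t ht => (h t ht).trans ?_⟩
  have h1 := pow_nonneg (lam_pos ht).le J
  have h2 : lam t ^ J ≤ lam t ^ J / t := by
    rw [le_div_iff₀ ht.1]; exact mul_le_of_le_one_right h1 ht.2.le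
  exact mul_le_mul (le_abs_self C) h2 h1 (abs_nonneg C)

lemma IsHead.comp_one_sub {f : ℝ → ℂ} (hf : IsHead f) : IsHead fun t => f (1 - t) := by
  have hm : ∀ t ∈ Ioo (0 : ℝ) 1, 1 - t ∈ Ioo (0 : ℝ) 1 := fun t ht =>
    ⟨by linarith [ht.2], by linarith [ht.1]⟩
  obtain ⟨C, J, h⟩ := hf.bound
  refine ⟨hf.cont.comp (by fun_prop) hm, C, J, fun t ht => ?_⟩
  simpa only [lam_one_sub] using h _ (hm t ht)

lemma IsTail.intervalIntegrable {f : ℝ → ℂ} (hf : IsTail f) {s : ℝ} (hs : s ∈ Ioo (0 : ℝ) 1) :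
    IntervalIntegrable f volume s 1 := by
  obtain ⟨C, J, h⟩ := hf.bound
  have h1 := (intervalIntegrable_pow_lam_div J hs).const_mul C
  rw [intervalIntegrable_iff_integrableOn_Ioo_of_le hs.2.le] at h1 ⊢
  refine Integrable.mono' h1 ?_ ?_
  · exact (hf.cont.mono (Ioo_subset_Ioo_left hs.1.le)).aestronglyMeasurable measurableSet_Ioo
  · refine (ae_restrict_mem measurableSet_Ioo).mono fun t ht => h t ⟨hs.1.trans ht.1, ht.2⟩

lemma IsTail.intervalIntegrable_of_mem {f : ℝ → ℂ} (hf : IsTail f) {s b : ℝ}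
    (hs : s ∈ Ioo (0 : ℝ) 1) (hb : b ∈ Ioc (0 : ℝ) 1) :
    IntervalIntegrable f volume s b := by
  rcases eq_or_lt_of_le hb.2 with rfl | hb1
  · exact hf.intervalIntegrable hs
  · refine ContinuousOn.intervalIntegrable (hf.cont.mono ?_)
    intro t ht
    exact ⟨(lt_min hs.1 hb.1).trans_le ht.1, ht.2.trans_lt (max_lt hs.2 hb1)⟩

lemma IsTail.exists_norm_integral_le {f : ℝ → ℂ} (hf : IsTail f) :
    ∃ (C : ℝ) (J : ℕ), 0 ≤ C ∧ ∀ s ∈ Ioo (0 : ℝ) 1,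
      ‖∫ t in s..1, f t‖ ≤ C * ((1 - s) * lam s ^ J) := by
  obtain ⟨C, J, h⟩ := hf.bound
  refine ⟨|C| * (4 * (J + 1) + 1) ^ (J + 1), J + 1, by positivity, fun s hs => ?_⟩
  have h1 : ‖∫ t in s..1, f t‖ ≤ ∫ t in s..1, |C| * (lam t ^ J / t) := by
    refine norm_integral_le_of_norm_le hs.2.le ?_
      ((intervalIntegrable_pow_lam_div J hs).const_mul _)
    have hne : ∀ᵐ t : ℝ, t ≠ 1 := by simp [ae_iff, measure_singleton]
    filter_upwards [hne] with t ht1 ht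
    have ht' : t ∈ Ioo (0 : ℝ) 1 := ⟨hs.1.trans ht.1, lt_of_le_of_ne ht.2 ht1⟩
    refine (h t ht').trans (mul_le_mul_of_nonneg_right (le_abs_self C) ?_)
    exact div_nonneg (pow_nonneg (lam_pos ht').le _) ht'.1.le
  rw [intervalIntegral.integral_const_mul] at h1
  refine h1.trans ?_
  rw [mul_assoc]
  exact mul_le_mul_of_nonneg_left (integral_pow_lam_div_le J hs) (abs_nonneg C)

lemma IsTail.hasDerivAt_integral {f : ℝ → ℂ} (hf : IsTail f) {s : ℝ} (hs : s ∈ Ioo (0 : ℝ) 1) :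
    HasDerivAt (fun s => ∫ t in s..1, f t) (-f s) s := by
  have hnhds := Ioo_mem_nhds hs.1 hs.2
  refine integral_hasDerivAt_left (hf.intervalIntegrable hs) ?_ (hf.cont.continuousAt hnhds)
  exact hf.cont.stronglyMeasurableAtFilter isOpen_Ioo s hs

/-- The weight increases on `[1/2, 1)`, so the product is at most `∫_s^1 lam t ^ J / t`, the tail of
a convergent integral. -/
lemma tendsto_one_sub_mul_lam_pow (J : ℕ) :
    Tendsto (fun s => (1 - s) * lam s ^ J) (𝓝[<] 1) (𝓝 0) := by
  have h2 : (1 / 2 : ℝ) ∈ Ioo (0 : ℝ) 1 := by norm_num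
  have hint := intervalIntegrable_pow_lam_div J h2
  have hcont := (continuousOn_primitive_interval_left
    ((intervalIntegrable_iff').1 hint)) 1 right_mem_uIcc
  have hlim : Tendsto (fun s => ∫ t in s..1, lam t ^ J / t) (𝓝[<] 1) (𝓝 0) := by
    have := hcont.tendsto
    rw [integral_same, uIcc_of_le h2.2.le] at this
    exact this.mono_left
      (nhdsWithin_le_of_mem (mem_of_superset (Ioo_mem_nhdsLT h2.2) Ioo_subset_Icc_self))
  refine squeeze_zero' ?_ ?_ hlim
  · filter_upwards [Ioo_mem_nhdsLT h2.2] with s hs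
    exact mul_nonneg (by linarith [hs.2]) (pow_nonneg (lam_pos ⟨by linarith [hs.1], hs.2⟩).le _)
  · filter_upwards [Ioo_mem_nhdsLT h2.2] with s hs
    have hs' : s ∈ Ioo (0 : ℝ) 1 := ⟨by linarith [hs.1], hs.2⟩
    have h3 : ∫ _ in s..1, lam s ^ J = (1 - s) * lam s ^ J := by simp
    rw [← h3]
    refine integral_mono_on_of_le_Ioo hs.2.le (by simp) (intervalIntegrable_pow_lam_div J hs')
      fun t ht => ?_
    have ht' : t ∈ Ioo (0 : ℝ) 1 := ⟨hs'.1.trans ht.1, ht.2⟩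
    have h4 : lam s ≤ lam t := by
      rw [← lam_one_sub t]
      exact lam_le_lam (by linarith [ht.2]) ⟨by linarith [hs.1, ht.1], by linarith [ht.1]⟩
    rw [le_div_iff₀ ht'.1]
    have h5 := pow_le_pow_left₀ (lam_pos hs').le h4 J
    have h6 := pow_nonneg (lam_pos hs').le J
    nlinarith [ht'.2]

lemma IsTail.integral_eq {f F : ℝ → ℂ} (hf : IsTail f)
    (hF : ∀ t ∈ Ioo (0 : ℝ) 1, HasDerivAt F (-f t) t) (h1 : Tendsto F (𝓝[<] 1) (𝓝 0))
    {s : ℝ} (hs : s ∈ Ioo (0 : ℝ) 1) : ∫ t in s..1, f t = F s := by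
  have hint := hf.intervalIntegrable hs
  have h := integral_eq_sub_of_hasDerivAt_of_tendsto (f := fun t => -F t) (f' := f) hs.2
    (fun t ht => by
      have h2 := (hF t ⟨hs.1.trans ht.1, ht.2⟩).neg
      rw [neg_neg] at h2
      exact h2) hint
    (((hF s hs).continuousAt.neg.tendsto).mono_left nhdsWithin_le_nhds) h1.neg
  rw [h]; simp

/-- The weight is symmetric under `t ↦ 1 - t`, so the end `0` reduces to the end `1`. -/
lemma IsHead.intervalIntegrable {f : ℝ → ℂ} (hf : IsHead f) :
    IntervalIntegrable f volume 0 1 := by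
  have h2 : (1 / 2 : ℝ) ∈ Ioo (0 : ℝ) 1 := by norm_num
  have h1 := hf.isTail.intervalIntegrable h2
  have h3 := (hf.comp_one_sub.isTail.intervalIntegrable h2).comp_sub_left 1
  simp only [sub_sub_cancel, sub_self] at h3
  norm_num at h1 h3
  exact h3.symm.trans h1

lemma IsHead.exists_norm_integral_le {f : ℝ → ℂ} (hf : IsHead f) :
    ∃ (C : ℝ) (J : ℕ), 0 ≤ C ∧ ∀ s ∈ Ioo (0 : ℝ) 1,
      ‖∫ t in (0 : ℝ)..s, f t‖ ≤ C * (s * lam s ^ J) := by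
  obtain ⟨C, J, hC, h⟩ := hf.comp_one_sub.isTail.exists_norm_integral_le
  refine ⟨C, J, hC, fun s hs => ?_⟩
  have := h (1 - s) ⟨by linarith [hs.2], by linarith [hs.1]⟩
  rw [lam_one_sub, sub_sub_cancel, integral_comp_sub_left (fun t => f t) 1] at this
  simpa using this

/-! ### Spaces of integrands and the integration operators -/

/-- Functions on `(0,1)` with at most simple poles at the end points. -/
def Letter : Submodule ℂ (ℝ → ℂ) where
  carrier := {φ | ContinuousOn φ (Ioo 0 1) ∧
    ∃ C : ℝ, ∀ t ∈ Ioo (0 : ℝ) 1, ‖φ t‖ ≤ C / (t * (1 - t))}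
  add_mem' := by
    rintro f g ⟨hf, C, hC⟩ ⟨hg, D, hD⟩
    refine ⟨hf.add hg, C + D, fun t ht => (norm_add_le _ _).trans ?_⟩
    rw [add_div]
    exact add_le_add (hC t ht) (hD t ht)
  zero_mem' := ⟨continuousOn_const, 0, by simp⟩
  smul_mem' := by
    rintro c f ⟨hf, C, hC⟩
    refine ⟨hf.const_smul c, ‖c‖ * C, fun t ht => ?_⟩
    rw [Pi.smul_apply, norm_smul, mul_div_assoc]
    exact mul_le_mul_of_nonneg_left (hC t ht) (norm_nonneg c)

/-- Functions on `(0,1)`, extended by zero, with at most logarithmic growth at `0` that vanish at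
`1` to first order up to logarithms. -/
def Decay : Submodule ℂ (ℝ → ℂ) where
  carrier := {k | ContinuousOn k (Ioo 0 1) ∧ (∀ s, s ∉ Ioo (0 : ℝ) 1 → k s = 0) ∧
    ∃ (C : ℝ) (J : ℕ), 0 ≤ C ∧ ∀ s ∈ Ioo (0 : ℝ) 1, ‖k s‖ ≤ C * ((1 - s) * lam s ^ J)}
  add_mem' := by
    rintro f g ⟨hf, hf0, C, J, hC0, hC⟩ ⟨hg, hg0, D, J', hD0, hD⟩
    refine ⟨hf.add hg, fun s hs => by simp [hf0 s hs, hg0 s hs], C + D, max J J',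
      add_nonneg hC0 hD0, fun t ht => (norm_add_le _ _).trans ?_⟩
    have h1 : 0 ≤ 1 - t := by linarith [ht.2]
    rw [add_mul]
    exact add_le_add
      ((hC t ht).trans (mul_le_mul_of_nonneg_left
        (mul_le_mul_of_nonneg_left (pow_lam_le ht (le_max_left _ _)) h1) hC0))
      ((hD t ht).trans (mul_le_mul_of_nonneg_left
        (mul_le_mul_of_nonneg_left (pow_lam_le ht (le_max_right _ _)) h1) hD0))
  zero_mem' := ⟨continuousOn_const, by simp, 0, 0, le_rfl, by simp⟩
  smul_mem' := by
    rintro c f ⟨hf, hf0, C, J, hC0, hC⟩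
    refine ⟨hf.const_smul c, fun s hs => by simp [hf0 s hs], ‖c‖ * C, J,
      mul_nonneg (norm_nonneg c) hC0, fun t ht => ?_⟩
    rw [Pi.smul_apply, norm_smul, mul_assoc]
    exact mul_le_mul_of_nonneg_left (hC t ht) (norm_nonneg c)

/-- The integrands of `IsTail` as a vector space. -/
def Tail : Submodule ℂ (ℝ → ℂ) where
  carrier := {f | IsTail f}
  add_mem' := by
    rintro f g ⟨hf, C, J, hC⟩ ⟨hg, D, J', hD⟩
    refine ⟨hf.add hg, |C| + |D|, max J J', fun t ht => (norm_add_le _ _).trans ?_⟩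
    have h1 : ∀ (E : ℝ) (i : ℕ), i ≤ max J J' →
        E * (lam t ^ i / t) ≤ |E| * (lam t ^ (max J J') / t) := fun E i hi =>
      mul_le_mul (le_abs_self E) (div_le_div_of_nonneg_right (pow_lam_le ht hi) ht.1.le)
        (div_nonneg (pow_nonneg (lam_pos ht).le _) ht.1.le) (abs_nonneg E)
    rw [add_mul]
    exact add_le_add ((hC t ht).trans (h1 _ _ (le_max_left _ _)))
      ((hD t ht).trans (h1 _ _ (le_max_right _ _)))
  zero_mem' := ⟨continuousOn_const, 0, 0, by simp⟩
  smul_mem' := by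
    rintro c f ⟨hf, C, J, hC⟩
    refine ⟨hf.const_smul c, ‖c‖ * C, J, fun t ht => ?_⟩
    rw [Pi.smul_apply, norm_smul, mul_assoc]
    exact mul_le_mul_of_nonneg_left (hC t ht) (norm_nonneg c)

/-- The zero at `1` of a function in `Decay` cancels the pole of the letter there, and only the pole
at `0` survives. Integrating from `s` to `1` then lands in `Decay` again, so letters can be
iterated. -/
lemma isTail_mul (φ : Letter) (k : Decay) : IsTail (φ.1 * k.1) := by
  obtain ⟨hφ, C, hC⟩ := φ.2
  obtain ⟨hk, -, D, J, hD0, hD⟩ := k.2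
  refine ⟨hφ.mul hk, C * D, J, fun t ht => ?_⟩
  have h1 : 0 < 1 - t := by linarith [ht.2]
  have ht0 := ht.1
  have h2 := lam_pos ht
  rw [Pi.mul_apply, norm_mul]
  refine (mul_le_mul (hC t ht) (hD t ht) (norm_nonneg _) ((norm_nonneg _).trans (hC t ht))).trans
    (le_of_eq ?_)
  field_simp

/-- The primitive `s ↦ ∫_s^1 f` that vanishes at `1`. -/
def tail : Tail →ₗ[ℂ] Decay where
  toFun f := ⟨(Ioo (0 : ℝ) 1).indicator fun s => ∫ t in s..1, f.1 t, by
    have hf : IsTail f.1 := f.2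
    obtain ⟨C, J, hC0, hC⟩ := hf.exists_norm_integral_le
    refine ⟨?_, fun s hs => indicator_of_notMem hs _, C, J, hC0, fun s hs => ?_⟩
    · refine ContinuousOn.congr (f := fun s => ∫ t in s..1, f.1 t) ?_
        fun s hs => indicator_of_mem hs _
      exact fun s hs => (hf.hasDerivAt_integral hs).continuousAt.continuousWithinAt
    · rw [indicator_of_mem hs]; exact hC s hs⟩
  map_add' f g := by
    ext s
    by_cases hs : s ∈ Ioo (0 : ℝ) 1
    · simp only [indicator_of_mem hs, Submodule.coe_add, Pi.add_apply]
      exact integral_add (IsTail.intervalIntegrable f.2 hs) (IsTail.intervalIntegrable g.2 hs)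
    · simp [indicator_of_notMem hs]
  map_smul' c f := by
    ext s
    by_cases hs : s ∈ Ioo (0 : ℝ) 1
    · simp [indicator_of_mem hs]
    · simp [indicator_of_notMem hs]

lemma tail_apply (f : Tail) {s : ℝ} (hs : s ∈ Ioo (0 : ℝ) 1) :
    (tail f).1 s = ∫ t in s..1, f.1 t :=
  indicator_of_mem hs fun s => ∫ t in s..1, f.1 t

lemma tail_eq_of_hasDerivAt (f : Tail) (k : ℝ → ℂ)
    (hk : ∀ t ∈ Ioo (0 : ℝ) 1, HasDerivAt k (-f.1 t) t) (h1 : Tendsto k (𝓝[<] 1) (𝓝 0))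
    {s : ℝ} (hs : s ∈ Ioo (0 : ℝ) 1) : (tail f).1 s = k s := by
  rw [tail_apply f hs]
  exact IsTail.integral_eq f.2 hk h1 hs

/-- The extension by zero makes identities on `(0,1)` genuine equalities in `Decay`, so operators
can be compared in its endomorphism ring. -/
lemma decay_ext {k l : Decay} (h : ∀ s ∈ Ioo (0 : ℝ) 1, k.1 s = l.1 s) : k = l := by
  ext s
  by_cases hs : s ∈ Ioo (0 : ℝ) 1
  · exact h s hs
  · rw [k.2.2.1 s hs, l.2.2.1 s hs]

lemma tail_congr {f g : Tail} (h : ∀ s ∈ Ioo (0 : ℝ) 1, f.1 s = g.1 s) : tail f = tail g := by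
  refine decay_ext fun s hs => ?_
  rw [tail_apply f hs, tail_apply g hs, integral_of_le hs.2.le, integral_of_le hs.2.le,
    integral_Ioc_eq_integral_Ioo, integral_Ioc_eq_integral_Ioo]
  exact setIntegral_congr_fun measurableSet_Ioo fun t ht => h t ⟨hs.1.trans ht.1, ht.2⟩

/-- The operator `k ↦ (s ↦ ∫_s^1 φ k)`. -/
def op : Letter →ₗ[ℂ] Module.End ℂ Decay :=
  LinearMap.mk₂ ℂ (fun φ k => tail ⟨φ.1 * k.1, isTail_mul φ k⟩)
    (fun φ φ' k => by
      rw [← map_add]; congr 1; ext t; simp [add_mul])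
    (fun c φ k => by
      rw [← map_smul]; congr 1; ext t; simp [mul_assoc])
    (fun φ k k' => by
      rw [← map_add]; congr 1; ext t; simp [mul_add])
    (fun c φ k => by
      rw [← map_smul]; congr 1; ext t; simp [mul_left_comm])

lemma op_eq (φ : Letter) (k : Decay) : op φ k = tail ⟨φ.1 * k.1, isTail_mul φ k⟩ := rfl

lemma op_congr {φ ψ : Letter} (h : ∀ s ∈ Ioo (0 : ℝ) 1, φ.1 s = ψ.1 s) : op φ = op ψ := by
  ext1 k
  rw [op_eq, op_eq]
  exact tail_congr fun s hs => by simp [h s hs]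

/-- Bounded integrands on `(0,1)`. -/
structure IsBdd (φ : ℝ → ℂ) : Prop where
  cont : ContinuousOn φ (Ioo 0 1)
  bound : ∃ C : ℝ, ∀ t ∈ Ioo (0 : ℝ) 1, ‖φ t‖ ≤ C

/-- A bounded letter adds no pole at `0`; used as the outermost letter, it makes the last integral
converge at both ends. -/
lemma IsBdd.isHead_mul {φ : ℝ → ℂ} (h : IsBdd φ) (k : Decay) : IsHead (φ * k.1) := by
  obtain ⟨hφ, C, hC⟩ := h
  obtain ⟨hk, -, D, J, hD0, hD⟩ := k.2
  refine ⟨hφ.mul hk, |C| * D, J, fun t ht => ?_⟩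
  rw [Pi.mul_apply, norm_mul, mul_assoc]
  refine mul_le_mul ((hC t ht).trans (le_abs_self C)) ((hD t ht).trans ?_) (norm_nonneg _)
    (abs_nonneg C)
  refine mul_le_mul_of_nonneg_left ?_ hD0
  exact mul_le_of_le_one_left (pow_nonneg (lam_pos ht).le _) (by linarith [ht.1])

/-- The functional `k ↦ ∫_0^1 φ k`. -/
def total (φ : ℝ → ℂ) (h : IsBdd φ) : Decay →ₗ[ℂ] ℂ where
  toFun k := ∫ t in (0 : ℝ)..1, φ t * k.1 t
  map_add' k l := by
    refine Eq.trans ?_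
      (integral_add (h.isHead_mul k).intervalIntegrable (h.isHead_mul l).intervalIntegrable)
    congr 1; ext t; simp [mul_add]
  map_smul' c k := by
    simp only [RingHom.id_apply, smul_eq_mul]
    rw [← intervalIntegral.integral_const_mul]
    congr 1; ext t; simp [mul_left_comm]

lemma total_apply (φ : ℝ → ℂ) (h : IsBdd φ) (k : Decay) :
    total φ h k = ∫ t in (0 : ℝ)..1, φ t * k.1 t := rfl

lemma total_congr {φ ψ : ℝ → ℂ} (h : IsBdd φ) (h' : IsBdd ψ)
    (heq : ∀ t ∈ Ioo (0 : ℝ) 1, φ t = ψ t) : total φ h = total ψ h' := by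
  ext k
  rw [total_apply, total_apply, integral_of_le zero_le_one, integral_of_le zero_le_one,
    integral_Ioc_eq_integral_Ioo, integral_Ioc_eq_integral_Ioo]
  exact setIntegral_congr_fun measurableSet_Ioo fun t ht => by simp only [heq t ht]

/-! ### Truncated iterated integrals -/

lemma hasDerivAt_integral_left_Ioo {g : ℝ → ℂ} (hg : ContinuousOn g (Ioo 0 1)) {s b : ℝ}
    (hs : s ∈ Ioo (0 : ℝ) 1) (hb : b ∈ Ioo (0 : ℝ) 1) :
    HasDerivAt (fun s => ∫ t in s..b, g t) (-g s) s := by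
  refine integral_hasDerivAt_left (ContinuousOn.intervalIntegrable (hg.mono ?_))
    (hg.stronglyMeasurableAtFilter isOpen_Ioo s hs) (hg.continuousAt (Ioo_mem_nhds hs.1 hs.2))
  exact fun t ht => ⟨(lt_min hs.1 hb.1).trans_le ht.1, ht.2.trans_lt (max_lt hs.2 hb.2)⟩

lemma continuousOn_iterInt {w : List (ℝ → ℂ)} (hw : ∀ φ ∈ w, ContinuousOn φ (Ioo 0 1)) {b : ℝ}
    (hb : b ∈ Ioo (0 : ℝ) 1) : ContinuousOn (fun s => iterInt w s b) (Ioo 0 1) := by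
  induction w with
  | nil => exact continuousOn_const
  | cons φ w ih =>
    have ih' := ih fun ψ hψ => hw ψ (List.mem_cons_of_mem _ hψ)
    have h1 := hw φ List.mem_cons_self
    exact fun s hs => (hasDerivAt_integral_left_Ioo (h1.mul ih') hs
      hb).continuousAt.continuousWithinAt

/-- The primitive is `log t - log (1 - t)`. This is the price, one factor `lam z`, of one more
letter in the truncation estimate. -/
lemma integral_inv_mul_one_sub_le {z s : ℝ} (hz : 0 < z) (hs : s ∈ Icc z (1 - z)) :
    IntervalIntegrable (fun t : ℝ => 1 / (t * (1 - t))) volume s (1 - z) ∧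
    ∫ t in s..(1 - z), 1 / (t * (1 - t)) ≤ 2 * lam z := by
  have hsub : ∀ t ∈ uIcc s (1 - z), t ∈ Ioo (0 : ℝ) 1 := fun t ht => by
    rw [uIcc_of_le hs.2] at ht
    exact ⟨by linarith [ht.1, hs.1], by linarith [ht.2]⟩
  have hint : IntervalIntegrable (fun t : ℝ => 1 / (t * (1 - t))) volume s (1 - z) := by
    refine ContinuousOn.intervalIntegrable (continuousOn_const.div (by fun_prop) fun t ht => ?_)
    exact mul_ne_zero (hsub t ht).1.ne' (sub_pos.2 (hsub t ht).2).ne'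
  refine ⟨hint, ?_⟩
  rw [integral_eq_sub_of_hasDerivAt (f := fun t => Real.log t - Real.log (1 - t)) _ hint]
  · have hs1 : s ∈ Ioo (0 : ℝ) 1 := hsub s left_mem_uIcc
    have hz1 : z < 1 := by linarith [hs.1, hs.2]
    have h1 : Real.log z ≤ Real.log s := Real.log_le_log hz hs.1
    have h2 : Real.log (1 - s) ≤ 0 := Real.log_nonpos (by linarith [hs1.2]) (by linarith [hs1.1])
    have h3 : Real.log (1 - z) ≤ 0 := Real.log_nonpos (by linarith) (by linarith)
    have h4 : Real.log z ≤ 0 := Real.log_nonpos hz.le hz1.le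
    simp only [lam, sub_sub_cancel]
    linarith
  · intro t ht
    have ht' := hsub t ht
    have h1 := (Real.hasDerivAt_log ht'.1.ne').sub
      (((hasDerivAt_id t).const_sub 1).log (sub_pos.2 ht'.2).ne')
    refine h1.congr_deriv ?_
    have := ht'.1.ne'
    have := (sub_pos.2 ht'.2).ne'
    simp only [id]
    field_simp
    ring

/-- Cutting off at `1 - z` loses the integral over `(1 - z, 1)`, which is `z` times a power of `lam
z`. A further letter integrates the inherited error against `1 / (t (1 - t))`, which only raises
that power by one, and loses one more such piece. -/
lemma exists_norm_sub_iterInt_le (p : List Letter) (f : Tail) :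
    ∃ (C : ℝ) (J : ℕ), 0 ≤ C ∧ ∀ z, 0 < z → ∀ s ∈ Icc z (1 - z),
      ‖((p.map op).prod (tail f)).1 s - iterInt (p.map (fun φ => φ.1) ++ [f.1]) s (1 - z)‖ ≤
        C * (z * lam z ^ J) := by
  induction p with
  | nil =>
    obtain ⟨C, J, hC0, hC⟩ := IsTail.exists_norm_integral_le f.2
    refine ⟨C, J, hC0, fun z hz s hs => ?_⟩
    have hs1 : s ∈ Ioo (0 : ℝ) 1 := ⟨by linarith [hs.1], by linarith [hs.2]⟩
    have hb1 : 1 - z ∈ Ioo (0 : ℝ) 1 := ⟨by linarith [hs.1, hs.2], by linarith⟩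
    simp only [List.map_nil, List.prod_nil, Module.End.one_apply, List.nil_append, iterInt,
      mul_one]
    rw [tail_apply f hs1, integral_interval_sub_left (IsTail.intervalIntegrable f.2 hs1)
      (IsTail.intervalIntegrable_of_mem f.2 hs1 ⟨hb1.1, hb1.2.le⟩)]
    simpa [lam_one_sub] using hC _ hb1
  | cons φ p ih =>
    obtain ⟨C, J, hC0, hC⟩ := ih
    set K := (p.map op).prod (tail f) with hK
    obtain ⟨D, J', hD0, hD⟩ := (isTail_mul φ K).exists_norm_integral_le
    obtain ⟨E, hE⟩ := φ.2.2
    refine ⟨D + 2 * |E| * C, max J' (J + 1), by positivity, fun z hz s hs => ?_⟩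
    have hs1 : s ∈ Ioo (0 : ℝ) 1 := ⟨by linarith [hs.1], by linarith [hs.2]⟩
    have hb1 : 1 - z ∈ Ioo (0 : ℝ) 1 := ⟨by linarith [hs.1, hs.2], by linarith⟩
    have hz1 : z ∈ Ioo (0 : ℝ) 1 := ⟨hz, by linarith [hb1.1]⟩
    have hsub : ∀ t ∈ Icc s (1 - z), t ∈ Ioo (0 : ℝ) 1 := fun t ht =>
      ⟨hs1.1.trans_le ht.1, ht.2.trans_lt hb1.2⟩
    have hl := lam_pos hz1
    set kb := fun t => iterInt (p.map (fun φ => φ.1) ++ [f.1]) t (1 - z) with hkb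
    have hkc : ContinuousOn kb (Ioo 0 1) := by
      refine continuousOn_iterInt (fun ψ hψ => ?_) hb1
      rw [List.mem_append, List.mem_map, List.mem_singleton] at hψ
      rcases hψ with ⟨a, -, rfl⟩ | rfl
      · exact a.2.1
      · exact IsTail.cont f.2
    have i1 : IntervalIntegrable (φ.1 * K.1) volume s (1 - z) :=
      (isTail_mul φ K).intervalIntegrable_of_mem hs1 ⟨hb1.1, hb1.2.le⟩
    have i2 : IntervalIntegrable (fun t => φ.1 t * kb t) volume s (1 - z) :=
      ContinuousOn.intervalIntegrable ((φ.2.1.mul hkc).mono (by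
        rw [uIcc_of_le hs.2]; exact hsub))
    have e1 : ((List.map op (φ :: p)).prod (tail f)).1 s =
        (∫ t in s..(1 - z), (φ.1 * K.1) t) + ∫ t in (1 - z)..1, (φ.1 * K.1) t := by
      rw [integral_add_adjacent_intervals i1 ((isTail_mul φ K).intervalIntegrable hb1)]
      simp only [List.map_cons, List.prod_cons, Module.End.mul_apply, ← hK]
      rw [op_eq, tail_apply _ hs1]
    have e2 : iterInt ((φ :: p).map (fun φ => φ.1) ++ [f.1]) s (1 - z) =
        ∫ t in s..(1 - z), φ.1 t * kb t := rfl
    rw [e1, e2, add_sub_right_comm, ← integral_sub i1 i2, add_comm, add_mul]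
    refine (norm_add_le _ _).trans (add_le_add ?_ ?_)
    · refine (hD _ hb1).trans ?_
      rw [lam_one_sub, sub_sub_cancel]
      exact mul_le_mul_of_nonneg_left (mul_le_mul_of_nonneg_left
        (pow_lam_le hz1 (le_max_left _ _)) hz.le) hD0
    · obtain ⟨i3, h3⟩ := integral_inv_mul_one_sub_le hz hs
      refine (norm_integral_le_of_norm_le hs.2 (g := fun t => (|E| * (C * (z * lam z ^ J))) *
        (1 / (t * (1 - t)))) (Eventually.of_forall fun t ht => ?_) (i3.const_mul _)).trans ?_
      · have ht' := hsub t (Ioc_subset_Icc_self ht)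
        have h4 := hC z hz t ⟨hs.1.trans ht.1.le, ht.2⟩
        have h5 : 0 ≤ t * (1 - t) := mul_nonneg ht'.1.le (by linarith [ht'.2])
        rw [Pi.mul_apply, ← mul_sub, norm_mul, mul_right_comm]
        refine mul_le_mul ((hE t ht').trans ?_) h4 (norm_nonneg _) (by positivity)
        rw [mul_one_div]
        exact div_le_div_of_nonneg_right (le_abs_self E) h5
      · rw [intervalIntegral.integral_const_mul]
        refine (mul_le_mul_of_nonneg_left h3 (by positivity)).trans ?_
        have h6 := pow_lam_le hz1 (le_max_right J' (J + 1))
        calc |E| * (C * (z * lam z ^ J)) * (2 * lam z)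
            = 2 * |E| * C * (z * lam z ^ (J + 1)) := by ring
          _ ≤ _ := by gcongr

/-! ### Regularized values -/

lemma tendsto_mul_abs_log_pow (J : ℕ) :
    Tendsto (fun z : ℝ => z * |Real.log z| ^ J) (𝓝[>] 0) (𝓝 0) := by
  have h1 : Tendsto (fun z : ℝ => 1 - z) (𝓝[>] 0) (𝓝[<] 1) := by
    refine tendsto_nhdsWithin_iff.2 ⟨?_, ?_⟩
    · have : Tendsto (fun z : ℝ => 1 - z) (𝓝 0) (𝓝 (1 - 0)) :=
        (continuous_const.sub continuous_id).tendsto 0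
      rw [sub_zero] at this
      exact this.mono_left nhdsWithin_le_nhds
    · filter_upwards [self_mem_nhdsWithin] with z hz
      simpa using hz
  refine squeeze_zero' ?_ ?_ ((tendsto_one_sub_mul_lam_pow J).comp h1)
  · filter_upwards [self_mem_nhdsWithin] with z hz
    exact mul_nonneg (le_of_lt hz) (by positivity)
  · filter_upwards [Ioo_mem_nhdsGT one_pos] with z hz
    have h2 := Real.log_nonpos hz.1.le hz.2.le
    have h3 := Real.log_nonpos (sub_pos.2 hz.2).le (by linarith [hz.1] : 1 - z ≤ 1)
    simp only [Function.comp, sub_sub_cancel, lam_one_sub]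
    refine mul_le_mul_of_nonneg_left (pow_le_pow_left₀ (abs_nonneg _) ?_ J) hz.1.le
    rw [abs_of_nonpos h2, lam]
    linarith

lemma one_le_abs_log : ∀ᶠ z : ℝ in 𝓝[>] 0, 1 ≤ |Real.log z| := by
  filter_upwards [Ioo_mem_nhdsGT (Real.exp_pos (-1))] with z hz
  have h1 : Real.log z < -1 := (Real.log_lt_iff_lt_exp hz.1).2 hz.2
  rw [abs_of_neg (by linarith)]
  linarith

lemma lam_le_abs_log : ∀ᶠ z : ℝ in 𝓝[>] 0, 0 ≤ lam z ∧ lam z ≤ 3 * |Real.log z| := by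
  filter_upwards [Ioo_mem_nhdsGT (by norm_num : (0 : ℝ) < 1 / 2), one_le_abs_log] with z hz h1
  have h2 := Real.log_nonpos hz.1.le (by linarith [hz.2])
  have h3 : Real.log z ≤ Real.log (1 - z) := Real.log_le_log hz.1 (by linarith [hz.2])
  refine ⟨(lam_pos ⟨hz.1, by linarith [hz.2]⟩).le, ?_⟩
  rw [abs_of_nonpos h2] at h1 ⊢
  simp only [lam]
  linarith

lemma isBigO_mul_log_mono {i j : ℕ} (h : i ≤ j) :
    (fun z : ℝ => z * |Real.log z| ^ i) =O[𝓝[>] (0 : ℝ)] fun z => z * |Real.log z| ^ j := by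
  refine IsBigO.of_bound 1 ?_
  filter_upwards [one_le_abs_log, self_mem_nhdsWithin] with z hz hz0
  have hz0' : (0 : ℝ) < z := hz0
  rw [one_mul, Real.norm_of_nonneg (by positivity), Real.norm_of_nonneg (by positivity)]
  exact mul_le_mul_of_nonneg_left (pow_le_pow_right₀ hz h) hz0'.le

lemma isBigO_eval_log (P : Polynomial ℂ) :
    (fun z : ℝ => P.eval (Real.log z : ℂ)) =O[𝓝[>] (0 : ℝ)]
      fun z => |Real.log z| ^ P.natDegree := by
  simp only [Polynomial.eval_eq_sum_range]
  refine IsBigO.fun_sum fun i hi => ?_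
  refine IsBigO.of_bound ‖P.coeff i‖ ?_
  filter_upwards [one_le_abs_log] with z hz
  rw [norm_mul, norm_pow, Complex.norm_real, Real.norm_eq_abs, norm_pow, Real.norm_eq_abs,
    abs_abs]
  exact mul_le_mul_of_nonneg_left
    (pow_le_pow_right₀ hz (Nat.lt_succ_iff.1 (Finset.mem_range.1 hi))) (norm_nonneg _)

/-- The difference of the two polynomials in `log z` tends to `0`, whereas a nonconstant polynomial
is unbounded as `log z → -∞`. So the difference is a constant, and that constant is `0`. -/
lemma IsRegValue.unique {F : ℝ → ℂ} {v v' : ℂ} (h : IsRegValue F v) (h' : IsRegValue F v') :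
    v = v' := by
  obtain ⟨P, J, hP, rfl⟩ := h
  obtain ⟨P', J', hP', rfl⟩ := h'
  have h1 : Tendsto (fun z : ℝ => (P - P').eval (Real.log z : ℂ)) (𝓝[>] 0) (𝓝 0) := by
    have h2 := (hP'.trans_tendsto (tendsto_mul_abs_log_pow J')).sub
      (hP.trans_tendsto (tendsto_mul_abs_log_pow J))
    simpa using h2
  have h3 : Tendsto (fun z : ℝ => ‖(Real.log z : ℂ)‖) (𝓝[>] 0) atTop := by
    simp only [Complex.norm_real]
    exact tendsto_abs_atBot_atTop.comp Real.tendsto_log_nhdsGT_zero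
  have h4 : (P - P').degree ≤ 0 := by
    by_contra! h
    have h5 := Polynomial.tendsto_norm_atTop (P - P') h h3
    exact not_tendsto_nhds_of_tendsto_atTop h5 _ h1.norm
  rw [Polynomial.eq_C_of_degree_le_zero h4] at h1
  simp only [Polynomial.eval_C] at h1
  have h6 := tendsto_nhds_unique h1 tendsto_const_nhds
  rw [Polynomial.coeff_zero_eq_eval_zero, Polynomial.eval_sub, eq_comm, sub_eq_zero] at h6
  exact h6

lemma IsRegValue.regExists {w : List (ℝ → ℂ)} {v : ℂ}
    (h : IsRegValue (fun z => iterInt w z (1 - z)) v) : RegExists w := ⟨v, h⟩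

lemma IsRegValue.regInt_eq {w : List (ℝ → ℂ)} {v : ℂ}
    (h : IsRegValue (fun z => iterInt w z (1 - z)) v) : regInt w = v := by
  have h1 := h.regExists
  rw [regInt, dif_pos h1]
  exact h1.choose_spec.unique h

lemma IsRegValue.congr {F G : ℝ → ℂ} {v : ℂ} (h : IsRegValue F v)
    (hFG : ∀ᶠ z in 𝓝[>] (0 : ℝ), F z = G z) : IsRegValue G v := by
  obtain ⟨P, J, hP, hv⟩ := h
  refine ⟨P, J, hP.congr' ?_ EventuallyEq.rfl, hv⟩
  filter_upwards [hFG] with z hz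
  rw [hz]

lemma isRegValue_const (v : ℂ) : IsRegValue (fun _ => v) v :=
  ⟨Polynomial.C v, 0, by simpa using isBigO_zero _ _, by simp⟩

lemma IsRegValue.add {F G : ℝ → ℂ} {v v' : ℂ} (h : IsRegValue F v) (h' : IsRegValue G v') :
    IsRegValue (fun z => F z + G z) (v + v') := by
  obtain ⟨P, J, hP, rfl⟩ := h
  obtain ⟨P', J', hP', rfl⟩ := h'
  refine ⟨P + P', max J J', ?_, by simp⟩
  refine ((hP.trans (isBigO_mul_log_mono (le_max_left J J'))).add
    (hP'.trans (isBigO_mul_log_mono (le_max_right J J')))).congr_left fun z => ?_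
  rw [Polynomial.eval_add]; ring

lemma IsRegValue.sum {ι : Type*} (s : Finset ι) {F : ι → ℝ → ℂ} {v : ι → ℂ}
    (h : ∀ i ∈ s, IsRegValue (F i) (v i)) :
    IsRegValue (fun z => ∑ i ∈ s, F i z) (∑ i ∈ s, v i) := by
  classical
  induction s using Finset.induction_on with
  | empty => simpa using isRegValue_const 0
  | insert a s ha ih =>
    simp only [Finset.sum_insert ha]
    exact (h a (Finset.mem_insert_self a s)).add
      (ih fun i hi => h i (Finset.mem_insert_of_mem hi))

/-- The error is `(F - P) P' + P (G - P') + (F - P) (G - P')`; a polynomial factor in `log z` only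
raises the power of the logarithm. -/
lemma IsRegValue.mul {F G : ℝ → ℂ} {v v' : ℂ} (h : IsRegValue F v) (h' : IsRegValue G v') :
    IsRegValue (fun z => F z * G z) (v * v') := by
  obtain ⟨P, J, hP, rfl⟩ := h
  obtain ⟨P', J', hP', rfl⟩ := h'
  have e1 : (fun z => (F z - P.eval (Real.log z : ℂ)) * P'.eval (Real.log z : ℂ)) =O[𝓝[>] 0]
      fun z => z * |Real.log z| ^ (J + P'.natDegree) :=
    (hP.mul (isBigO_eval_log P')).congr_right fun z => by rw [pow_add, mul_assoc]
  have e2 : (fun z => P.eval (Real.log z : ℂ) * (G z - P'.eval (Real.log z : ℂ))) =O[𝓝[>] 0]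
      fun z => z * |Real.log z| ^ (J' + P.natDegree) :=
    ((isBigO_eval_log P).mul hP').congr_right fun z => by rw [pow_add]; ring
  have e3 : (fun z => (F z - P.eval (Real.log z : ℂ)) * (G z - P'.eval (Real.log z : ℂ)))
      =O[𝓝[>] 0] fun z => z * |Real.log z| ^ J := by
    have : (fun z => G z - P'.eval (Real.log z : ℂ)) =O[𝓝[>] 0] fun _ => (1 : ℝ) :=
      (hP'.trans_tendsto (tendsto_mul_abs_log_pow J')).isBigO_one ℝ
    exact (hP.mul this).congr_right fun z => by rw [mul_one]
  set N := (J + P'.natDegree) + (J' + P.natDegree) with hN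
  refine ⟨P * P', N, ?_, by simp⟩
  refine (((e1.trans (isBigO_mul_log_mono (by omega : _ ≤ N))).add
    (e2.trans (isBigO_mul_log_mono (by omega : _ ≤ N)))).add
    (e3.trans (isBigO_mul_log_mono (by omega : _ ≤ N)))).congr_left fun z => ?_
  rw [Polynomial.eval_mul]; ring

lemma IsRegValue.const_mul {F : ℝ → ℂ} {v : ℂ} (c : ℂ) (h : IsRegValue F v) :
    IsRegValue (fun z => c * F z) (c * v) := (isRegValue_const c).mul h

lemma IsRegValue.pow {F : ℝ → ℂ} {v : ℂ} (h : IsRegValue F v) (n : ℕ) :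
    IsRegValue (fun z => F z ^ n) (v ^ n) := by
  induction n with
  | zero => simpa using isRegValue_const 1
  | succ n ih => simpa only [pow_succ] using ih.mul h

/-- A function with a limit at `0`, attained at speed `z (log z)^J`. -/
lemma isRegValue_of_norm_sub_le {F : ℝ → ℂ} {v : ℂ} {C : ℝ} {J : ℕ}
    (h : ∀ᶠ z in 𝓝[>] (0 : ℝ), ‖F z - v‖ ≤ C * (z * lam z ^ J)) : IsRegValue F v := by
  refine ⟨Polynomial.C v, J, ?_, by simp⟩
  refine IsBigO.of_bound (|C| * 3 ^ J) ?_
  filter_upwards [h, lam_le_abs_log, self_mem_nhdsWithin] with z hz hl hz0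
  have hz0' : (0 : ℝ) < z := hz0
  rw [Polynomial.eval_C, Real.norm_of_nonneg (by positivity)]
  refine hz.trans ?_
  calc C * (z * lam z ^ J) ≤ |C| * (z * lam z ^ J) :=
        mul_le_mul_of_nonneg_right (le_abs_self C) (mul_nonneg hz0'.le (pow_nonneg hl.1 _))
    _ ≤ |C| * (z * (3 * |Real.log z|) ^ J) := by
        refine mul_le_mul_of_nonneg_left (mul_le_mul_of_nonneg_left
          (pow_le_pow_left₀ hl.1 hl.2 J) hz0'.le) (abs_nonneg C)
    _ = |C| * 3 ^ J * (z * |Real.log z| ^ J) := by rw [mul_pow]; ring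

lemma eventually_nhdsGT_zero_lt_half :
    ∀ᶠ z : ℝ in 𝓝[>] 0, 0 < z ∧ z < 1 / 2 := Ioo_mem_nhdsGT (by norm_num)

lemma IsHead.isRegValue_integral {f : ℝ → ℂ} (hf : IsHead f) :
    IsRegValue (fun z => ∫ t in z..(1 - z), f t) (∫ t in (0 : ℝ)..1, f t) := by
  obtain ⟨C, J, hC0, hC⟩ := hf.exists_norm_integral_le
  obtain ⟨D, J', hD0, hD⟩ := hf.isTail.exists_norm_integral_le
  refine isRegValue_of_norm_sub_le (C := C + D) (J := max J J') ?_
  filter_upwards [eventually_nhdsGT_zero_lt_half] with z hz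
  have hz1 : z ∈ Ioo (0 : ℝ) 1 := ⟨hz.1, by linarith [hz.2]⟩
  have hb1 : 1 - z ∈ Ioo (0 : ℝ) 1 := ⟨by linarith [hz.2], by linarith [hz.1]⟩
  have i1 : IntervalIntegrable f volume 0 z :=
    hf.intervalIntegrable.mono_set (uIcc_subset_uIcc left_mem_uIcc
      (by rw [uIcc_of_le zero_le_one]; exact Ioo_subset_Icc_self hz1))
  have i2 := hf.isTail.intervalIntegrable_of_mem hz1 ⟨hb1.1, hb1.2.le⟩
  have i3 := hf.isTail.intervalIntegrable hb1
  rw [← integral_add_adjacent_intervals (i1.trans i2) i3,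
    ← integral_add_adjacent_intervals i1 i2]
  have e : ∀ a b c : ℂ, b - (a + b + c) = -(a + c) := fun a b c => by ring
  rw [e, norm_neg, add_mul]
  refine (norm_add_le _ _).trans (add_le_add ((hC z hz1).trans ?_) ((hD _ hb1).trans ?_))
  · exact mul_le_mul_of_nonneg_left (mul_le_mul_of_nonneg_left
      (pow_lam_le hz1 (le_max_left _ _)) hz.1.le) hC0
  · rw [lam_one_sub, sub_sub_cancel]
    exact mul_le_mul_of_nonneg_left (mul_le_mul_of_nonneg_left
      (pow_lam_le hz1 (le_max_right _ _)) hz.1.le) hD0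

lemma isRegValue_iterInt_singleton {f : ℝ → ℂ} (hf : IsHead f) :
    IsRegValue (fun z => iterInt [f] z (1 - z)) (∫ t in (0 : ℝ)..1, f t) := by
  simpa [iterInt] using hf.isRegValue_integral

/-- Replacing the truncated inner integrals by those up to `1` changes the outer integrand by `O(z
(lam z)^J)` uniformly on `[z, 1 - z]`, because the first letter is bounded. What is left converges,
so the polynomial is constant. -/
lemma isRegValue_iterInt {φ : ℝ → ℂ} (hφ : IsBdd φ) (p : List Letter) (f : Tail) :
    IsRegValue (fun z => iterInt (φ :: (p.map (fun φ => φ.1) ++ [f.1])) z (1 - z))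
      (total φ hφ ((p.map op).prod (tail f))) := by
  set K := (p.map op).prod (tail f) with hK
  obtain ⟨C, J, hC0, hC⟩ := exists_norm_sub_iterInt_le p f
  obtain ⟨E, hE⟩ := hφ.bound
  have h1 : IsRegValue (fun z => iterInt (φ :: (p.map (fun φ => φ.1) ++ [f.1])) z (1 - z) -
      ∫ t in z..(1 - z), (φ * K.1) t) 0 := by
    refine isRegValue_of_norm_sub_le (C := |E| * C) (J := J) ?_
    filter_upwards [eventually_nhdsGT_zero_lt_half] with z hz
    have hz1 : z ∈ Ioo (0 : ℝ) 1 := ⟨hz.1, by linarith [hz.2]⟩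
    have hb1 : 1 - z ∈ Ioo (0 : ℝ) 1 := ⟨by linarith [hz.2], by linarith [hz.1]⟩
    have hzb : z ≤ 1 - z := by linarith [hz.2]
    have hsub : ∀ t ∈ Icc z (1 - z), t ∈ Ioo (0 : ℝ) 1 := fun t ht =>
      ⟨hz1.1.trans_le ht.1, ht.2.trans_lt hb1.2⟩
    have hkc : ContinuousOn (fun t => iterInt (p.map (fun φ => φ.1) ++ [f.1]) t (1 - z))
        (Ioo 0 1) := by
      refine continuousOn_iterInt (fun ψ hψ => ?_) hb1
      rw [List.mem_append, List.mem_map, List.mem_singleton] at hψ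
      rcases hψ with ⟨a, -, rfl⟩ | rfl
      · exact a.2.1
      · exact IsTail.cont f.2
    have i1 := (hφ.isHead_mul K).isTail.intervalIntegrable_of_mem hz1 ⟨hb1.1, hb1.2.le⟩
    have i2 : IntervalIntegrable
        (fun t => φ t * iterInt (p.map (fun φ => φ.1) ++ [f.1]) t (1 - z)) volume z (1 - z) :=
      ContinuousOn.intervalIntegrable ((hφ.cont.mul hkc).mono (by
        rw [uIcc_of_le hzb]; exact hsub))
    rw [sub_zero, iterInt, ← integral_sub i2 i1]
    refine (intervalIntegral.norm_integral_le_of_norm_le_const (C := |E| * (C * (z * lam z ^ J)))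
      fun t ht => ?_).trans ?_
    · rw [uIoc_of_le hzb] at ht
      have ht' := hsub t (Ioc_subset_Icc_self ht)
      rw [Pi.mul_apply, ← mul_sub, norm_mul, norm_sub_rev]
      exact mul_le_mul ((hE t ht').trans (le_abs_self E)) (hC z hz.1 t (Ioc_subset_Icc_self ht))
        (norm_nonneg _) (abs_nonneg E)
    · rw [mul_assoc |E| C]
      have h0 : 0 ≤ |E| * (C * (z * lam z ^ J)) := by
        have := lam_pos hz1; have := hz.1; positivity
      refine mul_le_of_le_one_right h0 ?_
      rw [abs_of_nonneg (by linarith)]; linarith [hz.1]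
  have h2 := h1.add (hφ.isHead_mul K).isRegValue_integral
  simp only [sub_add_cancel, zero_add] at h2
  exact h2

/-! ### Primitives on a vertical strip -/

/-- The open vertical strip `0 < Re φ < π / 2`. -/
def strip : Set ℂ := {φ | 0 < φ.re ∧ φ.re < Real.pi / 2}

lemma isOpen_strip : IsOpen strip :=
  (isOpen_lt continuous_const Complex.continuous_re).inter
    (isOpen_lt Complex.continuous_re continuous_const)

lemma convex_strip : Convex ℝ strip :=
  (convex_halfSpace_re_gt 0).inter (convex_halfSpace_re_lt (Real.pi / 2))

lemma exists_primitive_on_strip {f : ℂ → ℂ} (hf : DifferentiableOn ℂ f strip) :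
    ∃ F : ℂ → ℂ, ∀ φ ∈ strip, HasDerivAt F (f φ) φ := by
  obtain ⟨F, hF⟩ := convex_strip.exists_forall_hasDerivWithinAt hf
  exact ⟨F, fun φ hφ => (hF φ hφ).hasDerivAt (isOpen_strip.mem_nhds hφ)⟩

/-- Mean value inequality along a vertical segment, against the primitive of the bound. The two
alternatives keep the segment in the region `1 ≤ |Im|`, where the bound is available. -/
lemma norm_sub_le_vertical {f F : ℂ → ℂ} (hF : ∀ φ ∈ strip, HasDerivAt F (f φ) φ) {C : ℝ}
    (hC : ∀ φ ∈ strip, 1 ≤ |φ.im| → ‖f φ‖ ≤ C * Real.exp (-φ.im / 2)) {φ : ℂ} (hφ : φ ∈ strip)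
    {r : ℝ} (hr : 0 ≤ r) (h : 1 ≤ φ.im ∨ φ.im + r ≤ -1) :
    ‖F (φ + r * Complex.I) - F φ‖ ≤
      2 * C * (Real.exp (-φ.im / 2) - Real.exp (-(φ.im + r) / 2)) := by
  have hmem : ∀ t : ℝ, φ + t * Complex.I ∈ strip := fun t => by simpa [strip] using hφ
  have him : ∀ t : ℝ, (φ + t * Complex.I).im = φ.im + t := fun t => by simp
  have hd : ∀ t : ℝ, HasDerivAt (fun t : ℝ => F (φ + t * Complex.I) - F φ)
      (f (φ + t * Complex.I) * Complex.I) t := fun t => by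
    have h1 : HasDerivAt (fun t : ℝ => φ + t * Complex.I) Complex.I t := by
      simpa using ((Complex.ofRealCLM.hasDerivAt (x := t)).mul_const Complex.I).const_add φ
    exact ((hF _ (hmem t)).comp t h1).sub_const _
  have hB : ∀ t : ℝ, HasDerivAt
      (fun t : ℝ => 2 * C * (Real.exp (-φ.im / 2) - Real.exp (-(φ.im + t) / 2)))
      (C * Real.exp (-(φ.im + t) / 2)) t := fun t => by
    have h1 : HasDerivAt (fun t : ℝ => -(φ.im + t) / 2) (-1 / 2) t :=
      (((hasDerivAt_id t).const_add φ.im).neg).div_const 2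
    exact ((h1.exp.const_sub (Real.exp (-φ.im / 2))).const_mul (2 * C)).congr_deriv (by ring)
  refine image_norm_le_of_norm_deriv_right_le_deriv_boundary (a := 0) (b := r)
    (fun t _ => (hd t).continuousAt.continuousWithinAt)
    (fun t _ => (hd t).hasDerivWithinAt) (by simp) hB (fun t ht => ?_) (right_mem_Icc.2 hr)
  rw [norm_mul, Complex.norm_I, mul_one]
  have h2 := hC _ (hmem t) (by
    rw [him, le_abs]
    rcases h with h | h
    · left; linarith [ht.1]
    · right; linarith [ht.2])
  rwa [him] at h2

lemma norm_sub_le_horizontal {f F : ℂ → ℂ} (hF : ∀ φ ∈ strip, HasDerivAt F (f φ) φ) {C : ℝ}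
    (hC0 : 0 ≤ C)
    (hC : ∀ φ ∈ strip, 1 ≤ |φ.im| → ‖f φ‖ ≤ C * Real.exp (-φ.im / 2)) {φ ψ : ℂ} (hφ : φ ∈ strip)
    (hψ : ψ ∈ strip) (him : φ.im = ψ.im) (h1 : 1 ≤ |φ.im|) :
    ‖F ψ - F φ‖ ≤ 2 * C * Real.exp (-φ.im / 2) := by
  have hconv : Convex ℝ (strip ∩ {χ : ℂ | χ.im = φ.im}) :=
    convex_strip.inter (convex_hyperplane Complex.imLm.isLinear φ.im)
  have h2 := hconv.norm_image_sub_le_of_norm_hasDerivWithin_le (𝕜 := ℂ) (f := F) (f' := f)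
    (C := C * Real.exp (-φ.im / 2)) (x := φ) (y := ψ)
    (fun χ hχ => (hF χ hχ.1).hasDerivWithinAt)
    (fun χ hχ => by
      have h3 := hC χ hχ.1
      rw [hχ.2] at h3
      exact h3 h1) ⟨hφ, rfl⟩ ⟨hψ, him.symm⟩
  refine h2.trans ?_
  have h4 : ‖ψ - φ‖ ≤ 2 := by
    have h5 : ψ - φ = ((ψ.re - φ.re : ℝ) : ℂ) := by
      apply Complex.ext <;> simp [him]
    rw [h5, Complex.norm_real, Real.norm_eq_abs, abs_le]
    -- The width `π / 2` of the strip is at most `2`, which is the factor in the bound.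
    have := Real.pi_le_four
    constructor <;> linarith [hφ.1, hφ.2, hψ.1, hψ.2]
  nlinarith [mul_nonneg hC0 (Real.exp_pos (-φ.im / 2)).le]

/-- Holomorphic functions on the strip bounded by `exp (- Im φ / 2)` away from the real axis. -/
def StripDecay (f : ℂ → ℂ) : Prop :=
  ∃ C : ℝ, ∀ φ ∈ strip, 1 ≤ |φ.im| → ‖f φ‖ ≤ C * Real.exp (-φ.im / 2)

/-- Any primitive of `-f` is Cauchy along the central vertical ray going up. Subtracting its limit
makes it decay, first on that ray and then, by horizontal comparison, on the whole strip. -/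
lemma exists_decaying_primitive {f : ℂ → ℂ} (hf : DifferentiableOn ℂ f strip)
    (hd : StripDecay f) :
    ∃ K : ℂ → ℂ, (∀ φ ∈ strip, HasDerivAt K (-f φ) φ) ∧ StripDecay K := by
  obtain ⟨F, hF⟩ := exists_primitive_on_strip hf.neg
  obtain ⟨C', hC'⟩ := hd
  set C := |C'| with hCdef
  have hC0 : 0 ≤ C := abs_nonneg C'
  have hC : ∀ φ ∈ strip, 1 ≤ |φ.im| → ‖(-f) φ‖ ≤ C * Real.exp (-φ.im / 2) := fun φ hφ h => by
    rw [Pi.neg_apply, norm_neg]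
    exact (hC' φ hφ h).trans
      (mul_le_mul_of_nonneg_right (le_abs_self C') (Real.exp_pos _).le)
  have hbase : ∀ b : ℝ, (Real.pi / 4 : ℝ) + b * Complex.I ∈ strip := fun b => by
    have := Real.pi_pos
    constructor
    · simp; positivity
    · simp; linarith
  have hbim : ∀ b : ℝ, ((Real.pi / 4 : ℝ) + b * Complex.I : ℂ).im = b := fun b => by simp
  have hto0 : Tendsto (fun n : ℕ => Real.exp (-((n : ℝ) + 1) / 2)) atTop (𝓝 0) := by
    refine Real.tendsto_exp_atBot.comp ?_
    have h1 : Tendsto (fun n : ℕ => ((n : ℝ) + 1) / 2) atTop atTop :=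
      (tendsto_atTop_add_const_right _ _ tendsto_natCast_atTop_atTop).atTop_div_const two_pos
    have h2 := tendsto_neg_atTop_atBot.comp h1
    refine h2.congr fun n => ?_
    simp only [Function.comp]; ring
  have hcauchy : CauchySeq fun n : ℕ =>
      F ((Real.pi / 4 : ℝ) + ((n + 1 : ℝ) : ℝ) * Complex.I) := by
    refine cauchySeq_of_le_tendsto_0' (fun n : ℕ => 2 * C * Real.exp (-((n : ℝ) + 1) / 2))
      (fun n m hnm => ?_) (by simpa using hto0.const_mul (2 * C))
    have h1 : (n : ℝ) ≤ m := by exact_mod_cast hnm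
    have h2 := norm_sub_le_vertical hF hC (hbase (n + 1)) (r := (m : ℝ) - n) (by linarith)
      (Or.inl (by rw [hbim]; linarith [n.cast_nonneg (α := ℝ)]))
    rw [hbim] at h2
    have h3 : ((Real.pi / 4 : ℝ) : ℂ) + ((n + 1 : ℝ) : ℝ) * Complex.I + ((m : ℝ) - n : ℝ) * Complex.I
        = (Real.pi / 4 : ℝ) + ((m + 1 : ℝ) : ℝ) * Complex.I := by push_cast; ring
    rw [h3] at h2
    rw [dist_comm, dist_eq_norm]
    refine h2.trans ?_
    have := Real.exp_pos (-((n : ℝ) + 1 + ((m : ℝ) - n)) / 2)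
    exact mul_le_mul_of_nonneg_left (by linarith) (by linarith)
  obtain ⟨L, hL⟩ := cauchySeq_tendsto_of_complete hcauchy
  have hup : ∀ φ ∈ strip, 1 ≤ φ.im → ‖F φ - L‖ ≤ 4 * C * Real.exp (-φ.im / 2) := by
    intro φ hφ h1
    have hlim : Tendsto (fun n : ℕ =>
        ‖F φ - F ((Real.pi / 4 : ℝ) + ((n + 1 : ℝ) : ℝ) * Complex.I)‖) atTop (𝓝 ‖F φ - L‖) :=
      (hL.const_sub (F φ)).norm
    refine le_of_tendsto hlim ?_
    filter_upwards [eventually_ge_atTop ⌈φ.im⌉₊] with n hn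
    have hn' : φ.im ≤ n := (Nat.le_ceil _).trans (by exact_mod_cast hn)
    have h2 := norm_sub_le_vertical hF hC hφ (r := (n : ℝ) + 1 - φ.im) (by linarith) (Or.inl h1)
    set ψ := φ + ((n : ℝ) + 1 - φ.im : ℝ) * Complex.I with hψ
    have hψim : ψ.im = n + 1 := by simp [hψ]
    have hψm : ψ ∈ strip := by simpa [strip, hψ] using hφ
    have h3 := norm_sub_le_horizontal hF hC0 hC (hbase (n + 1)) hψm (by rw [hbim, hψim])
      (by rw [hbim, abs_of_nonneg] <;> linarith)
    rw [hbim] at h3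
    have h4 : Real.exp (-((n : ℝ) + 1) / 2) ≤ Real.exp (-φ.im / 2) :=
      Real.exp_le_exp.2 (by linarith)
    have h5 : -(φ.im + ((n : ℝ) + 1 - φ.im)) / 2 = -((n : ℝ) + 1) / 2 := by ring
    rw [h5] at h2
    have h6 := norm_sub_le_norm_sub_add_norm_sub (F φ) (F ψ)
      (F ((Real.pi / 4 : ℝ) + ((n + 1 : ℝ) : ℝ) * Complex.I))
    rw [norm_sub_rev (F φ) (F ψ)] at h6
    have := (Real.exp_pos (-((n : ℝ) + 1) / 2)).le
    have := mul_le_mul_of_nonneg_left h4 hC0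
    nlinarith
  refine ⟨fun φ => F φ - L, fun φ hφ => (hF φ hφ).sub_const L, 4 * C +
    ‖F ((Real.pi / 4 : ℝ) + ((-1 : ℝ) : ℝ) * Complex.I) - L‖, fun φ hφ h => ?_⟩
  set M := ‖F ((Real.pi / 4 : ℝ) + ((-1 : ℝ) : ℝ) * Complex.I) - L‖ with hM
  have hM0 : 0 ≤ M := norm_nonneg _
  have he := Real.exp_pos (-φ.im / 2)
  -- Downwards the required bound grows, so no normalization is needed there: it is enough to
  -- compare with the height `-1`, and through it with the reference value `M`.
  rcases le_abs.1 h with h1 | h1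
  · exact (hup φ hφ h1).trans (by nlinarith [mul_nonneg hM0 he.le])
  · have h2 := norm_sub_le_vertical hF hC hφ (r := -1 - φ.im) (by linarith)
      (Or.inr (by linarith))
    set ψ := φ + (-1 - φ.im : ℝ) * Complex.I with hψ
    have hψim : ψ.im = -1 := by simp [hψ]
    have hψm : ψ ∈ strip := by simpa [strip, hψ] using hφ
    have h3 := norm_sub_le_horizontal hF hC0 hC (hbase (-1)) hψm (by rw [hbim, hψim])
      (by rw [hbim]; norm_num)
    rw [hbim] at h3
    have h5 : -(φ.im + (-1 - φ.im)) / 2 = -(-1 : ℝ) / 2 := by ring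
    rw [h5] at h2
    have h4 : Real.exp (-(-1 : ℝ) / 2) ≤ Real.exp (-φ.im / 2) :=
      Real.exp_le_exp.2 (by linarith)
    have h7 : (1 : ℝ) ≤ Real.exp (-φ.im / 2) := Real.one_le_exp (by linarith)
    have h6 := norm_sub_le_norm_sub_add_norm_sub (F φ) (F ψ) L
    have h8 := norm_sub_le_norm_sub_add_norm_sub (F ψ)
      (F ((Real.pi / 4 : ℝ) + ((-1 : ℝ) : ℝ) * Complex.I)) L
    rw [norm_sub_rev (F φ) (F ψ)] at h6
    have h9 := mul_le_mul_of_nonneg_left h4 hC0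
    have h10 := mul_le_mul_of_nonneg_left h7 hM0
    have h11 := mul_nonneg hC0 he.le
    have h12 := mul_nonneg hC0 (Real.exp_pos (-(-1 : ℝ) / 2)).le
    show ‖F φ - L‖ ≤ _
    nlinarith

/-- The reflection `φ ↦ π/2 - φ` preserves the strip and exchanges its two ends. The decaying
primitives for `f` and for the reflected function add up to a constant `V`, which is therefore the
limit of `K` at the lower end, that is, the integral of `f` across the strip. -/
lemma exists_primitive_of_two_sided_decay {f : ℂ → ℂ} (hf : DifferentiableOn ℂ f strip) {C : ℝ}
    (hC : ∀ φ ∈ strip, 1 ≤ |φ.im| → ‖f φ‖ ≤ C * Real.exp (-|φ.im| / 2)) :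
    ∃ (K : ℂ → ℂ) (V : ℂ), (∀ φ ∈ strip, HasDerivAt K (-f φ) φ) ∧ StripDecay K ∧
      ∃ D : ℝ, ∀ φ ∈ strip, φ.im ≤ -1 → ‖K φ - V‖ ≤ D * Real.exp (φ.im / 2) := by
  have hbd : ∀ φ ∈ strip, 1 ≤ |φ.im| → ∀ y : ℝ, y ≤ |φ.im| →
      ‖f φ‖ ≤ |C| * Real.exp (-y / 2) := fun φ hφ h y hy =>
    (hC φ hφ h).trans (mul_le_mul (le_abs_self C) (Real.exp_le_exp.2 (by linarith))
      (Real.exp_pos _).le (abs_nonneg C))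
  obtain ⟨K, hK, hKd⟩ := exists_decaying_primitive hf
    ⟨|C|, fun φ hφ h => hbd φ hφ h _ (le_abs_self _)⟩
  have hrefl : ∀ φ ∈ strip, ((Real.pi / 2 : ℝ) : ℂ) - φ ∈ strip := fun φ hφ => by
    have h1 := hφ.1
    have h2 := hφ.2
    constructor
    · rw [Complex.sub_re, Complex.ofReal_re]; linarith
    · rw [Complex.sub_re, Complex.ofReal_re]; linarith
  have him : ∀ φ : ℂ, (((Real.pi / 2 : ℝ) : ℂ) - φ).im = -φ.im := fun φ => by
    rw [Complex.sub_im, Complex.ofReal_im]; ring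
  obtain ⟨K₂, hK₂, D, hD⟩ := exists_decaying_primitive
    (f := fun φ => f (((Real.pi / 2 : ℝ) : ℂ) - φ))
    (hf.comp (by fun_prop) hrefl)
    ⟨|C|, fun φ hφ h => hbd _ (hrefl φ hφ) (by rwa [him, abs_neg]) _
      (by rw [him, abs_neg]; exact le_abs_self _)⟩
  have hG : ∀ φ ∈ strip, HasDerivAt (fun φ => K φ + K₂ (((Real.pi / 2 : ℝ) : ℂ) - φ)) 0 φ := by
    intro φ hφ
    have h1 := (hK₂ _ (hrefl φ hφ)).comp φ ((hasDerivAt_id φ).const_sub ((Real.pi / 2 : ℝ) : ℂ))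
    refine ((hK φ hφ).add h1).congr_deriv ?_
    simp
  have h0 : ((Real.pi / 4 : ℝ) : ℂ) ∈ strip := by
    have := Real.pi_pos
    constructor
    · rw [Complex.ofReal_re]; linarith
    · rw [Complex.ofReal_re]; linarith
  set V := K ((Real.pi / 4 : ℝ) : ℂ) + K₂ (((Real.pi / 2 : ℝ) : ℂ) - ((Real.pi / 4 : ℝ) : ℂ)) with hV
  refine ⟨K, V, hK, hKd, D, fun φ hφ h => ?_⟩
  have hconst := convex_strip.norm_image_sub_le_of_norm_hasDerivWithin_le (𝕜 := ℂ) (C := 0)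
    (fun χ hχ => (hG χ hχ).hasDerivWithinAt) (by simp) h0 hφ
  rw [zero_mul, norm_le_zero_iff, sub_eq_zero] at hconst
  have h1 : K φ - V = -K₂ (((Real.pi / 2 : ℝ) : ℂ) - φ) := by
    rw [hV, ← hconst]; ring
  rw [h1, norm_neg]
  have h2 := hD _ (hrefl φ hφ) (by rw [him, abs_neg, le_abs]; right; linarith)
  rwa [him, neg_neg] at h2

/-! ### The coordinate `x = c + (1 - c) cos φ` on the slit half-plane -/

/-- A branch of the inverse cosine. -/
def invCos (y : ℂ) : ℂ :=
  -Complex.I * Complex.log (y + Complex.I * Complex.exp (Complex.log (1 - y ^ 2) / 2))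

lemma cos_re (φ : ℂ) : (Complex.cos φ).re = Real.cos φ.re * Real.cosh φ.im := by
  rw [Complex.cos_eq, ← Complex.ofReal_cos, ← Complex.ofReal_sin, ← Complex.ofReal_cosh,
    ← Complex.ofReal_sinh]
  simp only [Complex.sub_re, Complex.mul_re,
    Complex.mul_im, Complex.ofReal_re, Complex.ofReal_im, Complex.I_re, Complex.I_im]
  ring

lemma cos_im (φ : ℂ) : (Complex.cos φ).im = -(Real.sin φ.re * Real.sinh φ.im) := by
  rw [Complex.cos_eq, ← Complex.ofReal_cos, ← Complex.ofReal_sin, ← Complex.ofReal_cosh,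
    ← Complex.ofReal_sinh]
  simp only [Complex.sub_im, Complex.mul_re,
    Complex.mul_im, Complex.ofReal_re, Complex.ofReal_im, Complex.I_re, Complex.I_im]
  ring

lemma sin_re (φ : ℂ) : (Complex.sin φ).re = Real.sin φ.re * Real.cosh φ.im := by
  rw [Complex.sin_eq, ← Complex.ofReal_cos, ← Complex.ofReal_sin, ← Complex.ofReal_cosh,
    ← Complex.ofReal_sinh]
  simp only [Complex.add_re, Complex.mul_re,
    Complex.mul_im, Complex.ofReal_re, Complex.ofReal_im, Complex.I_re, Complex.I_im]
  ring

lemma exp_half_log_re_pos {w : ℂ} (hw : w ∈ Complex.slitPlane) :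
    0 < (Complex.exp (Complex.log w / 2)).re := by
  rw [Complex.exp_re]
  refine mul_pos (Real.exp_pos _) (Real.cos_pos_of_mem_Ioo ?_)
  have h1 := Complex.neg_pi_lt_arg w
  have h2 := lt_of_le_of_ne (Complex.arg_le_pi w) (Complex.mem_slitPlane_iff_arg.1 hw).1
  have h3 : (Complex.log w / 2).im = Complex.arg w / 2 := by
    rw [← Complex.log_im]
    simp
  rw [h3]
  constructor <;> linarith

/-- If `1 - y²` were a nonpositive real number, `Re y * Im y = 0` would force `y` to be real, and
then `y ≥ 1`. -/
lemma one_sub_sq_mem_slitPlane {y : ℂ} (h : 0 < y.re) (h' : y.im = 0 → y.re < 1) :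
    1 - y ^ 2 ∈ Complex.slitPlane := by
  rw [Complex.mem_slitPlane_iff]
  by_contra! hcon
  obtain ⟨h1, h2⟩ := hcon
  simp only [sq, Complex.sub_re, Complex.sub_im, Complex.one_re, Complex.one_im, Complex.mul_re,
    Complex.mul_im] at h1 h2
  have h3 : y.im = 0 := by
    have : y.re * y.im = 0 := by linarith
    exact (mul_eq_zero.1 this).resolve_left h.ne'
  have h4 := h' h3
  rw [h3] at h1
  nlinarith

/-- With `s` the root of `1 - y²` of positive real part, `y + i s` and `y - i s` are inverse to each
other, so `φ = -i log (y + i s)` has cosine `y` and sine `s`. Both have positive real part, so `cos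
(Re φ)` and `sin (Re φ)` are positive, and this places `φ` in the strip. -/
lemma invCos_spec {y : ℂ} (h : 0 < y.re) (h' : y.im = 0 → y.re < 1) :
    Complex.cos (invCos y) = y ∧ invCos y ∈ strip ∧ DifferentiableAt ℂ invCos y := by
  have hslit := one_sub_sq_mem_slitPlane h h'
  set s := Complex.exp (Complex.log (1 - y ^ 2) / 2) with hs
  have hs2 : s * s = 1 - y ^ 2 := by
    rw [hs, ← Complex.exp_add, add_halves, Complex.exp_log (Complex.slitPlane_ne_zero hslit)]
  have hsre : 0 < s.re := exp_half_log_re_pos hslit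
  set v := y + Complex.I * s with hv
  have hv1 : v * (y - Complex.I * s) = 1 := by
    rw [hv]
    linear_combination hs2 - s * s * Complex.I_sq
  have hv0 : v ≠ 0 := left_ne_zero_of_mul_eq_one hv1
  have hφ : invCos y = -Complex.I * Complex.log v := rfl
  have e1 : Complex.exp (invCos y * Complex.I) = v := by
    rw [hφ, show -Complex.I * Complex.log v * Complex.I = Complex.log v by
      linear_combination (-Complex.log v) * Complex.I_sq, Complex.exp_log hv0]
  have e2 : Complex.exp (-invCos y * Complex.I) = y - Complex.I * s := by
    rw [neg_mul, Complex.exp_neg, e1]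
    exact (eq_inv_of_mul_eq_one_right hv1).symm
  have hcos : Complex.cos (invCos y) = y := by
    rw [Complex.cos, e1, e2, hv]; ring
  have hsin : Complex.sin (invCos y) = s := by
    rw [Complex.sin, e1, e2, hv]; linear_combination (-s) * Complex.I_sq
  have hre : (invCos y).re = Complex.arg v := by
    rw [hφ, ← Complex.log_im]; simp
  have harg : 0 < Complex.arg v ∧ Complex.arg v < Real.pi / 2 := by
    have h1 := Complex.neg_pi_lt_arg v
    have h2 := Complex.arg_le_pi v
    have h3 : 0 < Real.cos (Complex.arg v) := by
      have := cos_re (invCos y)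
      rw [hcos, hre] at this
      rw [this] at h
      exact pos_of_mul_pos_left h (Real.cosh_pos _).le
    have h4 : 0 < Real.sin (Complex.arg v) := by
      have := sin_re (invCos y)
      rw [hsin, hre] at this
      rw [this] at hsre
      exact pos_of_mul_pos_left hsre (Real.cosh_pos _).le
    constructor
    · by_contra! h5
      linarith [Real.sin_nonpos_of_nonpos_of_neg_pi_le h5 h1.le]
    · by_contra! h5
      linarith [Real.cos_nonpos_of_pi_div_two_le_of_le h5 (by linarith [Real.pi_pos])]
  refine ⟨hcos, ⟨by rw [hre]; exact harg.1, by rw [hre]; exact harg.2⟩, ?_⟩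
  have hvslit : v ∈ Complex.slitPlane := Complex.mem_slitPlane_iff_arg.2
    ⟨by linarith [Real.pi_pos, harg.2], hv0⟩
  have d1 : DifferentiableAt ℂ (fun y : ℂ => Complex.log (1 - y ^ 2)) y :=
    DifferentiableAt.clog (by fun_prop) hslit
  have d2 : DifferentiableAt ℂ
      (fun y : ℂ => y + Complex.I * Complex.exp (Complex.log (1 - y ^ 2) / 2)) y := by fun_prop
  exact (d2.clog hvslit).const_mul _

/-! ### Exponential growth of sine and cosine in the imaginary direction -/

lemma norm_exp_mul_I (φ : ℂ) : ‖Complex.exp (φ * Complex.I)‖ = Real.exp (-φ.im) := by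
  rw [Complex.norm_exp]; simp

lemma norm_exp_neg_mul_I (φ : ℂ) : ‖Complex.exp (-φ * Complex.I)‖ = Real.exp φ.im := by
  rw [Complex.norm_exp]; simp

lemma exp_im_le (φ : ℂ) : Real.exp φ.im ≤ Real.exp |φ.im| ∧ Real.exp (-φ.im) ≤ Real.exp |φ.im| :=
  ⟨Real.exp_le_exp.2 (le_abs_self _), Real.exp_le_exp.2 (neg_le_abs _)⟩

lemma norm_cos_le (φ : ℂ) : ‖Complex.cos φ‖ ≤ Real.exp |φ.im| := by
  rw [Complex.cos, norm_div, Complex.norm_ofNat]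
  have h1 := norm_add_le (Complex.exp (φ * Complex.I)) (Complex.exp (-φ * Complex.I))
  rw [norm_exp_neg_mul_I, norm_exp_mul_I] at h1
  have h2 := exp_im_le φ
  linarith [h2.1, h2.2]

lemma norm_sin_le (φ : ℂ) : ‖Complex.sin φ‖ ≤ Real.exp |φ.im| := by
  rw [Complex.sin, norm_div, norm_mul, Complex.norm_I, mul_one, Complex.norm_ofNat]
  have h1 := norm_sub_le (Complex.exp (-φ * Complex.I)) (Complex.exp (φ * Complex.I))
  rw [norm_exp_neg_mul_I, norm_exp_mul_I] at h1
  have h2 := exp_im_le φ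
  linarith [h2.1, h2.2]

lemma abs_exp_sub_exp (b : ℝ) :
    |Real.exp b - Real.exp (-b)| = Real.exp |b| - Real.exp (-|b|) := by
  rcases le_total 0 b with h | h
  · rw [abs_of_nonneg h, abs_of_nonneg]
    exact sub_nonneg.2 (Real.exp_le_exp.2 (by linarith))
  · rw [abs_of_nonpos h, neg_neg, abs_sub_comm, abs_of_nonneg]
    exact sub_nonneg.2 (Real.exp_le_exp.2 (by linarith))

lemma le_norm_cos (φ : ℂ) : (Real.exp |φ.im| - Real.exp (-|φ.im|)) / 2 ≤ ‖Complex.cos φ‖ := by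
  rw [Complex.cos, norm_div, Complex.norm_ofNat, ← abs_exp_sub_exp]
  have h1 := abs_norm_sub_norm_le (Complex.exp (-φ * Complex.I)) (-Complex.exp (φ * Complex.I))
  rw [norm_neg, norm_exp_neg_mul_I, norm_exp_mul_I, sub_neg_eq_add, add_comm] at h1
  linarith

lemma le_norm_sin (φ : ℂ) : (Real.exp |φ.im| - Real.exp (-|φ.im|)) / 2 ≤ ‖Complex.sin φ‖ := by
  rw [Complex.sin, norm_div, norm_mul, Complex.norm_I, mul_one, Complex.norm_ofNat,
    ← abs_exp_sub_exp]
  have h1 := abs_norm_sub_norm_le (Complex.exp (-φ * Complex.I)) (Complex.exp (φ * Complex.I))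
  rw [norm_exp_neg_mul_I, norm_exp_mul_I] at h1
  linarith

lemma half_exp_le {b : ℝ} (hb : 1 / 2 ≤ b) : Real.exp b / 2 ≤ Real.exp b - Real.exp (-b) := by
  have h1 : (2 : ℝ) ≤ Real.exp (2 * b) := by
    have := Real.add_one_le_exp (2 * b); linarith
  have h2 : Real.exp (-b) * Real.exp (2 * b) = Real.exp b := by
    rw [← Real.exp_add]; ring_nf
  nlinarith [Real.exp_pos (-b)]

lemma exp_div_le_norm_cos {φ : ℂ} (h : 1 ≤ |φ.im|) : Real.exp |φ.im| / 4 ≤ ‖Complex.cos φ‖ := by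
  have := le_norm_cos φ
  have := half_exp_le (by linarith : 1 / 2 ≤ |φ.im|)
  linarith

/-- The half-angle formula `cos φ - 1 = -2 sin² (φ/2)` reduces this to the lower bound for the sine.
-/
lemma exp_div_le_norm_cos_sub_one {φ : ℂ} (h : 1 ≤ |φ.im|) :
    Real.exp |φ.im| / 8 ≤ ‖Complex.cos φ - 1‖ := by
  have h1 : Complex.cos φ - 1 = -(2 * Complex.sin (φ / 2) ^ 2) := by
    have h2 := Complex.cos_sq' (φ / 2)
    have h3 := Complex.cos_two_mul (φ / 2)
    rw [mul_div_cancel₀ φ two_ne_zero] at h3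
    rw [h3, h2]; ring
  have h4 := le_norm_sin (φ / 2)
  have h5 : |(φ / 2).im| = |φ.im| / 2 := by
    rw [show (φ / 2).im = φ.im / 2 by simp, abs_div, abs_two]
  rw [h5] at h4
  have h6 := half_exp_le (by linarith : 1 / 2 ≤ |φ.im| / 2)
  have h7 : Real.exp (|φ.im| / 2) / 4 ≤ ‖Complex.sin (φ / 2)‖ := by linarith
  rw [h1, norm_neg, norm_mul, norm_pow, Complex.norm_ofNat]
  have h8 : Real.exp |φ.im| = Real.exp (|φ.im| / 2) ^ 2 := by
    rw [← Real.exp_nat_mul]; congr 1; push_cast; ring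
  rw [h8]
  have := Real.exp_pos (|φ.im| / 2)
  nlinarith

/-- The coordinate `x = c + (1 - c) cos φ`. -/
def xCoord (c : ℝ) (φ : ℂ) : ℂ := c + (1 - c) * Complex.cos φ

/-- The points at which forms on the slit half-plane may have poles. -/
def IsPole (c : ℝ) (a : ℂ) : Prop := a.re < c ∨ a = 1

lemma lt_re_xCoord {c : ℝ} (hc1 : c < 1) {φ : ℂ} (hφ : φ ∈ strip) : c < (xCoord c φ).re := by
  have h1 : (xCoord c φ).re = c + (1 - c) * (Complex.cos φ).re := by simp [xCoord]
  rw [h1, cos_re]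
  have h2 : 0 < Real.cos φ.re := Real.cos_pos_of_mem_Ioo
    ⟨by linarith [hφ.1, Real.pi_pos], hφ.2⟩
  have := mul_pos (sub_pos.2 hc1) (mul_pos h2 (Real.cosh_pos φ.im))
  linarith

lemma xCoord_ne {c : ℝ} (hc1 : c < 1) {a : ℂ} (ha : IsPole c a) {φ : ℂ} (hφ : φ ∈ strip) :
    xCoord c φ - a ≠ 0 := by
  rw [sub_ne_zero]
  rcases ha with ha | rfl
  · intro h
    have := lt_re_xCoord hc1 hφ
    rw [h] at this
    linarith
  · intro h
    have hc : (1 - c : ℂ) ≠ 0 := by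
      rw [← Complex.ofReal_one, ← Complex.ofReal_sub]
      exact Complex.ofReal_ne_zero.2 (sub_pos.2 hc1).ne'
    have h1 : Complex.cos φ = 1 := by
      have h2 : (1 - c : ℂ) * (Complex.cos φ - 1) = 0 := by
        simp only [xCoord] at h; linear_combination h
      exact sub_eq_zero.1 ((mul_eq_zero.1 h2).resolve_left hc)
    obtain ⟨n, hn⟩ := Complex.cos_eq_one_iff.1 h1
    have h3 : φ.re = n * (2 * Real.pi) := by rw [← hn]; simp
    have h4 := hφ.1
    have h5 := hφ.2
    rw [h3] at h4 h5
    have hpi := Real.pi_pos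
    have h6 : (0 : ℝ) < n := by
      by_contra! h; nlinarith
    have h7 : (1 : ℝ) ≤ n := by
      have : (0 : ℤ) < n := by exact_mod_cast h6
      exact_mod_cast this
    nlinarith

/-- If `w` stays away from `a`, then `w - a` is bounded below by a multiple of `w`. -/
lemma norm_le_mul_norm_sub {w a : ℂ} {d : ℝ} (hd : 0 < d) (h : d ≤ ‖w - a‖) :
    ‖w‖ ≤ (1 + ‖a‖ / d) * ‖w - a‖ := by
  have h1 : ‖w‖ ≤ ‖w - a‖ + ‖a‖ := by simpa using norm_add_le (w - a) a
  have h2 : ‖a‖ ≤ ‖a‖ / d * ‖w - a‖ := by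
    rw [div_mul_eq_mul_div, le_div_iff₀ hd]
    exact mul_le_mul_of_nonneg_left h (norm_nonneg a)
  linarith

/-- For a pole left of the line `Re x = c`, the coordinate keeps a positive distance from it, so
subtracting the pole costs a constant only. For the pole `1`, `x - 1 = (1 - c) (cos φ - 1)`. -/
lemma exists_le_norm_xCoord_sub {c : ℝ} (hc1 : c < 1) {a : ℂ} (ha : IsPole c a) :
    ∃ m > 0, ∀ φ ∈ strip, 1 ≤ |φ.im| → m * Real.exp |φ.im| ≤ ‖xCoord c φ - a‖ := by
  have hc : 0 < 1 - c := sub_pos.2 hc1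
  have hcn : ‖(1 - c : ℂ)‖ = 1 - c := by
    rw [← Complex.ofReal_one, ← Complex.ofReal_sub, Complex.norm_real, Real.norm_of_nonneg hc.le]
  rcases ha with ha | rfl
  · have hd : 0 < c - a.re := sub_pos.2 ha
    refine ⟨(1 - c) / 4 / (1 + ‖a - c‖ / (c - a.re)), by positivity, fun φ hφ h => ?_⟩
    have h1 : c - a.re ≤ ‖xCoord c φ - a‖ := by
      refine le_trans ?_ (Complex.re_le_norm _)
      rw [Complex.sub_re]
      linarith [lt_re_xCoord hc1 hφ]
    have h2 : (1 - c : ℂ) * Complex.cos φ - (a - c) = xCoord c φ - a := by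
      rw [xCoord]; ring
    rw [← h2] at h1 ⊢
    have h3 := norm_le_mul_norm_sub hd h1
    rw [norm_mul, hcn] at h3
    have h4 := exp_div_le_norm_cos h
    rw [div_mul_eq_mul_div, div_le_iff₀ (by positivity)]
    nlinarith
  · refine ⟨(1 - c) / 8, by positivity, fun φ _ h => ?_⟩
    have h1 : xCoord c φ - 1 = (1 - c) * (Complex.cos φ - 1) := by rw [xCoord]; ring
    rw [h1, norm_mul, hcn]
    nlinarith [exp_div_le_norm_cos_sub_one h]

/-- The coefficient of the form `dx / (x - a)` in the coordinate `φ`. -/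
def stripForm (c : ℝ) (a φ : ℂ) : ℂ := -((1 - c) * Complex.sin φ) / (xCoord c φ - a)

lemma differentiable_xCoord (c : ℝ) : Differentiable ℂ (xCoord c) :=
  (Complex.differentiable_cos.const_mul _).const_add _

lemma differentiableOn_stripForm {c : ℝ} (hc1 : c < 1) {a : ℂ} (ha : IsPole c a) :
    DifferentiableOn ℂ (stripForm c a) strip := by
  refine DifferentiableOn.div ?_ ?_ fun φ hφ => xCoord_ne hc1 ha hφ
  · exact (Complex.differentiable_sin.const_mul _).neg.differentiableOn
  · exact ((differentiable_xCoord c).sub_const a).differentiableOn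

lemma exists_norm_stripForm_le {c : ℝ} (hc1 : c < 1) {a : ℂ} (ha : IsPole c a) :
    ∃ C : ℝ, 0 ≤ C ∧ ∀ φ ∈ strip, 1 ≤ |φ.im| → ‖stripForm c a φ‖ ≤ C := by
  obtain ⟨m, hm, h⟩ := exists_le_norm_xCoord_sub hc1 ha
  refine ⟨‖(1 - c : ℂ)‖ / m, by positivity, fun φ hφ h1 => ?_⟩
  have h2 := h φ hφ h1
  have h3 := Real.exp_pos |φ.im|
  rw [stripForm, norm_div, norm_neg, norm_mul]
  calc ‖(1 - c : ℂ)‖ * ‖Complex.sin φ‖ / ‖xCoord c φ - a‖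
      ≤ ‖(1 - c : ℂ)‖ * Real.exp |φ.im| / (m * Real.exp |φ.im|) := by
        gcongr
        exact norm_sin_le φ
    _ = ‖(1 - c : ℂ)‖ / m := by field_simp

/-- The difference equals the form at `a` times `a / x`: a bounded factor times one of size `exp
(-|Im φ|)`. -/
lemma exists_norm_stripForm_sub_le {c : ℝ} (hc0 : 0 < c) (hc1 : c < 1) {a : ℂ}
    (ha : IsPole c a) : ∃ C : ℝ, 0 ≤ C ∧ ∀ φ ∈ strip, 1 ≤ |φ.im| →
      ‖stripForm c a φ - stripForm c 0 φ‖ ≤ C * Real.exp (-|φ.im|) := by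
  have h0 : IsPole c 0 := Or.inl (by simpa using hc0)
  obtain ⟨m, hm, h⟩ := exists_le_norm_xCoord_sub hc1 h0
  obtain ⟨C, hC0, hC⟩ := exists_norm_stripForm_le hc1 ha
  refine ⟨C * ‖a‖ / m, by positivity, fun φ hφ h1 => ?_⟩
  have h2 := h φ hφ h1
  rw [sub_zero] at h2
  have h3 := Real.exp_pos |φ.im|
  have n1 := xCoord_ne hc1 ha hφ
  have n2 := xCoord_ne hc1 h0 hφ
  rw [sub_zero] at n2
  have e : stripForm c a φ - stripForm c 0 φ = stripForm c a φ * a / xCoord c φ := by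
    rw [stripForm, stripForm, sub_zero]
    field_simp
    ring
  rw [e, norm_div, norm_mul, Real.exp_neg]
  calc ‖stripForm c a φ‖ * ‖a‖ / ‖xCoord c φ‖ ≤ C * ‖a‖ / (m * Real.exp |φ.im|) := by
        gcongr
        exact hC φ hφ h1
    _ = C * ‖a‖ / m * (Real.exp |φ.im|)⁻¹ := by field_simp

/-! ### The last form, with powers of the logarithm -/

lemma one_add_pow_le (n : ℕ) {b : ℝ} (hb : 0 ≤ b) :
    (1 + b) ^ n ≤ 2 ^ n * n.factorial * Real.exp (1 / 2) * Real.exp (b / 2) := by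
  have h1 := Real.pow_div_factorial_le_exp ((1 + b) / 2) (by positivity) n
  rw [div_le_iff₀ (by positivity), div_pow, div_le_iff₀ (by positivity), add_div,
    Real.exp_add] at h1
  linarith

lemma norm_log_le {w : ℂ} {m M : ℝ} (hm : 0 < m) (h1 : m ≤ ‖w‖) (h2 : ‖w‖ ≤ M) :
    ‖Complex.log w‖ ≤ |Real.log m| + |Real.log M| + 4 := by
  have h3 : ‖Complex.log w‖ ≤ |Real.log ‖w‖| + |Complex.arg w| := by
    simpa [Complex.log_re, Complex.log_im] using Complex.norm_le_abs_re_add_abs_im (Complex.log w)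
  have h4 := (Complex.abs_arg_le_pi w).trans Real.pi_le_four
  have h5 : Real.log m ≤ Real.log ‖w‖ := Real.log_le_log hm h1
  have h6 : Real.log ‖w‖ ≤ Real.log M := Real.log_le_log (hm.trans_le h1) h2
  have h7 : |Real.log ‖w‖| ≤ |Real.log m| + |Real.log M| := by
    rw [abs_le]
    constructor
    · linarith [neg_abs_le (Real.log m), abs_nonneg (Real.log M)]
    · linarith [le_abs_self (Real.log M), abs_nonneg (Real.log m)]
  linarith

/-- The coefficient of `(e_b - e_0) (log x)^n / n!` in the coordinate `φ`. -/
def stripLast (c : ℝ) (b : ℂ) (n : ℕ) (φ : ℂ) : ℂ :=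
  (stripForm c b φ - stripForm c 0 φ) * (Complex.log (xCoord c φ) ^ n / n.factorial)

lemma differentiableOn_stripLast {c : ℝ} (hc0 : 0 < c) (hc1 : c < 1) {b : ℂ} (hb : IsPole c b)
    (n : ℕ) : DifferentiableOn ℂ (stripLast c b n) strip := by
  have h0 : IsPole c 0 := Or.inl (by simpa using hc0)
  refine ((differentiableOn_stripForm hc1 hb).sub (differentiableOn_stripForm hc1 h0)).mul
    (DifferentiableOn.div_const (DifferentiableOn.pow ?_ n) _)
  refine (differentiable_xCoord c).differentiableOn.clog fun φ hφ => ?_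
  exact Or.inl (hc0.trans (lt_re_xCoord hc1 hφ))

lemma stripDecay_stripLast {c : ℝ} (hc0 : 0 < c) (hc1 : c < 1) {b : ℂ} (hb : IsPole c b)
    (n : ℕ) : StripDecay (stripLast c b n) := by
  obtain ⟨C, hC0, hC⟩ := exists_norm_stripForm_sub_le hc0 hc1 hb
  set A := |Real.log c| + 4 + 1 with hA
  have hA1 : 0 < A := by positivity
  refine ⟨C * (A ^ n * (2 ^ n * n.factorial * Real.exp (1 / 2))), fun φ hφ h1 => ?_⟩
  have hlog : ‖Complex.log (xCoord c φ)‖ ≤ A * (1 + |φ.im|) := by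
    have hlow : c ≤ ‖xCoord c φ‖ := (lt_re_xCoord hc1 hφ).le.trans (Complex.re_le_norm _)
    have hup : ‖xCoord c φ‖ ≤ Real.exp |φ.im| := by
      have h2 : ‖(1 - c : ℂ)‖ = 1 - c := by
        rw [← Complex.ofReal_one, ← Complex.ofReal_sub, Complex.norm_real,
          Real.norm_of_nonneg (sub_pos.2 hc1).le]
      have h3 : ‖xCoord c φ‖ ≤ ‖(c : ℂ)‖ + ‖(1 - c : ℂ) * Complex.cos φ‖ := norm_add_le _ _
      rw [norm_mul, h2, Complex.norm_real, Real.norm_of_nonneg hc0.le] at h3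
      have h4 := norm_cos_le φ
      have h5 : 1 ≤ Real.exp |φ.im| := Real.one_le_exp (abs_nonneg _)
      nlinarith
    have h2 := norm_log_le hc0 hlow hup
    rw [Real.log_exp, abs_abs] at h2
    have := abs_nonneg φ.im
    have := abs_nonneg (Real.log c)
    rw [hA]
    nlinarith
  have hpow : ‖Complex.log (xCoord c φ) ^ n / n.factorial‖ ≤
      A ^ n * (2 ^ n * n.factorial * Real.exp (1 / 2)) * Real.exp (|φ.im| / 2) := by
    rw [norm_div, norm_pow, Complex.norm_natCast]
    have hf : (1 : ℝ) ≤ n.factorial := by exact_mod_cast n.factorial_pos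
    refine (div_le_self (by positivity) hf).trans ?_
    refine (pow_le_pow_left₀ (norm_nonneg _) hlog n).trans ?_
    rw [mul_pow, mul_assoc (A ^ n)]
    exact mul_le_mul_of_nonneg_left (one_add_pow_le n (abs_nonneg _)) (by positivity)
  rw [stripLast, norm_mul]
  refine (mul_le_mul (hC φ hφ h1) hpow (norm_nonneg _) (by positivity)).trans ?_
  -- Half of the decay of `e_b - e_0` pays for the power of the logarithm; this explains the
  -- exponent `1/2` in `StripDecay`.
  have e : Real.exp (-|φ.im|) * Real.exp (|φ.im| / 2) ≤ Real.exp (-φ.im / 2) := by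
    rw [← Real.exp_add]
    exact Real.exp_le_exp.2 (by linarith [le_abs_self φ.im])
  calc _ = C * (A ^ n * (2 ^ n * n.factorial * Real.exp (1 / 2))) *
        (Real.exp (-|φ.im|) * Real.exp (|φ.im| / 2)) := by ring
    _ ≤ _ := mul_le_mul_of_nonneg_left e (by positivity)

/-! ### Paths in the slit half-plane from one end to the other -/

/-- A path in the half-plane `c < Re x`, slit along `[1, ∞)`, that stays away from `1` and goes to
infinity with speed `1 / (t (1 - t))`, above the slit for `t → 0` and below it for `t → 1`. -/
structure GoodPath (c : ℝ) (γ : ℝ → ℂ) : Prop where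
  differentiable : ∀ t ∈ Ioo (0 : ℝ) 1, DifferentiableAt ℝ γ t
  deriv_cont : ContinuousOn (deriv γ) (Ioo 0 1)
  lt_re : ∀ t ∈ Ioo (0 : ℝ) 1, c < (γ t).re
  slit : ∀ t ∈ Ioo (0 : ℝ) 1, (γ t).im = 0 → (γ t).re < 1
  far : ∃ d > 0, ∀ t ∈ Ioo (0 : ℝ) 1, d ≤ ‖γ t - 1‖
  lower : ∃ m > 0, ∀ t ∈ Ioo (0 : ℝ) 1, m ≤ t * (1 - t) * ‖γ t‖
  upper : ∃ M : ℝ, ∀ t ∈ Ioo (0 : ℝ) 1, t * (1 - t) * ‖γ t‖ ≤ M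
  deriv_le : ∃ M : ℝ, ∀ t ∈ Ioo (0 : ℝ) 1, (t * (1 - t)) ^ 2 * ‖deriv γ t‖ ≤ M
  im_neg : ∀ᶠ t in 𝓝[<] (1 : ℝ), (γ t).im < 0
  im_pos : ∀ᶠ t in 𝓝[>] (0 : ℝ), 0 < (γ t).im

/-- The form `(e_b - e_0) (log x)^n / n!` along `γ`. -/
def pathLast (γ : ℝ → ℂ) (b : ℂ) (n : ℕ) : ℝ → ℂ := fun t =>
  (eForm γ b t - eForm γ 0 t) * (Complex.log (γ t) ^ n / n.factorial)

open Classical in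
/-- A function as an element of `Letter`, and `0` if it is none. -/
def toLetter (φ : ℝ → ℂ) : Letter := if h : φ ∈ Letter then ⟨φ, h⟩ else 0

open Classical in
/-- A function as an element of `Tail`, and `0` if it is none. -/
def toTail (f : ℝ → ℂ) : Tail := if h : f ∈ Tail then ⟨f, h⟩ else 0

lemma toLetter_val {φ : ℝ → ℂ} (h : φ ∈ Letter) : (toLetter φ).1 = φ := by
  rw [toLetter, dif_pos h]

lemma toTail_val {f : ℝ → ℂ} (h : IsTail f) : (toTail f).1 = f := by
  have h' : f ∈ Tail := h
  rw [toTail, dif_pos h']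

lemma mul_one_sub_pos {t : ℝ} (ht : t ∈ Ioo (0 : ℝ) 1) : 0 < t * (1 - t) :=
  mul_pos ht.1 (sub_pos.2 ht.2)

lemma isPole_zero {c : ℝ} (hc : 0 < c) : IsPole c 0 := Or.inl (by simpa using hc)

namespace GoodPath

variable {c : ℝ} {γ : ℝ → ℂ}

lemma continuousOn (h : GoodPath c γ) : ContinuousOn γ (Ioo 0 1) := fun t ht =>
  (h.differentiable t ht).continuousAt.continuousWithinAt

lemma exists_le_norm_sub (h : GoodPath c γ) {a : ℂ} (ha : IsPole c a) :
    ∃ d > 0, ∀ t ∈ Ioo (0 : ℝ) 1, d ≤ ‖γ t - a‖ := by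
  rcases ha with ha | rfl
  · refine ⟨c - a.re, sub_pos.2 ha, fun t ht => le_trans ?_ (Complex.re_le_norm _)⟩
    rw [Complex.sub_re]
    linarith [h.lt_re t ht]
  · exact h.far

lemma sub_ne_zero (h : GoodPath c γ) {a : ℂ} (ha : IsPole c a) {t : ℝ} (ht : t ∈ Ioo (0 : ℝ) 1) :
    γ t - a ≠ 0 := by
  obtain ⟨d, hd, h1⟩ := h.exists_le_norm_sub ha
  exact norm_pos_iff.1 (hd.trans_le (h1 t ht))

lemma exists_le_mul_norm_sub (h : GoodPath c γ) {a : ℂ} (ha : IsPole c a) :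
    ∃ m > 0, ∀ t ∈ Ioo (0 : ℝ) 1, m ≤ t * (1 - t) * ‖γ t - a‖ := by
  obtain ⟨d, hd, h1⟩ := h.exists_le_norm_sub ha
  obtain ⟨m, hm, h2⟩ := h.lower
  refine ⟨m / (1 + ‖a‖ / d), by positivity, fun t ht => ?_⟩
  rw [div_le_iff₀ (by positivity)]
  have h3 := mul_le_mul_of_nonneg_left (norm_le_mul_norm_sub hd (h1 t ht)) (mul_one_sub_pos ht).le
  linarith [h2 t ht]

lemma continuousOn_eForm (h : GoodPath c γ) {a : ℂ} (ha : IsPole c a) :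
    ContinuousOn (eForm γ a) (Ioo 0 1) :=
  h.deriv_cont.div (h.continuousOn.sub continuousOn_const) fun _ ht => h.sub_ne_zero ha ht

lemma exists_norm_eForm_le (h : GoodPath c γ) {a : ℂ} (ha : IsPole c a) :
    ∃ C : ℝ, 0 ≤ C ∧ ∀ t ∈ Ioo (0 : ℝ) 1, ‖eForm γ a t‖ ≤ C / (t * (1 - t)) := by
  obtain ⟨m, hm, h1⟩ := h.exists_le_mul_norm_sub ha
  obtain ⟨M, h2⟩ := h.deriv_le
  refine ⟨|M| / m, by positivity, fun t ht => ?_⟩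
  have h3 := mul_one_sub_pos ht
  have h4 := norm_pos_iff.2 (h.sub_ne_zero ha ht)
  rw [eForm, norm_div, div_le_div_iff₀ h4 h3, div_mul_eq_mul_div, le_div_iff₀ hm]
  calc ‖deriv γ t‖ * (t * (1 - t)) * m
      ≤ ‖deriv γ t‖ * (t * (1 - t)) * (t * (1 - t) * ‖γ t - a‖) := by
        gcongr
        exact h1 t ht
    _ = (t * (1 - t)) ^ 2 * ‖deriv γ t‖ * ‖γ t - a‖ := by ring
    _ ≤ |M| * ‖γ t - a‖ := by
        gcongr
        exact (h2 t ht).trans (le_abs_self M)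

lemma eForm_mem (h : GoodPath c γ) {a : ℂ} (ha : IsPole c a) : eForm γ a ∈ Letter := by
  obtain ⟨C, -, hC⟩ := h.exists_norm_eForm_le ha
  exact ⟨h.continuousOn_eForm ha, C, hC⟩

/-- Again `e_a - e_0` is `e_a` times `a / γ`, and `1 / γ = O(t (1 - t))` cancels the poles of `e_a`
at both ends. -/
lemma isBdd_eForm_sub (hc : 0 < c) (h : GoodPath c γ) {a : ℂ} (ha : IsPole c a) :
    IsBdd (eForm γ a - eForm γ 0) := by
  have h0 := isPole_zero hc
  refine ⟨(h.continuousOn_eForm ha).sub (h.continuousOn_eForm h0), ?_⟩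
  obtain ⟨C, hC0, hC⟩ := h.exists_norm_eForm_le ha
  obtain ⟨m, hm, h1⟩ := h.lower
  refine ⟨C * ‖a‖ / m, fun t ht => ?_⟩
  have n1 := h.sub_ne_zero ha ht
  have n2 := h.sub_ne_zero h0 ht
  rw [sub_zero] at n2
  have e : (eForm γ a - eForm γ 0) t = eForm γ a t * a / γ t := by
    rw [Pi.sub_apply, eForm, eForm, sub_zero]
    field_simp
    ring
  have h3 := mul_one_sub_pos ht
  have h4 := norm_pos_iff.2 n2
  rw [e, norm_div, norm_mul, div_le_div_iff₀ h4 hm]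
  have h5 := hC t ht
  rw [le_div_iff₀ h3] at h5
  calc ‖eForm γ a t‖ * ‖a‖ * m ≤ ‖eForm γ a t‖ * ‖a‖ * (t * (1 - t) * ‖γ t‖) := by
        gcongr
        exact h1 t ht
    _ = ‖eForm γ a t‖ * (t * (1 - t)) * (‖a‖ * ‖γ t‖) := by ring
    _ ≤ C * (‖a‖ * ‖γ t‖) := by gcongr
    _ = C * ‖a‖ * ‖γ t‖ := by ring

lemma exists_norm_log_le (hc : 0 < c) (h : GoodPath c γ) :
    ∃ C : ℝ, 0 ≤ C ∧ ∀ t ∈ Ioo (0 : ℝ) 1, ‖Complex.log (γ t)‖ ≤ C * lam t := by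
  obtain ⟨M, hM⟩ := h.upper
  set N := |M| + 1
  refine ⟨|Real.log c| + |Real.log N| + 1 + 4, by positivity, fun t ht => ?_⟩
  have h1 : c ≤ ‖γ t‖ := (h.lt_re t ht).le.trans (Complex.re_le_norm _)
  have h3 := mul_one_sub_pos ht
  have h2 : ‖γ t‖ ≤ N / (t * (1 - t)) := by
    rw [le_div_iff₀ h3, mul_comm]
    exact (hM t ht).trans ((le_abs_self M).trans (by simp [N]))
  have h4 := norm_log_le hc h1 h2
  have hN : 0 < N := by positivity
  rw [Real.log_div hN.ne' h3.ne'] at h4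
  have h5 := lam_eq ht
  have h6 := one_le_lam ht
  have h7 : |Real.log N - Real.log (t * (1 - t))| ≤ |Real.log N| + lam t := by
    refine (abs_sub _ _).trans ?_
    rw [show Real.log (t * (1 - t)) = 1 - lam t by linarith, abs_sub_comm 1,
      abs_of_nonneg (by linarith : 0 ≤ lam t - 1)]
    linarith
  have := abs_nonneg (Real.log c)
  have := abs_nonneg (Real.log N)
  nlinarith

lemma continuousOn_log (hc : 0 < c) (h : GoodPath c γ) :
    ContinuousOn (fun t => Complex.log (γ t)) (Ioo 0 1) :=
  h.continuousOn.clog fun t ht => Or.inl (hc.trans (h.lt_re t ht))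

lemma isHead_pathLast (hc : 0 < c) (h : GoodPath c γ) {b : ℂ} (hb : IsPole c b) (n : ℕ) :
    IsHead (pathLast γ b n) := by
  have h1 := h.isBdd_eForm_sub hc hb
  obtain ⟨D, hD⟩ := h1.bound
  obtain ⟨C, hC0, hC⟩ := h.exists_norm_log_le hc
  refine ⟨h1.cont.mul (((h.continuousOn_log hc).pow n).div_const _), |D| * C ^ n, n,
    fun t ht => ?_⟩
  rw [pathLast, norm_mul, norm_div, norm_pow, Complex.norm_natCast, mul_assoc, ← mul_pow]
  refine mul_le_mul ((hD t ht).trans (le_abs_self D)) ?_ (by positivity) (abs_nonneg D)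
  have hf : (1 : ℝ) ≤ n.factorial := by exact_mod_cast n.factorial_pos
  exact (div_le_self (by positivity) hf).trans (pow_le_pow_left₀ (norm_nonneg _) (hC t ht) n)

end GoodPath

/-- The lift of a path to the strip. -/
def stripLift (c : ℝ) (γ : ℝ → ℂ) (t : ℝ) : ℂ := invCos ((γ t - c) / (1 - c))

namespace GoodPath

variable {c : ℝ} {γ : ℝ → ℂ}

lemma stripLift_spec (hc1 : c < 1) (h : GoodPath c γ) {t : ℝ} (ht : t ∈ Ioo (0 : ℝ) 1) :
    stripLift c γ t ∈ strip ∧ xCoord c (stripLift c γ t) = γ t ∧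
      DifferentiableAt ℝ (stripLift c γ) t := by
  have hc : 0 < 1 - c := sub_pos.2 hc1
  have hcc : (1 - c : ℂ) = ((1 - c : ℝ) : ℂ) := by push_cast; rfl
  have hne : (1 - c : ℂ) ≠ 0 := by rw [hcc]; exact Complex.ofReal_ne_zero.2 hc.ne'
  have hre : ((γ t - c) / (1 - c) : ℂ).re = ((γ t).re - c) / (1 - c) := by
    rw [hcc, Complex.div_ofReal_re]; simp
  have him : ((γ t - c) / (1 - c) : ℂ).im = (γ t).im / (1 - c) := by
    rw [hcc, Complex.div_ofReal_im]; simp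
  have h1 : 0 < ((γ t - c) / (1 - c) : ℂ).re := by
    rw [hre]; exact div_pos (sub_pos.2 (h.lt_re t ht)) hc
  have h2 : ((γ t - c) / (1 - c) : ℂ).im = 0 → ((γ t - c) / (1 - c) : ℂ).re < 1 := by
    rw [hre, him, div_lt_one hc]
    intro h3
    have := h.slit t ht ((div_eq_zero_iff.1 h3).resolve_right hc.ne')
    linarith
  obtain ⟨e1, e2, e3⟩ := invCos_spec h1 h2
  refine ⟨e2, ?_, ?_⟩
  · rw [xCoord, stripLift, e1, mul_div_cancel₀ _ hne]; ring
  · exact (e3.restrictScalars ℝ).comp t (f := fun t => (γ t - c) / (1 - c : ℂ))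
      (((h.differentiable t ht).sub_const _).div_const _)

/-- The relation comes from differentiating `xCoord c ∘ stripLift c γ = γ`; no formula for the
derivative of `invCos` is needed. -/
lemma deriv_stripLift (hc1 : c < 1) (h : GoodPath c γ) {t : ℝ} (ht : t ∈ Ioo (0 : ℝ) 1) :
    -((1 - c) * Complex.sin (stripLift c γ t)) * deriv (stripLift c γ) t = deriv γ t := by
  obtain ⟨-, -, h3⟩ := h.stripLift_spec hc1 ht
  have h4 : HasDerivAt (xCoord c) (-((1 - c) * Complex.sin (stripLift c γ t)))
      (stripLift c γ t) :=
    (((Complex.hasDerivAt_cos (stripLift c γ t)).const_mul (1 - c : ℂ)).const_add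
      (c : ℂ)).congr_deriv (by ring)
  have h5 : HasDerivAt (fun t => xCoord c (stripLift c γ t)) _ t := h4.comp t h3.hasDerivAt
  have h6 : (fun t => xCoord c (stripLift c γ t)) =ᶠ[𝓝 t] γ := by
    filter_upwards [Ioo_mem_nhds ht.1 ht.2] with s hs
    exact (h.stripLift_spec hc1 hs).2.1
  rw [← h6.deriv_eq, h5.deriv]

lemma stripForm_mul_deriv (hc1 : c < 1) (h : GoodPath c γ) (a : ℂ) {t : ℝ}
    (ht : t ∈ Ioo (0 : ℝ) 1) :
    stripForm c a (stripLift c γ t) * deriv (stripLift c γ) t = eForm γ a t := by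
  rw [stripForm, (h.stripLift_spec hc1 ht).2.1, div_mul_eq_mul_div, h.deriv_stripLift hc1 ht, eForm]

/-- Near the ends `γ` is unbounded, while `‖x‖ ≤ 1 + exp |Im φ|`; hence the lift leaves every
bounded range of heights. -/
lemma eventually_lt_abs_im {c : ℝ} (hc0 : 0 < c) (hc1 : c < 1) {γ : ℝ → ℂ} (h : GoodPath c γ)
    (N : ℝ) {l : Filter ℝ} (hl : ∀ᶠ t in l, t ∈ Ioo (0 : ℝ) 1)
    (hl0 : Tendsto (fun t : ℝ => t * (1 - t)) l (𝓝 0)) :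
    ∀ᶠ t in l, N < |(stripLift c γ t).im| := by
  obtain ⟨m, hm, h1⟩ := h.lower
  have h2 : Tendsto (fun t : ℝ => t * (1 - t) * (1 + Real.exp N)) l (𝓝 0) := by
    simpa using hl0.mul_const (1 + Real.exp N)
  filter_upwards [hl, h2.eventually (gt_mem_nhds hm)] with t ht h3
  by_contra! h4
  obtain ⟨-, h5, -⟩ := h.stripLift_spec hc1 ht
  have h6 : ‖γ t‖ ≤ 1 + Real.exp N := by
    rw [← h5, xCoord]
    have h7 : ‖(1 - c : ℂ)‖ = 1 - c := by
      rw [← Complex.ofReal_one, ← Complex.ofReal_sub, Complex.norm_real,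
        Real.norm_of_nonneg (sub_pos.2 hc1).le]
    refine (norm_add_le _ _).trans ?_
    rw [norm_mul, h7, Complex.norm_real, Real.norm_of_nonneg hc0.le]
    have h8 := (norm_cos_le (stripLift c γ t)).trans (Real.exp_le_exp.2 h4)
    nlinarith [norm_nonneg (Complex.cos (stripLift c γ t))]
  have := mul_le_mul_of_nonneg_left h6 (mul_one_sub_pos ht).le
  linarith [h1 t ht]

/-- On the strip `sin (Re φ) > 0`, so the imaginary parts of the path and of its lift have opposite
signs. This decides which end of the strip the lift approaches. -/
lemma im_eq (hc1 : c < 1) (h : GoodPath c γ) {t : ℝ} (ht : t ∈ Ioo (0 : ℝ) 1) :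
    ∃ r > 0, (γ t).im = -(r * Real.sinh (stripLift c γ t).im) := by
  obtain ⟨h1, h2, -⟩ := h.stripLift_spec hc1 ht
  refine ⟨(1 - c) * Real.sin (stripLift c γ t).re, mul_pos (sub_pos.2 hc1)
    (Real.sin_pos_of_pos_of_lt_pi h1.1 (by linarith [h1.2, Real.pi_pos])), ?_⟩
  have h3 := congrArg Complex.im h2
  rw [← h3, xCoord]
  have h4 : ((c : ℂ) + (1 - c) * Complex.cos (stripLift c γ t)).im =
      (1 - c) * (Complex.cos (stripLift c γ t)).im := by simp
  rw [h4, cos_im]; ring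

lemma tendsto_im_atTop (hc0 : 0 < c) (hc1 : c < 1) (h : GoodPath c γ) :
    Tendsto (fun t => (stripLift c γ t).im) (𝓝[<] 1) atTop := by
  refine tendsto_atTop.2 fun N => ?_
  have hl : ∀ᶠ t in 𝓝[<] (1 : ℝ), t ∈ Ioo (0 : ℝ) 1 := Ioo_mem_nhdsLT one_pos
  have hl0 : Tendsto (fun t : ℝ => t * (1 - t)) (𝓝[<] 1) (𝓝 0) := by
    have : Tendsto (fun t : ℝ => t * (1 - t)) (𝓝 1) (𝓝 (1 * (1 - 1))) :=
      (continuous_id.mul (continuous_const.sub continuous_id)).tendsto 1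
    simpa using this.mono_left nhdsWithin_le_nhds
  filter_upwards [hl, h.im_neg, h.eventually_lt_abs_im hc0 hc1 N hl hl0] with t ht h1 h2
  obtain ⟨r, hr, h3⟩ := h.im_eq hc1 ht
  have h4 : 0 < Real.sinh (stripLift c γ t).im := by
    rw [h3, neg_lt_zero] at h1
    exact pos_of_mul_pos_right h1 hr.le
  rw [abs_of_pos (Real.sinh_pos_iff.1 h4)] at h2
  exact h2.le

lemma tendsto_im_atBot (hc0 : 0 < c) (hc1 : c < 1) (h : GoodPath c γ) :
    Tendsto (fun t => (stripLift c γ t).im) (𝓝[>] 0) atBot := by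
  refine tendsto_atBot.2 fun N => ?_
  have hl : ∀ᶠ t in 𝓝[>] (0 : ℝ), t ∈ Ioo (0 : ℝ) 1 := Ioo_mem_nhdsGT one_pos
  have hl0 : Tendsto (fun t : ℝ => t * (1 - t)) (𝓝[>] 0) (𝓝 0) := by
    have : Tendsto (fun t : ℝ => t * (1 - t)) (𝓝 0) (𝓝 (0 * (1 - 0))) :=
      (continuous_id.mul (continuous_const.sub continuous_id)).tendsto 0
    simpa using this.mono_left nhdsWithin_le_nhds
  filter_upwards [hl, h.im_pos, h.eventually_lt_abs_im hc0 hc1 (-N) hl hl0] with t ht h1 h2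
  obtain ⟨r, hr, h3⟩ := h.im_eq hc1 ht
  have h4 : Real.sinh (stripLift c γ t).im < 0 := by
    by_contra! h5
    have := mul_nonneg hr.le h5
    linarith
  rw [abs_of_neg (Real.sinh_neg_iff.1 h4)] at h2
  linarith

lemma tendsto_comp_stripLift (hc0 : 0 < c) (hc1 : c < 1) (h : GoodPath c γ) {K : ℂ → ℂ}
    (hK : StripDecay K) : Tendsto (fun t => K (stripLift c γ t)) (𝓝[<] 1) (𝓝 0) := by
  obtain ⟨C, hC⟩ := hK
  have h1 := h.tendsto_im_atTop hc0 hc1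
  have h2 : Tendsto (fun t => C * Real.exp (-(stripLift c γ t).im / 2)) (𝓝[<] 1) (𝓝 0) := by
    have h3 := (Real.tendsto_exp_atBot.comp
      (tendsto_neg_atTop_atBot.comp (h1.atTop_div_const two_pos))).const_mul C
    rw [mul_zero] at h3
    refine h3.congr fun t => ?_
    simp only [Function.comp, neg_div]
  refine squeeze_zero_norm' ?_ h2
  filter_upwards [Ioo_mem_nhdsLT one_pos, h1.eventually_ge_atTop 1] with t ht h4
  exact hC _ (h.stripLift_spec hc1 ht).1 (h4.trans (le_abs_self _))

/-- Both sides have the same derivative and vanish at the end of the path, since the lift goes to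
the upper end of the strip, where `K` decays. -/
lemma tail_eq_comp (hc0 : 0 < c) (hc1 : c < 1) (h : GoodPath c γ) {F K : ℂ → ℂ}
    (hK : ∀ φ ∈ strip, HasDerivAt K (-F φ) φ) (hd : StripDecay K) (f : Tail)
    (hf : ∀ t ∈ Ioo (0 : ℝ) 1, f.1 t = F (stripLift c γ t) * deriv (stripLift c γ) t) :
    ∀ t ∈ Ioo (0 : ℝ) 1, (tail f).1 t = K (stripLift c γ t) := by
  intro t ht
  refine tail_eq_of_hasDerivAt f (fun t => K (stripLift c γ t)) (fun s hs => ?_)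
    (h.tendsto_comp_stripLift hc0 hc1 hd) ht
  obtain ⟨h1, -, h3⟩ := h.stripLift_spec hc1 hs
  refine ((hK _ h1).comp s h3.hasDerivAt).congr_deriv ?_
  rw [hf s hs]; ring

end GoodPath

/-- The iterated integral from `s` to `1` along `γ` of the forms `e_a`, for `a` in a list, followed
by `(e_b - e_0) (log x)^n / n!`. -/
def pathTail (γ : ℝ → ℂ) (as : List ℂ) (b : ℂ) (n : ℕ) : Decay :=
  (as.map fun a => op (toLetter (eForm γ a))).prod (tail (toTail (pathLast γ b n)))

/-- The point is the order of quantifiers: one function `K` serves all paths. Each letter is bounded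
on the strip away from the real axis, so multiplying by it preserves `StripDecay` and a decaying
primitive exists again. -/
lemma exists_strip_pathTail {c : ℝ} (hc0 : 0 < c) (hc1 : c < 1) {as : List ℂ}
    (has : ∀ a ∈ as, IsPole c a) {b : ℂ} (hb : IsPole c b) (n : ℕ) :
    ∃ K : ℂ → ℂ, DifferentiableOn ℂ K strip ∧ StripDecay K ∧
      ∀ γ, GoodPath c γ → ∀ t ∈ Ioo (0 : ℝ) 1, (pathTail γ as b n).1 t = K (stripLift c γ t) := by
  induction as with
  | nil =>
    obtain ⟨K, hK, hd⟩ := exists_decaying_primitive (differentiableOn_stripLast hc0 hc1 hb n)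
      (stripDecay_stripLast hc0 hc1 hb n)
    refine ⟨K, fun φ hφ => (hK φ hφ).differentiableAt.differentiableWithinAt, hd, fun γ hγ => ?_⟩
    refine hγ.tail_eq_comp hc0 hc1 hK hd _ fun t ht => ?_
    rw [toTail_val (hγ.isHead_pathLast hc0 hb n).isTail, stripLast,
      (hγ.stripLift_spec hc1 ht).2.1, pathLast, ← hγ.stripForm_mul_deriv hc1 b ht,
      ← hγ.stripForm_mul_deriv hc1 0 ht]
    ring
  | cons a as ih =>
    obtain ⟨K, hK, ⟨C, hC⟩, hm⟩ := ih fun x hx => has x (List.mem_cons_of_mem _ hx)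
    have ha := has a List.mem_cons_self
    obtain ⟨D, hD0, hD⟩ := exists_norm_stripForm_le hc1 ha
    obtain ⟨K', hK', hd'⟩ := exists_decaying_primitive
      (f := fun φ => stripForm c a φ * K φ) ((differentiableOn_stripForm hc1 ha).mul hK)
      ⟨D * C, fun φ hφ h => by
        rw [norm_mul, mul_assoc]
        exact mul_le_mul (hD φ hφ h) (hC φ hφ h) (norm_nonneg _) hD0⟩
    refine ⟨K', fun φ hφ => (hK' φ hφ).differentiableAt.differentiableWithinAt, hd',
      fun γ hγ => ?_⟩
    refine hγ.tail_eq_comp hc0 hc1 hK' hd' ⟨_, isTail_mul (toLetter (eForm γ a))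
      (pathTail γ as b n)⟩ fun t ht => ?_
    change (toLetter (eForm γ a)).1 t * (pathTail γ as b n).1 t = _
    rw [toLetter_val (hγ.eForm_mem ha), hm γ hγ t ht,
      ← hγ.stripForm_mul_deriv hc1 a ht]
    ring

/-- Homotopy invariance: the convergent iterated integrals along all good paths agree. -/
theorem exists_total_pathTail_eq {c : ℝ} (hc0 : 0 < c) (hc1 : c < 1) {a : ℂ} (ha : IsPole c a)
    {as : List ℂ} (has : ∀ a ∈ as, IsPole c a) {b : ℂ} (hb : IsPole c b) (n : ℕ) :
    ∃ V : ℂ, ∀ γ, ∀ hγ : GoodPath c γ,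
      total (eForm γ a - eForm γ 0) (hγ.isBdd_eForm_sub hc0 ha) (pathTail γ as b n) = V := by
  obtain ⟨K, hK, ⟨C, hC⟩, hm⟩ := exists_strip_pathTail hc0 hc1 has hb n
  obtain ⟨D, hD0, hD⟩ := exists_norm_stripForm_sub_le hc0 hc1 ha
  have h0 := isPole_zero hc0
  obtain ⟨K', V, hK', hd', E, hE⟩ := exists_primitive_of_two_sided_decay
    (f := fun φ => (stripForm c a φ - stripForm c 0 φ) * K φ) (C := D * |C|)
    (((differentiableOn_stripForm hc1 ha).sub (differentiableOn_stripForm hc1 h0)).mul hK)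
    (fun φ hφ h => by
      rw [norm_mul]
      refine (mul_le_mul (hD φ hφ h) (hC φ hφ h) (norm_nonneg _) (by positivity)).trans ?_
      -- At the lower end `K` may grow like `exp (|Im φ| / 2)`, and the decay of the first form
      -- still wins by a factor of the same size.
      have e : Real.exp (-|φ.im|) * Real.exp (-φ.im / 2) ≤ Real.exp (-|φ.im| / 2) := by
        rw [← Real.exp_add]
        exact Real.exp_le_exp.2 (by linarith [neg_le_abs φ.im])
      calc D * Real.exp (-|φ.im|) * (C * Real.exp (-φ.im / 2))
          = D * C * (Real.exp (-|φ.im|) * Real.exp (-φ.im / 2)) := by ring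
        _ ≤ D * |C| * (Real.exp (-|φ.im|) * Real.exp (-φ.im / 2)) := by
            gcongr; exact le_abs_self C
        _ ≤ _ := mul_le_mul_of_nonneg_left e (by positivity))
  refine ⟨V, fun γ hγ => ?_⟩
  rw [total_apply]
  have hlim : Tendsto (fun t => K' (stripLift c γ t)) (𝓝[>] 0) (𝓝 V) := by
    have h1 := hγ.tendsto_im_atBot hc0 hc1
    have h2 : Tendsto (fun t => E * Real.exp ((stripLift c γ t).im / 2)) (𝓝[>] 0) (𝓝 0) := by
      have h3 := (Real.tendsto_exp_atBot.comp (h1.atBot_div_const two_pos)).const_mul E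
      rwa [mul_zero] at h3
    refine tendsto_iff_norm_sub_tendsto_zero.2 (squeeze_zero' (Eventually.of_forall fun t =>
      norm_nonneg _) ?_ h2)
    filter_upwards [Ioo_mem_nhdsGT one_pos, h1.eventually_le_atBot (-1)] with t ht h4
    exact hE _ (hγ.stripLift_spec hc1 ht).1 h4
  have hint := ((hγ.isBdd_eForm_sub hc0 ha).isHead_mul (pathTail γ as b n)).intervalIntegrable
  have h5 := integral_eq_sub_of_hasDerivAt_of_tendsto (f := fun t => -K' (stripLift c γ t))
    one_pos (fun t ht => ?_) hint hlim.neg (hγ.tendsto_comp_stripLift hc0 hc1 hd').neg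
  · refine h5.trans ?_
    rw [neg_zero, zero_sub, neg_neg]
  · obtain ⟨h1, -, h3⟩ := hγ.stripLift_spec hc1 ht
    refine ((hK' _ h1).comp t h3.hasDerivAt).neg.congr_deriv ?_
    rw [Pi.mul_apply, Pi.sub_apply, hm γ hγ t ht, ← hγ.stripForm_mul_deriv hc1 a ht,
      ← hγ.stripForm_mul_deriv hc1 0 ht]
    ring

/-! ### The loop `β` -/

/-- The angle of `1 - β`. -/
def betaAngle (t : ℝ) : ℝ := 2 * Real.pi * (3 * t ^ 2 - 2 * t ^ 3)

lemma beta_eq (t : ℝ) :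
    β t = 1 - ((1 - t + t ^ 2 : ℝ) : ℂ) * Complex.exp (betaAngle t * Complex.I) := by
  rw [β, betaAngle]
  push_cast
  congr 2
  ring_nf

lemma beta_re (t : ℝ) : (β t).re = 1 - (1 - t + t ^ 2) * Real.cos (betaAngle t) := by
  rw [beta_eq, Complex.sub_re, Complex.re_ofReal_mul, Complex.exp_ofReal_mul_I_re, Complex.one_re]

lemma beta_im (t : ℝ) : (β t).im = -((1 - t + t ^ 2) * Real.sin (betaAngle t)) := by
  rw [beta_eq, Complex.sub_im, Complex.im_ofReal_mul, Complex.exp_ofReal_mul_I_im, Complex.one_im,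
    zero_sub]

lemma norm_one_sub_beta (t : ℝ) : ‖1 - β t‖ = 1 - t + t ^ 2 := by
  rw [beta_eq, sub_sub_cancel, norm_mul, Complex.norm_exp_ofReal_mul_I, mul_one, Complex.norm_real,
    Real.norm_of_nonneg (by nlinarith [sq_nonneg (t - 1 / 2)])]

lemma betaAngle_mem {t : ℝ} (ht : t ∈ Ioo (0 : ℝ) 1) :
    0 < betaAngle t ∧ betaAngle t < 2 * Real.pi := by
  have h0 := ht.1
  have h1 := ht.2
  have hpi := Real.pi_pos
  have h2 : 0 < 3 * t ^ 2 - 2 * t ^ 3 := by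
    have : 3 * t ^ 2 - 2 * t ^ 3 = t ^ 2 * (3 - 2 * t) := by ring
    rw [this]; exact mul_pos (by positivity) (by linarith)
  have h3 : 3 * t ^ 2 - 2 * t ^ 3 < 1 := by
    have : 1 - (3 * t ^ 2 - 2 * t ^ 3) = (1 - t) ^ 2 * (1 + 2 * t) := by ring
    have h4 : 0 < (1 - t) ^ 2 * (1 + 2 * t) := mul_pos (pow_pos (by linarith) 2) (by linarith)
    linarith
  exact ⟨by unfold betaAngle; positivity, by unfold betaAngle; nlinarith⟩

lemma betaAngle_sub_pi (t : ℝ) :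
    betaAngle t - Real.pi = Real.pi * ((2 * t - 1) * (1 + 2 * t * (1 - t))) := by
  unfold betaAngle; ring

lemma le_norm_beta {t : ℝ} : t * (1 - t) ≤ ‖β t‖ := by
  have h1 := norm_sub_norm_le (1 : ℂ) (1 - β t)
  rw [norm_one, norm_one_sub_beta, sub_sub_cancel] at h1
  linarith

lemma beta_ne_zero {t : ℝ} (ht : t ∈ Ioo (0 : ℝ) 1) : β t ≠ 0 :=
  norm_pos_iff.1 ((mul_one_sub_pos ht).trans_le le_norm_beta)

lemma contDiff_beta : ContDiff ℝ 1 β := by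
  have h : β = fun t : ℝ => 1 - (1 - (t : ℂ) + (t : ℂ) ^ 2) *
      Complex.exp (2 * Real.pi * Complex.I * (3 * (t : ℂ) ^ 2 - 2 * (t : ℂ) ^ 3)) := rfl
  rw [h]
  have h1 : ContDiff ℝ 1 fun t : ℝ => (t : ℂ) := Complex.ofRealCLM.contDiff
  fun_prop

lemma beta_zero : β 0 = 0 := by simp [β]

lemma beta_one : β 1 = 0 := by
  simp only [β, Complex.ofReal_one]
  rw [show (2 * Real.pi * Complex.I * (3 * 1 ^ 2 - 2 * 1 ^ 3) : ℂ) = 2 * Real.pi * Complex.I by ring,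
    Complex.exp_two_pi_mul_I]
  norm_num

lemma exists_norm_deriv_beta_le : ∃ M : ℝ, 0 ≤ M ∧ ∀ t ∈ Icc (0 : ℝ) 1, ‖deriv β t‖ ≤ M := by
  obtain ⟨M, hM⟩ := isCompact_Icc.exists_bound_of_continuousOn (s := Icc (0 : ℝ) 1)
    (contDiff_beta.continuous_deriv le_rfl).continuousOn
  exact ⟨M, (norm_nonneg _).trans (hM 0 (by norm_num)), hM⟩

/-- Since `β` vanishes at both ends, it is bounded by `M t` and by `M (1 - t)`. Multiply by `1 - t`
and by `t` respectively, and add. -/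
lemma exists_norm_beta_le : ∃ M > 0, ∀ t ∈ Ioo (0 : ℝ) 1, ‖β t‖ ≤ M * (t * (1 - t)) := by
  obtain ⟨M, hM0, hM⟩ := exists_norm_deriv_beta_le
  have hlip : ∀ x ∈ Icc (0 : ℝ) 1, ∀ y ∈ Icc (0 : ℝ) 1, ‖β y - β x‖ ≤ M * ‖y - x‖ :=
    fun x hx y hy => (convex_Icc (0 : ℝ) 1).norm_image_sub_le_of_norm_deriv_le
      (fun t _ => contDiff_beta.differentiable one_ne_zero t) hM hx hy
  refine ⟨2 * M + 1, by positivity, fun t ht => ?_⟩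
  have h0 := hlip 0 (by norm_num) t (Ioo_subset_Icc_self ht)
  have h1 := hlip 1 (by norm_num) t (Ioo_subset_Icc_self ht)
  rw [beta_zero, sub_zero, sub_zero, Real.norm_of_nonneg ht.1.le] at h0
  rw [beta_one, sub_zero, norm_sub_rev, Real.norm_of_nonneg (by linarith [ht.2])] at h1
  have h2 := ht.1
  have h3 := sub_pos.2 ht.2
  have h4 := mul_one_sub_pos ht
  have h5 : ‖β t‖ * (t + (1 - t)) ≤ M * (1 - t) * t + M * t * (1 - t) := by
    rw [mul_add]
    exact add_le_add (mul_le_mul_of_nonneg_right h1 h2.le) (mul_le_mul_of_nonneg_right h0 h3.le)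
  nlinarith

/-- The path `1 / β`. -/
def invBeta (t : ℝ) : ℂ := (β t)⁻¹

lemma hasDerivAt_invBeta {t : ℝ} (ht : t ∈ Ioo (0 : ℝ) 1) :
    HasDerivAt invBeta (-deriv β t / β t ^ 2) t :=
  ((contDiff_beta.differentiable one_ne_zero t).hasDerivAt).inv (beta_ne_zero ht)

/-- Inversion maps the disc `|y - 1| < 1` to the half-plane `Re x > 1/2`. -/
lemma half_lt_re_invBeta {t : ℝ} (ht : t ∈ Ioo (0 : ℝ) 1) : 1 / 2 < (invBeta t).re := by
  have h1 : ‖1 - β t‖ < 1 := by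
    rw [norm_one_sub_beta]; nlinarith [ht.1, ht.2]
  have h2 : Complex.normSq (1 - β t) < 1 := by
    rw [Complex.normSq_eq_norm_sq]
    nlinarith [norm_nonneg (1 - β t)]
  have h3 := Complex.normSq_pos.2 (beta_ne_zero ht)
  rw [invBeta, Complex.inv_re, lt_div_iff₀ h3]
  simp only [Complex.normSq_apply, Complex.sub_re, Complex.sub_im, Complex.one_re,
    Complex.one_im] at h2 ⊢
  nlinarith

lemma im_invBeta {t : ℝ} (ht : t ∈ Ioo (0 : ℝ) 1) :
    ∃ r > 0, (invBeta t).im = r * Real.sin (betaAngle t) := by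
  have h3 := Complex.normSq_pos.2 (beta_ne_zero ht)
  refine ⟨(1 - t + t ^ 2) / Complex.normSq (β t), div_pos ?_ h3, ?_⟩
  · nlinarith [ht.1, ht.2]
  · rw [invBeta, Complex.inv_im, beta_im]; ring

theorem goodPath_invBeta {c : ℝ} (hc : c ≤ 1 / 2) : GoodPath c invBeta where
  differentiable t ht := (hasDerivAt_invBeta ht).differentiableAt
  deriv_cont := by
    refine ContinuousOn.congr (f := fun t => -deriv β t / β t ^ 2) ?_
      fun t ht => (hasDerivAt_invBeta ht).deriv
    refine ContinuousOn.div (contDiff_beta.continuous_deriv le_rfl).neg.continuousOn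
      (contDiff_beta.continuous.pow 2).continuousOn fun t ht => pow_ne_zero 2 (beta_ne_zero ht)
  lt_re t ht := hc.trans_lt (half_lt_re_invBeta ht)
  slit t ht h := by
    obtain ⟨r, hr, h1⟩ := im_invBeta ht
    rw [h1] at h
    have h2 := (mul_eq_zero.1 h).resolve_left hr.ne'
    have h3 := betaAngle_mem ht
    -- The only angle in `(0, 2π)` with vanishing sine is `π`; there `β > 1`, so `1/β` lies to the
    -- left of the slit.
    have h4 : Real.cos (betaAngle t) = -1 := by
      have h5 : Real.sin (betaAngle t - Real.pi) = 0 := by rw [Real.sin_sub_pi, h2, neg_zero]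
      have h6 := (Real.sin_eq_zero_iff_of_lt_of_lt (by linarith) (by linarith)).1 h5
      rw [sub_eq_zero.1 h6, Real.cos_pi]
    have h5 : (β t).im = 0 := by rw [beta_im, h2]; ring
    have h6 : 1 < (β t).re := by rw [beta_re, h4]; nlinarith [ht.1, ht.2]
    rw [invBeta, Complex.inv_re, Complex.normSq_apply, h5,
      div_lt_one (by nlinarith)]
    nlinarith
  far := by
    obtain ⟨M, hM, h⟩ := exists_norm_beta_le
    refine ⟨3 / 4 / M, by positivity, fun t ht => ?_⟩
    have h1 := norm_pos_iff.2 (beta_ne_zero ht)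
    have h2 : invBeta t - 1 = (1 - β t) / β t := by
      rw [invBeta, sub_div, div_self (beta_ne_zero ht), one_div]
    rw [h2, norm_div, norm_one_sub_beta, div_le_div_iff₀ hM h1]
    have h3 : ‖β t‖ ≤ M := (h t ht).trans (mul_le_of_le_one_right hM.le (by nlinarith [ht.1, ht.2]))
    have h4 : (3 / 4 : ℝ) ≤ 1 - t + t ^ 2 := by nlinarith [sq_nonneg (t - 1 / 2)]
    nlinarith
  lower := by
    obtain ⟨M, hM, h⟩ := exists_norm_beta_le
    refine ⟨1 / M, by positivity, fun t ht => ?_⟩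
    have h1 := norm_pos_iff.2 (beta_ne_zero ht)
    rw [invBeta, norm_inv, ← div_eq_mul_inv, div_le_div_iff₀ hM h1, one_mul, mul_comm]
    exact h t ht
  upper := by
    refine ⟨1, fun t ht => ?_⟩
    have h1 := norm_pos_iff.2 (beta_ne_zero ht)
    rw [invBeta, norm_inv, ← div_eq_mul_inv, div_le_one h1]
    exact le_norm_beta
  deriv_le := by
    obtain ⟨M, hM0, hM⟩ := exists_norm_deriv_beta_le
    refine ⟨M, fun t ht => ?_⟩
    have h1 := norm_pos_iff.2 (beta_ne_zero ht)
    rw [(hasDerivAt_invBeta ht).deriv, norm_div, norm_neg, norm_pow, mul_div_assoc',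
      div_le_iff₀ (by positivity), mul_comm M]
    exact mul_le_mul (pow_le_pow_left₀ (mul_one_sub_pos ht).le le_norm_beta 2)
      (hM t (Ioo_subset_Icc_self ht)) (norm_nonneg _) (by positivity)
  im_neg := by
    filter_upwards [Ioo_mem_nhdsLT (by norm_num : (1 / 2 : ℝ) < 1)] with t ht
    have ht' : t ∈ Ioo (0 : ℝ) 1 := ⟨by linarith [ht.1], ht.2⟩
    obtain ⟨r, hr, h1⟩ := im_invBeta ht'
    have h2 : 0 < betaAngle t - Real.pi := by
      rw [betaAngle_sub_pi]
      have := mul_one_sub_pos ht'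
      exact mul_pos Real.pi_pos (mul_pos (by linarith [ht.1]) (by linarith))
    rw [h1]
    refine mul_neg_of_pos_of_neg hr ?_
    have h3 := Real.sin_pos_of_pos_of_lt_pi h2 (by linarith [(betaAngle_mem ht').2])
    rw [Real.sin_sub_pi] at h3
    linarith
  im_pos := by
    filter_upwards [Ioo_mem_nhdsGT (by norm_num : (0 : ℝ) < 1 / 2)] with t ht
    have ht' : t ∈ Ioo (0 : ℝ) 1 := ⟨ht.1, by linarith [ht.2]⟩
    obtain ⟨r, hr, h1⟩ := im_invBeta ht'
    have h2 : betaAngle t - Real.pi < 0 := by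
      rw [betaAngle_sub_pi]
      have := mul_one_sub_pos ht'
      exact mul_neg_of_pos_of_neg Real.pi_pos (mul_neg_of_neg_of_pos (by linarith [ht.2])
        (by linarith))
    rw [h1]
    exact mul_pos hr (Real.sin_pos_of_pos_of_lt_pi (betaAngle_mem ht').1 (by linarith))

/-! ### The path `η_u` -/

lemma hasDerivAt_eta (u : ℂ) {t : ℝ} (ht : t ∈ Ioo (0 : ℝ) 1) :
    HasDerivAt (eta u) (-(Complex.I * (((t : ℂ) ^ 2)⁻¹ + ((1 - (t : ℂ)) ^ 2)⁻¹))) t := by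
  have h0 : (t : ℂ) ≠ 0 := Complex.ofReal_ne_zero.2 ht.1.ne'
  have h1 : (1 - (t : ℂ)) ≠ 0 := by
    rw [← Complex.ofReal_one, ← Complex.ofReal_sub]
    exact Complex.ofReal_ne_zero.2 (sub_pos.2 ht.2).ne'
  have d : HasDerivAt (fun t : ℝ => (t : ℂ)) 1 t := Complex.ofRealCLM.hasDerivAt
  refine (((d.inv h0).sub ((d.const_sub 1).inv h1)).const_mul Complex.I |>.const_add
    (u / 2)).congr_deriv ?_
  field_simp
  ring

lemma mul_eta (u : ℂ) {t : ℝ} (ht : t ∈ Ioo (0 : ℝ) 1) :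
    ((t * (1 - t) : ℝ) : ℂ) * eta u t =
      ((t * (1 - t) : ℝ) : ℂ) * (u / 2) + Complex.I * ((1 - 2 * t : ℝ) : ℂ) := by
  have h0 : (t : ℂ) ≠ 0 := Complex.ofReal_ne_zero.2 ht.1.ne'
  have h1 : (1 - (t : ℂ)) ≠ 0 := by
    rw [← Complex.ofReal_one, ← Complex.ofReal_sub]
    exact Complex.ofReal_ne_zero.2 (sub_pos.2 ht.2).ne'
  rw [eta]
  push_cast
  field_simp
  ring

lemma eta_re (u : ℂ) (t : ℝ) : (eta u t).re = u.re / 2 := by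
  have h : eta u t = u / 2 + Complex.I * ((t⁻¹ - (1 - t)⁻¹ : ℝ) : ℂ) := by
    rw [eta]; push_cast; rfl
  rw [h]; simp

lemma mul_eta_im (u : ℂ) {t : ℝ} (ht : t ∈ Ioo (0 : ℝ) 1) :
    t * (1 - t) * (eta u t).im = t * (1 - t) * (u.im / 2) + (1 - 2 * t) := by
  have h := congrArg Complex.im (mul_eta u ht)
  rw [Complex.im_ofReal_mul, Complex.add_im, Complex.im_ofReal_mul] at h
  simpa using h

theorem goodPath_eta {c : ℝ} {u : ℂ} (hc0 : 0 < c) (hc : c < u.re / 2) (hu : u.re / 2 < 1) :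
    GoodPath c (eta u) where
  differentiable t ht := (hasDerivAt_eta u ht).differentiableAt
  deriv_cont := by
    refine ContinuousOn.congr (f := fun t : ℝ =>
      -(Complex.I * (((t : ℂ) ^ 2)⁻¹ + ((1 - (t : ℂ)) ^ 2)⁻¹))) ?_
      fun t ht => (hasDerivAt_eta u ht).deriv
    intro t ht
    have h0 : (t : ℂ) ≠ 0 := Complex.ofReal_ne_zero.2 ht.1.ne'
    have h1 : (1 - (t : ℂ)) ≠ 0 := by
      rw [← Complex.ofReal_one, ← Complex.ofReal_sub]
      exact Complex.ofReal_ne_zero.2 (sub_pos.2 ht.2).ne'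
    refine ContinuousAt.continuousWithinAt ?_
    have h2 := pow_ne_zero 2 h0
    have h3 := pow_ne_zero 2 h1
    fun_prop (disch := assumption)
  lt_re t _ := by rw [eta_re]; exact hc
  slit t _ _ := by rw [eta_re]; exact hu
  far := by
    refine ⟨1 - u.re / 2, sub_pos.2 hu, fun t _ => ?_⟩
    rw [norm_sub_rev]
    refine le_trans ?_ (Complex.re_le_norm _)
    rw [Complex.sub_re, eta_re, Complex.one_re]
  lower := by
    -- `t (1 - t) η_u(t)` extends continuously to `[0, 1]` without zeros, so compactness gives the
    -- lower bound.
    set g : ℝ → ℂ := fun t => ((t * (1 - t) : ℝ) : ℂ) * (u / 2) +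
      Complex.I * ((1 - 2 * t : ℝ) : ℂ) with hg
    have hgc : ContinuousOn (fun t => ‖g t‖) (Icc 0 1) := by
      have : Continuous g := by fun_prop
      exact this.norm.continuousOn
    obtain ⟨t₀, ht₀, hmin⟩ := isCompact_Icc.exists_isMinOn (nonempty_Icc.2 zero_le_one) hgc
    refine ⟨‖g t₀‖, norm_pos_iff.2 fun h0 => ?_, fun t ht => ?_⟩
    · have hre := congrArg Complex.re h0
      have him := congrArg Complex.im h0
      simp only [hg, Complex.add_re, Complex.add_im, Complex.re_ofReal_mul, Complex.im_ofReal_mul,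
        Complex.zero_re, Complex.zero_im] at hre him
      have e1 : (u / 2).re = u.re / 2 := by simp
      have e2 : (Complex.I * ((1 - 2 * t₀ : ℝ) : ℂ)).re = 0 := by simp
      have e3 : (Complex.I * ((1 - 2 * t₀ : ℝ) : ℂ)).im = 1 - 2 * t₀ := by simp
      rw [e1, e2, add_zero] at hre
      have h1 : t₀ * (1 - t₀) = 0 := (mul_eq_zero.1 hre).resolve_right (by linarith)
      rw [e3, h1, zero_mul, zero_add] at him
      nlinarith
    · have h1 := hmin (Ioo_subset_Icc_self ht)
      refine le_trans h1 (le_of_eq ?_)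
      simp only [hg]
      rw [← mul_eta u ht, norm_mul, Complex.norm_real, Real.norm_of_nonneg (mul_one_sub_pos ht).le]
  upper := by
    refine ⟨‖u / 2‖ + 1, fun t ht => ?_⟩
    have h1 := congrArg norm (mul_eta u ht)
    rw [norm_mul, Complex.norm_real, Real.norm_of_nonneg (mul_one_sub_pos ht).le] at h1
    rw [h1]
    refine (norm_add_le _ _).trans (add_le_add ?_ ?_)
    · rw [norm_mul, Complex.norm_real, Real.norm_of_nonneg (mul_one_sub_pos ht).le]
      exact mul_le_of_le_one_left (norm_nonneg _) (by nlinarith [ht.1, ht.2])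
    · rw [norm_mul, Complex.norm_I, one_mul, Complex.norm_real, Real.norm_eq_abs, abs_le]
      constructor <;> linarith [ht.1, ht.2]
  deriv_le := by
    refine ⟨1, fun t ht => ?_⟩
    have h0 : (t : ℝ) ≠ 0 := ht.1.ne'
    have h1 : (1 - t) ≠ 0 := (sub_pos.2 ht.2).ne'
    have e : (((t : ℂ) ^ 2)⁻¹ + ((1 - (t : ℂ)) ^ 2)⁻¹) = (((t ^ 2)⁻¹ + ((1 - t) ^ 2)⁻¹ : ℝ) : ℂ) := by
      push_cast; rfl
    rw [(hasDerivAt_eta u ht).deriv, e, norm_neg, norm_mul, Complex.norm_I, one_mul,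
      Complex.norm_real, Real.norm_of_nonneg (by positivity)]
    have e2 : (t * (1 - t)) ^ 2 * ((t ^ 2)⁻¹ + ((1 - t) ^ 2)⁻¹) = (1 - t) ^ 2 + t ^ 2 := by
      field_simp
    rw [e2]
    nlinarith [ht.1, ht.2]
  im_neg := by
    have h1 : Tendsto (fun t : ℝ => t * (1 - t) * (u.im / 2) + (1 - 2 * t)) (𝓝[<] 1)
        (𝓝 (1 * (1 - 1) * (u.im / 2) + (1 - 2 * 1))) := by
      refine (Continuous.tendsto ?_ 1).mono_left nhdsWithin_le_nhds
      fun_prop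
    filter_upwards [Ioo_mem_nhdsLT one_pos, h1.eventually (gt_mem_nhds (by norm_num :
      (1 * (1 - 1) * (u.im / 2) + (1 - 2 * 1) : ℝ) < 0))] with t ht h2
    rw [← mul_eta_im u ht] at h2
    by_contra! h3
    have := mul_nonneg (mul_one_sub_pos ht).le h3
    linarith
  im_pos := by
    have h1 : Tendsto (fun t : ℝ => t * (1 - t) * (u.im / 2) + (1 - 2 * t)) (𝓝[>] 0)
        (𝓝 (0 * (1 - 0) * (u.im / 2) + (1 - 2 * 0))) := by
      refine (Continuous.tendsto ?_ 0).mono_left nhdsWithin_le_nhds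
      fun_prop
    filter_upwards [Ioo_mem_nhdsGT one_pos, h1.eventually (lt_mem_nhds (by norm_num :
      (0 : ℝ) < (0 * (1 - 0) * (u.im / 2) + (1 - 2 * 0) : ℝ)))] with t ht h2
    rw [← mul_eta_im u ht] at h2
    exact pos_of_mul_pos_right h2 (mul_one_sub_pos ht).le

/-! ### Integrands that are only specified on `(0,1)` -/

lemma letter_mem_congr {φ ψ : ℝ → ℂ} (h : ∀ t ∈ Ioo (0 : ℝ) 1, φ t = ψ t) (hψ : ψ ∈ Letter) :
    φ ∈ Letter := by
  obtain ⟨h1, C, hC⟩ := hψ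
  exact ⟨h1.congr h, C, fun t ht => by rw [h t ht]; exact hC t ht⟩

lemma IsBdd.congr {φ ψ : ℝ → ℂ} (hψ : IsBdd ψ) (h : ∀ t ∈ Ioo (0 : ℝ) 1, φ t = ψ t) :
    IsBdd φ := by
  obtain ⟨h1, C, hC⟩ := hψ
  exact ⟨h1.congr h, C, fun t ht => by rw [h t ht]; exact hC t ht⟩

lemma IsHead.congr {φ ψ : ℝ → ℂ} (hψ : IsHead ψ) (h : ∀ t ∈ Ioo (0 : ℝ) 1, φ t = ψ t) :
    IsHead φ := by
  obtain ⟨h1, C, J, hC⟩ := hψ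
  exact ⟨h1.congr h, C, J, fun t ht => by rw [h t ht]; exact hC t ht⟩

lemma op_toLetter_congr {φ ψ : ℝ → ℂ} (h : ∀ t ∈ Ioo (0 : ℝ) 1, φ t = ψ t) (hψ : ψ ∈ Letter) :
    op (toLetter φ) = op (toLetter ψ) :=
  op_congr fun s hs => by
    rw [toLetter_val hψ, toLetter_val (letter_mem_congr h hψ), h s hs]

lemma tail_toTail_congr {f g : ℝ → ℂ} (h : ∀ t ∈ Ioo (0 : ℝ) 1, f t = g t) (hf : IsTail f)
    (hg : IsTail g) : tail (toTail f) = tail (toTail g) :=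
  tail_congr fun s hs => by rw [toTail_val hf, toTail_val hg, h s hs]

lemma isRegValue_iterInt_list {φ : ℝ → ℂ} (hφ : IsBdd φ) (q : List (ℝ → ℂ))
    (hq : ∀ ψ ∈ q, ψ ∈ Letter) {f : ℝ → ℂ} (hf : IsTail f) :
    IsRegValue (fun z => iterInt (φ :: (q ++ [f])) z (1 - z))
      (total φ hφ ((q.map fun ψ => op (toLetter ψ)).prod (tail (toTail f)))) := by
  have h := isRegValue_iterInt hφ (q.map toLetter) (toTail f)
  rw [toTail_val hf, List.map_map, List.map_map] at h
  have h1 : q.map ((fun φ : Letter => φ.1) ∘ toLetter) = q := by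
    conv_rhs => rw [← List.map_id q]
    exact List.map_congr_left fun ψ hψ => toLetter_val (hq ψ hψ)
  rw [h1] at h
  exact h

/-! ### Words ending in powers of `e_0` -/

/-- The coefficients may depend on the upper limit `b` but not on `s`, so they pass through the
integrations of the prefix `q`. -/
lemma iterInt_append_eq_sum {ι : Type*} (S : Finset ι) (c : ι → ℂ) {w : List (ℝ → ℂ)}
    {w' : ι → List (ℝ → ℂ)} {b : ℝ} (hb : b ∈ Ioo (0 : ℝ) 1)
    (hw' : ∀ j ∈ S, ∀ φ ∈ w' j, ContinuousOn φ (Ioo 0 1))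
    (h : ∀ s ∈ Ioo (0 : ℝ) 1, iterInt w s b = ∑ j ∈ S, c j * iterInt (w' j) s b)
    {q : List (ℝ → ℂ)} (hq : ∀ φ ∈ q, ContinuousOn φ (Ioo 0 1)) :
    ∀ s ∈ Ioo (0 : ℝ) 1, iterInt (q ++ w) s b = ∑ j ∈ S, c j * iterInt (q ++ w' j) s b := by
  induction q with
  | nil => simpa using h
  | cons φ q ih =>
    have ih' := ih fun ψ hψ => hq ψ (List.mem_cons_of_mem _ hψ)
    intro s hs
    have hsub : uIcc s b ⊆ Ioo 0 1 := fun t ht =>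
      ⟨(lt_min hs.1 hb.1).trans_le ht.1, ht.2.trans_lt (max_lt hs.2 hb.2)⟩
    simp only [List.cons_append, iterInt]
    rw [integral_congr (g := fun t => ∑ j ∈ S, c j * (φ t * iterInt (q ++ w' j) t b))
      fun t ht => by
        simp only [ih' t (hsub ht), Finset.mul_sum]
        exact Finset.sum_congr rfl fun j _ => by ring]
    rw [intervalIntegral.integral_finsetSum]
    · simp only [intervalIntegral.integral_const_mul]
    · intro j hj
      refine ContinuousOn.intervalIntegrable (continuousOn_const.mul (ContinuousOn.mono ?_ hsub))
      refine (hq φ List.mem_cons_self).mul (continuousOn_iterInt (fun ψ hψ => ?_) hb)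
      rcases List.mem_append.1 hψ with h1 | h1
      · exact hq ψ (List.mem_cons_of_mem _ h1)
      · exact hw' j hj ψ h1

lemma add_pow_div_factorial (x y : ℂ) (n : ℕ) :
    (x + y) ^ n / n.factorial =
      ∑ j ∈ Finset.range (n + 1), y ^ (n - j) / (n - j).factorial * (x ^ j / j.factorial) := by
  rw [add_pow, Finset.sum_div]
  refine Finset.sum_congr rfl fun j hj => ?_
  have hj' : j ≤ n := Nat.lt_succ_iff.1 (Finset.mem_range.1 hj)
  rw [Nat.cast_choose ℂ hj']
  have h1 : (n.factorial : ℂ) ≠ 0 := by exact_mod_cast n.factorial_ne_zero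
  have h2 : (j.factorial : ℂ) ≠ 0 := by exact_mod_cast j.factorial_ne_zero
  have h3 : ((n - j).factorial : ℂ) ≠ 0 := by exact_mod_cast (n - j).factorial_ne_zero
  field_simp

lemma iterInt_replicate {ℓ e : ℝ → ℂ} (he : ContinuousOn e (Ioo 0 1))
    (hℓ : ∀ t ∈ Ioo (0 : ℝ) 1, HasDerivAt ℓ (-e t) t) {b : ℝ} (hb : b ∈ Ioo (0 : ℝ) 1) (n : ℕ) :
    ∀ s ∈ Ioo (0 : ℝ) 1, iterInt (List.replicate n e) s b = (ℓ s - ℓ b) ^ n / n.factorial := by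
  induction n with
  | zero => intro s _; simp [iterInt]
  | succ n ih =>
    intro s hs
    have hsub : uIcc s b ⊆ Ioo 0 1 := fun t ht =>
      ⟨(lt_min hs.1 hb.1).trans_le ht.1, ht.2.trans_lt (max_lt hs.2 hb.2)⟩
    have hℓc : ContinuousOn ℓ (Ioo 0 1) := fun t ht =>
      (hℓ t ht).continuousAt.continuousWithinAt
    rw [List.replicate_succ, iterInt, integral_congr
      (g := fun t => e t * ((ℓ t - ℓ b) ^ n / n.factorial)) fun t ht => by
        simp only [ih t (hsub ht)]]
    have hd : ∀ t ∈ uIcc s b, HasDerivAt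
        (fun t => -((ℓ t - ℓ b) ^ (n + 1) / (n + 1).factorial))
        (e t * ((ℓ t - ℓ b) ^ n / n.factorial)) t := fun t ht => by
      refine (((((hℓ t (hsub ht)).sub_const (ℓ b)).pow (n + 1)).div_const _).neg).congr_deriv ?_
      have h1 : (n.factorial : ℂ) ≠ 0 := by exact_mod_cast n.factorial_ne_zero
      have h2 : ((n : ℂ) + 1) ≠ 0 := by exact_mod_cast n.succ_ne_zero
      rw [Nat.factorial_succ]
      push_cast
      field_simp
    rw [integral_eq_sub_of_hasDerivAt hd]
    · simp
    · refine ContinuousOn.intervalIntegrable (ContinuousOn.mono ?_ hsub)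
      exact he.mul (((hℓc.sub continuousOn_const).pow n).div_const _)

/-- The trailing `e^n` contributes `(ℓ t - ℓ (1 - z))^n / n!`. In its binomial expansion each
positive power of `-ℓ (1 - z)` has regularized value `0`, and regularization is multiplicative, so
only the term with `ℓ t ^ n` survives. -/
lemma isRegValue_append_replicate {ℓ e φ : ℝ → ℂ} (he : ContinuousOn e (Ioo 0 1))
    (hℓ : ∀ t ∈ Ioo (0 : ℝ) 1, HasDerivAt ℓ (-e t) t) (hφ : ContinuousOn φ (Ioo 0 1))
    (hend : IsRegValue (fun z => -ℓ (1 - z)) 0) {q : List (ℝ → ℂ)}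
    (hq : ∀ φ ∈ q, ContinuousOn φ (Ioo 0 1)) {V : ℕ → ℂ}
    (hV : ∀ n, IsRegValue
      (fun z => iterInt (q ++ [fun t => φ t * (ℓ t ^ n / n.factorial)]) z (1 - z)) (V n)) (n : ℕ) :
    IsRegValue (fun z => iterInt (q ++ φ :: List.replicate n e) z (1 - z)) (V n) := by
  have hℓc : ContinuousOn ℓ (Ioo 0 1) := fun t ht => (hℓ t ht).continuousAt.continuousWithinAt
  have h1 : IsRegValue (fun z => ∑ j ∈ Finset.range (n + 1),
      (((n - j).factorial : ℂ)⁻¹ * (-ℓ (1 - z)) ^ (n - j)) *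
        iterInt (q ++ [fun t => φ t * (ℓ t ^ j / j.factorial)]) z (1 - z))
      (∑ j ∈ Finset.range (n + 1), (((n - j).factorial : ℂ)⁻¹ * 0 ^ (n - j)) * V j) :=
    IsRegValue.sum _ fun j _ => ((hend.pow (n - j)).const_mul _).mul (hV j)
  have h2 : ∑ j ∈ Finset.range (n + 1), (((n - j).factorial : ℂ)⁻¹ * 0 ^ (n - j)) * V j = V n := by
    rw [Finset.sum_eq_single n]
    · simp
    · intro j hj hjn
      have : n - j ≠ 0 := by have := Finset.mem_range.1 hj; omega
      rw [zero_pow this, mul_zero, zero_mul]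
    · intro h; exact absurd (Finset.mem_range.2 n.lt_succ_self) h
  rw [h2] at h1
  refine h1.congr ?_
  filter_upwards [eventually_nhdsGT_zero_lt_half] with z hz
  have hz1 : z ∈ Ioo (0 : ℝ) 1 := ⟨hz.1, by linarith [hz.2]⟩
  have hb1 : 1 - z ∈ Ioo (0 : ℝ) 1 := ⟨by linarith [hz.2], by linarith [hz.1]⟩
  refine (iterInt_append_eq_sum (Finset.range (n + 1))
    (fun j => ((n - j).factorial : ℂ)⁻¹ * (-ℓ (1 - z)) ^ (n - j))
    (w' := fun j => [fun t => φ t * (ℓ t ^ j / j.factorial)]) hb1 ?_ ?_ hq z hz1).symm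
  · intro j _ ψ hψ
    rw [List.mem_singleton] at hψ
    rw [hψ]
    exact hφ.mul ((hℓc.pow j).div_const _)
  · intro s hs
    have hsub : uIcc s (1 - z) ⊆ Ioo 0 1 := fun t ht =>
      ⟨(lt_min hs.1 hb1.1).trans_le ht.1, ht.2.trans_lt (max_lt hs.2 hb1.2)⟩
    simp only [iterInt, mul_one]
    rw [integral_congr (g := fun t => ∑ j ∈ Finset.range (n + 1),
      (((n - j).factorial : ℂ)⁻¹ * (-ℓ (1 - z)) ^ (n - j)) * (φ t * (ℓ t ^ j / j.factorial)))
      fun t ht => by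
        beta_reduce
        rw [iterInt_replicate he hℓ hb1 n t (hsub ht), sub_eq_add_neg (ℓ t),
          add_pow_div_factorial, Finset.mul_sum]
        exact Finset.sum_congr rfl fun j _ => by ring]
    rw [intervalIntegral.integral_finsetSum]
    · simp only [intervalIntegral.integral_const_mul]
    · intro j _
      refine ContinuousOn.intervalIntegrable (continuousOn_const.mul (ContinuousOn.mono ?_ hsub))
      exact hφ.mul ((hℓc.pow j).div_const _)

/-! ### Forms along `β` -/

lemma deriv_invBeta {t : ℝ} (ht : t ∈ Ioo (0 : ℝ) 1) :
    deriv invBeta t = -deriv β t / β t ^ 2 := (hasDerivAt_invBeta ht).deriv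

lemma eForm_beta_zero {t : ℝ} (ht : t ∈ Ioo (0 : ℝ) 1) :
    eForm β 0 t = -eForm invBeta 0 t := by
  have h := beta_ne_zero ht
  rw [eForm, eForm, deriv_invBeta ht, invBeta]
  field_simp
  simp

/-- Under `y = 1/x` the pole `u/z` moves to `z/u`, and the pole at infinity moves to `0`. For `z =
0` both sides vanish, in accordance with `e_∞ = 0`. -/
lemma eQuot_beta {c : ℝ} (hc : c ≤ 1 / 2) {u z : ℂ} (hu : u ≠ 0) (hz : IsPole c (z / u)) {t : ℝ}
    (ht : t ∈ Ioo (0 : ℝ) 1) :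
    eQuot β u z t = (eForm invBeta (z / u) - eForm invBeta 0) t := by
  have h := beta_ne_zero ht
  by_cases hz0 : z = 0
  · rw [hz0, zero_div, sub_self, eQuot, if_pos rfl]
  · have h1 := (goodPath_invBeta hc).sub_ne_zero hz ht
    rw [Pi.sub_apply, eQuot, if_neg hz0, eForm, eForm, eForm, deriv_invBeta ht, sub_zero]
    simp only [invBeta] at h1 ⊢
    have h2 : β t - u / z ≠ 0 := by
      intro h3
      apply h1
      rw [sub_eq_zero.1 h3, inv_div, sub_self]
    have h3 : (β t)⁻¹ - z / u = -((β t - u / z) * z / (β t * u)) := by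
      field_simp
      ring
    rw [h3]
    have h4 : z * β t - u ≠ 0 := by
      intro h5
      apply h2
      field_simp
      linear_combination h5
    field_simp
    have h5 : β t * z - u ≠ 0 := by rwa [mul_comm]
    field_simp
    ring

/-- The logarithm of `1 / β`. -/
def logInvBeta (t : ℝ) : ℂ := Complex.log (invBeta t)

lemma hasDerivAt_logInvBeta {t : ℝ} (ht : t ∈ Ioo (0 : ℝ) 1) :
    HasDerivAt logInvBeta (-eForm β 0 t) t := by
  have h1 := (hasDerivAt_invBeta ht).clog_real
    (Or.inl (lt_trans (by norm_num) (half_lt_re_invBeta ht)))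
  refine h1.congr_deriv ?_
  rw [eForm_beta_zero ht, neg_neg, eForm, sub_zero, deriv_invBeta ht]

/-- First-order expansion at the end point, expressing `β(1) = 0` and `β'(1) = -1`: the angle
differs from `2π` only by `O(z²)`. -/
lemma norm_beta_one_sub_sub_le {z : ℝ} (hz : z ∈ Ioo (0 : ℝ) 1) :
    ‖β (1 - z) - z‖ ≤ (6 * Real.pi + 1) * z ^ 2 := by
  set x : ℝ := 2 * Real.pi * (-3 * z ^ 2 + 2 * z ^ 3) with hx
  have hE : β (1 - z) = 1 - (1 - z + z ^ 2 : ℝ) * Complex.exp (Complex.I * x) := by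
    rw [beta_eq, show betaAngle (1 - z) = 2 * Real.pi + x by rw [betaAngle, hx]; ring,
      show (1 - (1 - z) + (1 - z) ^ 2 : ℝ) = 1 - z + z ^ 2 by ring]
    have h0 : ((2 * Real.pi + x : ℝ) : ℂ) * Complex.I =
        Complex.I * x + 2 * Real.pi * Complex.I := by
      push_cast; ring
    rw [h0, Complex.exp_add, Complex.exp_two_pi_mul_I, mul_one]
  have h1 : β (1 - z) - z = (1 - z : ℝ) * -(Complex.exp (Complex.I * x) - 1) -
      (z ^ 2 : ℝ) * Complex.exp (Complex.I * x) := by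
    rw [hE]; push_cast; ring
  have h2 : ‖Complex.exp (Complex.I * x) - 1‖ ≤ 6 * Real.pi * z ^ 2 := by
    refine (Real.norm_exp_I_mul_ofReal_sub_one_le).trans ?_
    rw [Real.norm_eq_abs, hx, abs_le]
    have hpi := Real.pi_pos
    have h0 : 0 < z ^ 2 := by have := hz.1; positivity
    have h3 : 0 ≤ z ^ 3 := by have := hz.1; positivity
    have h4 : z ^ 3 ≤ z ^ 2 := by nlinarith [hz.1, hz.2]
    constructor <;> nlinarith
  have h3 : ‖Complex.exp (Complex.I * x)‖ = 1 := by
    rw [mul_comm]; exact Complex.norm_exp_ofReal_mul_I x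
  rw [h1]
  refine (norm_sub_le _ _).trans ?_
  rw [norm_mul, norm_mul, norm_neg, h3, mul_one, Complex.norm_real, Complex.norm_real,
    Real.norm_of_nonneg (by linarith [hz.2]), Real.norm_of_nonneg (by positivity), add_mul, one_mul]
  refine add_le_add (le_trans ?_ h2) le_rfl
  exact mul_le_of_le_one_left (norm_nonneg _) (by linarith [hz.1])

/-- The function is `log β(1 - z) = log z + O(z)`, so the polynomial is `X`, with constant term `0`.
A different tangent length would leave a constant here. -/
lemma isRegValue_logInvBeta : IsRegValue (fun z => -logInvBeta (1 - z)) 0 := by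
  refine ⟨Polynomial.X, 0, ?_, by simp⟩
  simp only [pow_zero, mul_one, Polynomial.eval_X]
  have h1 : (fun z : ℝ => β (1 - z) / z - 1) =O[𝓝[>] (0 : ℝ)] fun z : ℝ => z := by
    refine IsBigO.of_bound (6 * Real.pi + 1) ?_
    filter_upwards [Ioo_mem_nhdsGT one_pos] with z hz
    have hz0 : (z : ℂ) ≠ 0 := Complex.ofReal_ne_zero.2 hz.1.ne'
    have h2 : β (1 - z) / z - 1 = (β (1 - z) - z) / z := by rw [sub_div, div_self hz0]
    rw [h2, norm_div, Complex.norm_real, div_le_iff₀ (norm_pos_iff.2 hz.1.ne')]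
    refine (norm_beta_one_sub_sub_le hz).trans (le_of_eq ?_)
    rw [Real.norm_of_nonneg hz.1.le]; ring
  have h2 : Tendsto (fun z : ℝ => β (1 - z) / z) (𝓝[>] (0 : ℝ)) (𝓝 1) := by
    have h3 := h1.trans_tendsto (tendsto_id'.2 nhdsWithin_le_nhds)
    have h4 := h3.add_const 1
    simpa using h4
  have h3 : (fun w : ℂ => Complex.log w - Complex.log 1) =O[𝓝 1] fun w => w - 1 :=
    ((Complex.hasDerivAt_log (by simp)).hasFDerivAt).isBigO_sub
  have h4 := (h3.comp_tendsto h2).trans h1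
  refine h4.congr' ?_ EventuallyEq.rfl
  filter_upwards [Ioo_mem_nhdsGT one_pos] with z hz
  have ht : 1 - z ∈ Ioo (0 : ℝ) 1 := ⟨by linarith [hz.2], by linarith [hz.1]⟩
  have hre := half_lt_re_invBeta ht
  have hβ := beta_ne_zero ht
  simp only [Function.comp, Complex.log_one, sub_zero, logInvBeta]
  have h5 : β (1 - z) / z = (z⁻¹ : ℝ) * β (1 - z) := by push_cast; ring
  have h6 : Complex.log (invBeta (1 - z)) = -Complex.log (β (1 - z)) := by
    rw [invBeta, Complex.log_inv]
    have h7 : invBeta (1 - z) ∈ Complex.slitPlane := Or.inl (by linarith)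
    have h8 : β (1 - z) ∈ Complex.slitPlane := by
      refine Or.inl ?_
      have h9 : β (1 - z) = (invBeta (1 - z))⁻¹ := by rw [invBeta, inv_inv]
      rw [h9, Complex.inv_re]
      refine div_pos (by linarith) (Complex.normSq_pos.2 ?_)
      exact inv_ne_zero hβ
    exact (Complex.mem_slitPlane_iff_arg.1 h8).1
  rw [h5, Complex.log_ofReal_mul (inv_pos.2 hz.1) hβ, h6, Real.log_inv]
  push_cast
  ring

/-! ### Regularized integrals along `β` -/

/-- The quotient `z/u` is `1` for `z = u`, and otherwise lies strictly left of `Re u / 2`. As `Q` is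
finite, some `c` just below `Re u / 2` separates all of them. Taking `v = 1` in the last condition
gives `Re u ≤ 1`, hence `c ≤ 1/2`, so that `1/β` also stays to the right. -/
lemma IsAdmissible.exists_isPole {Q : Finset ℂ} (hQ : IsAdmissible Q) {u : ℂ} (hu : u ∈ Q)
    (hu0 : u ≠ 0) : ∃ c : ℝ, 0 < c ∧ c < u.re / 2 ∧ c ≤ 1 / 2 ∧ u.re / 2 < 1 ∧
      ∀ z ∈ Q, IsPole c (z / u) := by
  have hu1 : u.re ≤ 1 := by
    by_cases h : u = 1
    · simp [h]
    · have := hQ.re_div_lt u hu 1 hQ.one_mem one_ne_zero h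
      rw [div_one, Complex.one_re] at this
      have := hQ.re_pos u hu hu0
      linarith
  have hpos := hQ.re_pos u hu hu0
  have h1 : ∀ᶠ c in 𝓝[<] (u.re / 2), ∀ z ∈ Q, IsPole c (z / u) := by
    rw [Filter.eventually_all_finset]
    intro z hz
    by_cases h : z = u
    · exact Eventually.of_forall fun c => Or.inr (by rw [h, div_self hu0])
    · have h2 := hQ.re_div_lt z hz u hu hu0 h
      filter_upwards [Ioo_mem_nhdsLT (show (z / u).re < u.re / 2 by linarith)] with c hc
      exact Or.inl hc.1
  obtain ⟨c, hc, hc2⟩ := (h1.and (Ioo_mem_nhdsLT (show 0 < u.re / 2 by linarith))).exists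
  exact ⟨c, hc2.1, hc2.2, by linarith [hc2.2], by linarith, hc⟩

/-- Integration against the form `e_a` along `γ`. -/
def pathOp (γ : ℝ → ℂ) (a : ℂ) : Module.End ℂ Decay := op (toLetter (eForm γ a))

lemma toLetter_add {φ ψ : ℝ → ℂ} (hφ : φ ∈ Letter) (hψ : ψ ∈ Letter) :
    toLetter (φ + ψ) = toLetter φ + toLetter ψ := by
  apply Subtype.ext
  rw [toLetter_val (Letter.add_mem hφ hψ), Submodule.coe_add, toLetter_val hφ, toLetter_val hψ]

lemma toLetter_neg {φ : ℝ → ℂ} (hφ : φ ∈ Letter) : toLetter (-φ) = -toLetter φ := by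
  apply Subtype.ext
  rw [toLetter_val (Letter.neg_mem hφ), Submodule.coe_neg, toLetter_val hφ]

section Loop

variable {c : ℝ} {u : ℂ}

lemma eForm_beta_zero_mem (hc0 : 0 < c) (hc : c ≤ 1 / 2) : eForm β 0 ∈ Letter :=
  letter_mem_congr (ψ := -eForm invBeta 0) (fun _ ht => eForm_beta_zero ht)
    (Letter.neg_mem ((goodPath_invBeta hc).eForm_mem (isPole_zero hc0)))

lemma isBdd_eQuot_beta (hc0 : 0 < c) (hc : c ≤ 1 / 2) (hu : u ≠ 0) {z : ℂ}
    (hz : IsPole c (z / u)) : IsBdd (eQuot β u z) :=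
  ((goodPath_invBeta hc).isBdd_eForm_sub hc0 hz).congr fun _ ht => eQuot_beta hc hu hz ht

lemma eQuot_beta_mem (hc0 : 0 < c) (hc : c ≤ 1 / 2) (hu : u ≠ 0) {z : ℂ}
    (hz : IsPole c (z / u)) : eQuot β u z ∈ Letter :=
  letter_mem_congr (fun _ ht => eQuot_beta hc hu hz ht)
    (Letter.sub_mem ((goodPath_invBeta hc).eForm_mem hz)
      ((goodPath_invBeta hc).eForm_mem (isPole_zero hc0)))

lemma op_eForm_beta_zero (hc0 : 0 < c) (hc : c ≤ 1 / 2) :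
    op (toLetter (eForm β 0)) = -pathOp invBeta 0 := by
  have h0 := (goodPath_invBeta hc).eForm_mem (isPole_zero hc0)
  rw [op_toLetter_congr (ψ := -eForm invBeta 0) (fun _ ht => eForm_beta_zero ht)
    (Letter.neg_mem h0), toLetter_neg h0, map_neg, pathOp]

lemma op_eQuot_beta (hc0 : 0 < c) (hc : c ≤ 1 / 2) (hu : u ≠ 0) {z : ℂ}
    (hz : IsPole c (z / u)) :
    op (toLetter (eQuot β u z)) = pathOp invBeta (z / u) - pathOp invBeta 0 := by
  have h0 := (goodPath_invBeta hc).eForm_mem (isPole_zero hc0)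
  have h1 := (goodPath_invBeta hc).eForm_mem hz
  rw [op_toLetter_congr (fun _ ht => eQuot_beta hc hu hz ht) (Letter.sub_mem h1 h0),
    sub_eq_add_neg, toLetter_add h1 (Letter.neg_mem h0), toLetter_neg h0, map_add, map_neg,
    ← sub_eq_add_neg, pathOp, pathOp]

lemma eForm_beta_mul_log (hc : c ≤ 1 / 2) (hu : u ≠ 0) (h1 : IsPole c (1 / u)) (n : ℕ) {t : ℝ}
    (ht : t ∈ Ioo (0 : ℝ) 1) :
    eForm β u t * (logInvBeta t ^ n / n.factorial) = pathLast invBeta (1 / u) n t := by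
  have h2 := eQuot_beta hc hu h1 ht
  rw [eQuot, if_neg one_ne_zero, div_one] at h2
  rw [h2, pathLast, Pi.sub_apply, logInvBeta]

/-- The product of operators that belongs to `e_0^{k_1-1} e_{z_2} e_0^{k_2-1} ⋯`, where `f` and `g z`
are the operators that belong to `e_0` and `e_z`. -/
def columnProd {R : Type*} [Ring R] (f : R) (g : ℂ → R) : List (ℂ × ℕ) → R
  -- A junk value: the first letter is handled by `total`, so only nonempty arrays matter.
  | [] => 0
  | p :: v => f ^ (p.2 - 1) * (v.map fun q => g q.1 * f ^ (q.2 - 1)).prod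

lemma prod_map_flatMap {R : Type*} [Ring R] {α : Type*} (F : (ℝ → ℂ) → R) (a : α → (ℝ → ℂ))
    (e : ℝ → ℂ) (k : α → ℕ) (v : List α) :
    ((v.flatMap fun p => a p :: List.replicate (k p) e).map F).prod =
      (v.map fun p => F (a p) * F e ^ k p).prod := by
  induction v with
  | nil => simp
  | cons p v ih =>
    rw [List.flatMap_cons, List.map_append, List.prod_append, ih, List.map_cons, List.prod_cons,
      List.map_cons, List.prod_cons, List.map_replicate, List.prod_replicate]

/-- The first letter goes into the functional `total`, the last letters are collected into a power
of `log x`, and everything in between becomes a product of operators along `1/β`. -/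
lemma isRegValue_rsWord (hc0 : 0 < c) (hc : c ≤ 1 / 2) (hu : u ≠ 0) (h1 : IsPole c (1 / u))
    {p : ℂ × ℕ} {v : List (ℂ × ℕ)} (hp : IsPole c (p.1 / u))
    (hv : ∀ q ∈ v, IsPole c (q.1 / u)) (n : ℕ) :
    IsRegValue (fun z => iterInt (rsWord u (p :: v) n) z (1 - z))
      (total (eForm invBeta (p.1 / u) - eForm invBeta 0)
        ((goodPath_invBeta hc).isBdd_eForm_sub hc0 hp)
        (columnProd (-pathOp invBeta 0) (fun z => pathOp invBeta (z / u) - pathOp invBeta 0)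
          (p :: v) (pathTail invBeta [] (1 / u) n))) := by
  set q : List (ℝ → ℂ) := List.replicate (p.2 - 1) (eForm β 0) ++
    v.flatMap (fun p => eQuot β u p.1 :: List.replicate (p.2 - 1) (eForm β 0)) with hq
  have hqL : ∀ ψ ∈ q, ψ ∈ Letter := by
    intro ψ hψ
    rcases List.mem_append.1 hψ with h | h
    · rw [List.eq_of_mem_replicate h]
      exact eForm_beta_zero_mem hc0 hc
    · obtain ⟨r, hr, h⟩ := List.mem_flatMap.1 h
      rcases List.mem_cons.1 h with rfl | h
      · exact eQuot_beta_mem hc0 hc hu (hv r hr)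
      · rw [List.eq_of_mem_replicate h]
        exact eForm_beta_zero_mem hc0 hc
  have hw : rsWord u (p :: v) n =
      (eQuot β u p.1 :: q) ++ eForm β u :: List.replicate n (eForm β 0) := by
    rw [rsWord, List.flatMap_cons, hq, List.cons_append]
  have hu1 : eForm β u = eQuot β u 1 := by rw [eQuot, if_neg one_ne_zero, div_one]
  have hprod : (q.map fun ψ => op (toLetter ψ)).prod =
      columnProd (-pathOp invBeta 0) (fun z => pathOp invBeta (z / u) - pathOp invBeta 0)
          (p :: v) := by
    rw [hq, List.map_append, List.prod_append, List.map_replicate, List.prod_replicate,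
      prod_map_flatMap (fun ψ => op (toLetter ψ)), op_eForm_beta_zero hc0 hc, columnProd]
    congr 2
    exact List.map_congr_left fun r hr => by rw [op_eQuot_beta hc0 hc hu (hv r hr)]
  have hbdd := isBdd_eQuot_beta hc0 hc hu hp
  rw [hw]
  refine isRegValue_append_replicate
    (V := fun n => total (eForm invBeta (p.1 / u) - eForm invBeta 0)
        ((goodPath_invBeta hc).isBdd_eForm_sub hc0 hp)
        (columnProd (-pathOp invBeta 0) (fun z => pathOp invBeta (z / u) - pathOp invBeta 0)
          (p :: v) (pathTail invBeta [] (1 / u) n))) (eForm_beta_zero_mem hc0 hc).1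
    (fun t ht => hasDerivAt_logInvBeta ht) ?_ isRegValue_logInvBeta ?_ ?_ n
  · rw [hu1]
    exact (eQuot_beta_mem hc0 hc hu h1).1
  · intro ψ hψ
    rcases List.mem_cons.1 hψ with rfl | hψ
    · exact hbdd.cont
    · exact (hqL ψ hψ).1
  · intro n
    have hh := ((goodPath_invBeta hc).isHead_pathLast hc0 h1 n)
    have hf : IsHead fun t => eForm β u t * (logInvBeta t ^ n / n.factorial) :=
      hh.congr fun t ht => eForm_beta_mul_log hc hu h1 n ht
    have h2 := isRegValue_iterInt_list hbdd q hqL hf.isTail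
    rw [hprod, total_congr hbdd ((goodPath_invBeta hc).isBdd_eForm_sub hc0 hp)
      fun t ht => eQuot_beta hc hu hp ht, tail_toTail_congr (g := pathLast invBeta (1 / u) n)
      (fun t ht => eForm_beta_mul_log hc hu h1 n ht) hf.isTail hh.isTail] at h2
    simpa [pathTail] using h2

lemma regExists_rsWord (hc0 : 0 < c) (hc : c ≤ 1 / 2) (hu : u ≠ 0) (h1 : IsPole c (1 / u))
    {v : List (ℂ × ℕ)} (hv : ∀ q ∈ v, IsPole c (q.1 / u)) (n : ℕ) :
    RegExists (rsWord u v n) := by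
  cases v with
  | cons p v =>
    exact (isRegValue_rsWord hc0 hc hu h1 (hv p List.mem_cons_self)
      (fun q hq => hv q (List.mem_cons_of_mem _ hq)) n).regExists
  | nil =>
    have hu1 : eForm β u = eQuot β u 1 := by rw [eQuot, if_neg one_ne_zero, div_one]
    refine IsRegValue.regExists (isRegValue_append_replicate (q := []) (φ := eForm β u)
      (V := fun n => ∫ t in (0 : ℝ)..1, eForm β u t * (logInvBeta t ^ n / n.factorial))
      (eForm_beta_zero_mem hc0 hc).1
      (fun t ht => hasDerivAt_logInvBeta ht) ?_ isRegValue_logInvBeta ?_ ?_ n)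
    · rw [hu1]
      exact (eQuot_beta_mem hc0 hc hu h1).1
    · simp
    · intro n
      exact isRegValue_iterInt_singleton (((goodPath_invBeta hc).isHead_pathLast hc0 h1 n).congr
        fun t ht => eForm_beta_mul_log hc hu h1 n ht)

end Loop

/-! ### Regularized integrals along `η_u` -/

lemma IsTail.congr {f g : ℝ → ℂ} (hg : IsTail g) (h : ∀ t ∈ Ioo (0 : ℝ) 1, f t = g t) :
    IsTail f := by
  obtain ⟨h1, C, J, hC⟩ := hg
  exact ⟨h1.congr h, C, J, fun t ht => by rw [h t ht]; exact hC t ht⟩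

/-- A branch of `log (x - b)` along `γ` that is asymptotic to `log x` at the end of `γ`. -/
structure IsLogAlong (γ : ℝ → ℂ) (b : ℂ) (L : ℝ → ℂ) : Prop where
  continuousOn : ContinuousOn L (Ioo 0 1)
  exp_eq : ∀ t ∈ Ioo (0 : ℝ) 1, Complex.exp (L t) = γ t - b
  tendsto : Tendsto (fun t => L t - Complex.log (γ t)) (𝓝[<] (1 : ℝ)) (𝓝 0)

/-- The difference of the forms `(x - b)⁻¹ (log (x - b))^n / n!` and `x⁻¹ (log x)^n / n!`. -/
def logDiff (γ : ℝ → ℂ) (b : ℂ) (L : ℝ → ℂ) (n : ℕ) : ℝ → ℂ :=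
  fForm γ b L n - fForm γ 0 (fun t => Complex.log (γ t)) n

/-- The primitive of `logDiff` that vanishes at the end of the path. -/
def logDiffPrimitive (γ : ℝ → ℂ) (L : ℝ → ℂ) (n : ℕ) (t : ℝ) : ℂ :=
  (L t ^ (n + 1) - Complex.log (γ t) ^ (n + 1)) / (n + 1).factorial

section

variable {c : ℝ} {γ : ℝ → ℂ} {b : ℂ} {L : ℝ → ℂ}

/-- By continuity, near `t` the branch is `L t` plus the principal logarithm of `(γ s - b) / (γ t -
b)`, a quotient close to `1`. -/
lemma IsLogAlong.hasDerivAt (hγ : GoodPath c γ) (hb : IsPole c b) (hL : IsLogAlong γ b L) {t : ℝ}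
    (ht : t ∈ Ioo (0 : ℝ) 1) : HasDerivAt L (eForm γ b t) t := by
  have hne := hγ.sub_ne_zero hb ht
  have h1 : HasDerivAt (fun s => (γ s - b) / (γ t - b)) (deriv γ t / (γ t - b)) t :=
    ((hγ.differentiable t ht).hasDerivAt.sub_const b).div_const _
  have h2 := (h1.clog_real (by rw [div_self hne]; simp)).const_add (L t)
  rw [div_self hne, div_one] at h2
  refine h2.congr_of_eventuallyEq ?_
  have hcont : ContinuousAt (fun s => (L s - L t).im) t :=
    Complex.continuous_im.continuousAt.comp
      ((hL.continuousOn.continuousAt (Ioo_mem_nhds ht.1 ht.2)).sub continuousAt_const)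
  have h3 : ∀ᶠ s in 𝓝 t, |(L s - L t).im| < Real.pi := by
    refine hcont.abs.eventually (gt_mem_nhds ?_)
    simpa using Real.pi_pos
  filter_upwards [h3, Ioo_mem_nhds ht.1 ht.2] with s hs hs'
  have h4 : (γ s - b) / (γ t - b) = Complex.exp (L s - L t) := by
    rw [Complex.exp_sub, hL.exp_eq s hs', hL.exp_eq t ht]
  rw [h4, Complex.log_exp (neg_lt_of_abs_lt hs) (lt_of_abs_lt hs).le]
  ring

lemma GoodPath.hasDerivAt_log (hc : 0 < c) (hγ : GoodPath c γ) {t : ℝ} (ht : t ∈ Ioo (0 : ℝ) 1) :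
    HasDerivAt (fun t => Complex.log (γ t)) (eForm γ 0 t) t := by
  have h := (hγ.differentiable t ht).hasDerivAt.clog_real (Or.inl (hc.trans (hγ.lt_re t ht)))
  exact h.congr_deriv (by rw [eForm, sub_zero])

lemma hasDerivAt_logDiffPrimitive (hc : 0 < c) (hγ : GoodPath c γ) (hb : IsPole c b)
    (hL : IsLogAlong γ b L) (n : ℕ) {t : ℝ} (ht : t ∈ Ioo (0 : ℝ) 1) :
    HasDerivAt (logDiffPrimitive γ L n) (logDiff γ b L n t) t := by
  have h1 := (((hL.hasDerivAt hγ hb ht).pow (n + 1)).sub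
    ((hγ.hasDerivAt_log hc ht).pow (n + 1))).div_const ((n + 1).factorial : ℂ)
  refine h1.congr_deriv ?_
  have h2 : (n.factorial : ℂ) ≠ 0 := by exact_mod_cast n.factorial_ne_zero
  have h3 : ((n : ℂ) + 1) ≠ 0 := by exact_mod_cast n.succ_ne_zero
  simp only [logDiff, fForm, Pi.sub_apply, eForm, Nat.factorial_succ, add_tsub_cancel_right]
  push_cast
  field_simp

lemma tendsto_log_pow_mul_decay (hc : 0 < c) (hγ : GoodPath c γ) (n : ℕ) (k : Decay) :
    Tendsto (fun t => Complex.log (γ t) ^ n * k.1 t) (𝓝[<] 1) (𝓝 0) := by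
  obtain ⟨C, hC0, hC⟩ := hγ.exists_norm_log_le hc
  obtain ⟨-, -, D, J, hD0, hD⟩ := k.2
  have h1 := (tendsto_one_sub_mul_lam_pow (n + J)).const_mul (C ^ n * D)
  rw [mul_zero] at h1
  refine squeeze_zero_norm' ?_ h1
  filter_upwards [Ioo_mem_nhdsLT one_pos] with t ht
  rw [norm_mul, norm_pow]
  calc ‖Complex.log (γ t)‖ ^ n * ‖k.1 t‖ ≤ (C * lam t) ^ n * (D * ((1 - t) * lam t ^ J)) := by
        have h2 : 0 ≤ C * lam t := mul_nonneg hC0 (lam_pos ht).le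
        gcongr
        · exact hC t ht
        · exact hD t ht
    _ = C ^ n * D * ((1 - t) * lam t ^ (n + J)) := by rw [mul_pow, pow_add]; ring

/-- Integrability and vanishing of the primitive at the end have to be proved together: the form of
index `n + 1` is `e_b` times the primitive of index `n` plus `(e_b - e_0) (log x)^{n+1} / (n+1)!`.
-/
lemma logDiffPrimitive_spec (hc : 0 < c) (hγ : GoodPath c γ) (hb : IsPole c b)
    (hL : IsLogAlong γ b L) (n : ℕ) : IsTail (logDiff γ b L n) ∧
      ∀ t ∈ Ioo (0 : ℝ) 1, logDiffPrimitive γ L n t = -(tail (toTail (logDiff γ b L n))).1 t := by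
  have hp : ∀ m, IsTail (logDiff γ b L m) →
      Tendsto (logDiffPrimitive γ L m) (𝓝[<] 1) (𝓝 0) → ∀ t ∈ Ioo (0 : ℝ) 1,
      logDiffPrimitive γ L m t = -(tail (toTail (logDiff γ b L m))).1 t := by
    intro m hm hlim t ht
    rw [tail_eq_of_hasDerivAt (toTail (logDiff γ b L m)) (fun t => -logDiffPrimitive γ L m t)
      (fun t ht => ?_) (by simpa using hlim.neg) ht, neg_neg]
    rw [toTail_val hm]
    exact (hasDerivAt_logDiffPrimitive hc hγ hb hL m ht).neg
  have hlim0 : Tendsto (logDiffPrimitive γ L 0) (𝓝[<] 1) (𝓝 0) := by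
    refine hL.tendsto.congr fun t => ?_
    simp [logDiffPrimitive]
  have htail0 : IsTail (logDiff γ b L 0) :=
    (hγ.isHead_pathLast hc hb 0).isTail.congr fun t _ => by
      simp [logDiff, pathLast, fForm, eForm]
  have h0 := hp 0 htail0 hlim0
  induction n with
  | zero => exact ⟨htail0, h0⟩
  | succ n ih =>
    obtain ⟨ih1, ih2⟩ := ih
    have h1 : IsTail (logDiff γ b L (n + 1)) := by
      refine IsTail.congr (Tail.add_mem
        (isTail_mul ⟨eForm γ b, hγ.eForm_mem hb⟩ (-tail (toTail (logDiff γ b L n))))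
        (hγ.isHead_pathLast hc hb (n + 1)).isTail) fun t ht => ?_
      simp only [Pi.add_apply, Pi.mul_apply, Submodule.coe_neg, Pi.neg_apply]
      rw [← ih2 t ht]
      simp only [logDiff, logDiffPrimitive, pathLast, fForm, eForm, Pi.sub_apply]
      ring
    refine ⟨h1, hp (n + 1) h1 ?_⟩
    -- With `δ = L - log γ`, one has `L^{n+2} - log^{n+2} = (L^{n+1} - log^{n+1}) (log + δ) +
    -- log^{n+1} δ`. Both `δ` and the first bracket lie in `Decay`, up to constant factors, and so
    -- beat any power of the logarithm.
    have e : (fun t => (((n + 1).factorial : ℂ) *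
        (Complex.log (γ t) ^ 1 * (tail (toTail (logDiff γ b L n))).1 t -
          (Complex.log (γ t) ^ 0 * (tail (toTail (logDiff γ b L 0))).1 t) *
            (Complex.log (γ t) ^ 0 * (tail (toTail (logDiff γ b L n))).1 t)) +
        Complex.log (γ t) ^ (n + 1) * (tail (toTail (logDiff γ b L 0))).1 t) *
          (-((n + 2).factorial : ℂ)⁻¹)) =ᶠ[𝓝[<] 1] logDiffPrimitive γ L (n + 1) := by
      filter_upwards [Ioo_mem_nhdsLT one_pos] with t ht
      have e1 := ih2 t ht
      have e2 := h0 t ht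
      rw [eq_comm, neg_eq_iff_eq_neg] at e1 e2
      rw [e1, e2]
      have f1 : ((n + 1).factorial : ℂ) ≠ 0 := by exact_mod_cast (n + 1).factorial_ne_zero
      have f2 : ((n + 2).factorial : ℂ) ≠ 0 := by exact_mod_cast (n + 2).factorial_ne_zero
      simp only [logDiffPrimitive, zero_add, pow_one, pow_zero, Nat.factorial_one, Nat.cast_one,
        div_one, one_mul]
      field_simp
      ring
    refine Tendsto.congr' e ?_
    have t1 := tendsto_log_pow_mul_decay hc hγ 1 (tail (toTail (logDiff γ b L n)))
    have t2 := tendsto_log_pow_mul_decay hc hγ 0 (tail (toTail (logDiff γ b L n)))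
    have t3 := tendsto_log_pow_mul_decay hc hγ 0 (tail (toTail (logDiff γ b L 0)))
    have t4 := tendsto_log_pow_mul_decay hc hγ (n + 1) (tail (toTail (logDiff γ b L 0)))
    simpa using (((t1.sub (t3.mul t2)).const_mul ((n + 1).factorial : ℂ)).add t4).mul_const
      (-((n + 2).factorial : ℂ)⁻¹)

lemma tail_logDiff_succ (hc : 0 < c) (hγ : GoodPath c γ) (hb : IsPole c b)
    (hL : IsLogAlong γ b L) (n : ℕ) :
    tail (toTail (logDiff γ b L (n + 1))) =
      -pathOp γ b (tail (toTail (logDiff γ b L n))) + pathTail γ [] b (n + 1) := by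
  have ht := (hγ.isHead_pathLast hc hb (n + 1)).isTail
  rw [← map_neg, pathOp, op_eq, pathTail, List.map_nil, List.prod_nil, Module.End.one_apply,
    ← map_add]
  refine tail_congr fun t ht' => ?_
  rw [toTail_val (logDiffPrimitive_spec hc hγ hb hL (n + 1)).1, Submodule.coe_add, toTail_val ht]
  simp only [Pi.add_apply, Pi.mul_apply, Submodule.coe_neg, Pi.neg_apply,
    toLetter_val (hγ.eForm_mem hb)]
  rw [← (logDiffPrimitive_spec hc hγ hb hL n).2 t ht']
  simp only [logDiff, logDiffPrimitive, pathLast, fForm, eForm, Pi.sub_apply]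
  ring

lemma pathTail_append (γ : ℝ → ℂ) (as bs : List ℂ) (b : ℂ) (n : ℕ) :
    pathTail γ (as ++ bs) b n = (as.map (pathOp γ)).prod (pathTail γ bs b n) := by
  rw [pathTail, List.map_append, List.prod_append, Module.End.mul_apply]
  rfl

lemma pathTail_replicate (γ : ℝ → ℂ) (a b : ℂ) (m n : ℕ) :
    pathTail γ (List.replicate m a) b n = (pathOp γ a ^ m) (pathTail γ [] b n) := by
  rw [← List.append_nil (List.replicate m a), pathTail_append, List.map_replicate,
    List.prod_replicate]

/-- Unrolling the recursion `tail_logDiff_succ`: each step integrates once more against `e_b` with a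
sign, or stops with the form containing a power of `log x`. -/
lemma tail_logDiff (hc : 0 < c) (hγ : GoodPath c γ) (hb : IsPole c b)
    (hL : IsLogAlong γ b L) (m : ℕ) :
    tail (toTail (logDiff γ b L m)) = ∑ n ∈ Finset.range (m + 1),
      (-1 : ℂ) ^ n • pathTail γ (List.replicate n b) b (m - n) := by
  induction m with
  | zero =>
    rw [Finset.sum_range_one, pow_zero, one_smul, List.replicate_zero, pathTail, List.map_nil,
      List.prod_nil, Module.End.one_apply]
    refine tail_toTail_congr (fun t _ => ?_) (logDiffPrimitive_spec hc hγ hb hL 0).1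
      (hγ.isHead_pathLast hc hb 0).isTail
    simp [logDiff, pathLast, fForm, eForm]
  | succ m ih =>
    rw [tail_logDiff_succ hc hγ hb hL, ih, Finset.sum_range_succ' _ (m + 1), pow_zero, one_smul,
      List.replicate_zero, tsub_zero, map_sum, ← Finset.sum_neg_distrib]
    congr 1
    refine Finset.sum_congr rfl fun n _ => ?_
    rw [map_smul, pathTail_replicate, pathTail_replicate, ← Module.End.mul_apply, ← pow_succ',
      Nat.add_sub_add_right, pow_succ (-1 : ℂ), mul_neg_one]
    exact (neg_smul _ _).symm

end

/-- The poles of the word `e_0^{k_1-1} e_{z_2/u} e_0^{k_2-1} ⋯`. -/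
def columnPoles (u : ℂ) : List (ℂ × ℕ) → List ℂ
  | [] => []
  | p :: v => List.replicate (p.2 - 1) 0 ++ v.flatMap fun q => q.1 / u :: List.replicate (q.2 - 1) 0

lemma columnPoles_isPole {c : ℝ} (hc : 0 < c) {u : ℂ} {p : ℂ × ℕ} {v : List (ℂ × ℕ)}
    (hv : ∀ q ∈ v, IsPole c (q.1 / u)) : ∀ a ∈ columnPoles u (p :: v), IsPole c a := by
  intro a ha
  rcases List.mem_append.1 ha with h | h
  · rw [List.eq_of_mem_replicate h]
    exact isPole_zero hc
  · obtain ⟨r, hr, h⟩ := List.mem_flatMap.1 h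
    rcases List.mem_cons.1 h with rfl | h
    · exact hv r hr
    · rw [List.eq_of_mem_replicate h]
      exact isPole_zero hc

lemma isRegValue_etaWord {c : ℝ} (hc : 0 < c) {u : ℂ} (hγ : GoodPath c (eta u)) {L : ℝ → ℂ}
    (hL : IsLogBranch u L) (h1 : IsPole c u⁻¹) {p : ℂ × ℕ} {v : List (ℂ × ℕ)}
    (hp : IsPole c (p.1 / u)) (hv : ∀ q ∈ v, IsPole c (q.1 / u)) (m : ℕ) :
    IsRegValue (fun z => iterInt (etaWord u L (p :: v) m) z (1 - z))
      (∑ n ∈ Finset.range (m + 1), (-1) ^ n *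
        total (eForm (eta u) (p.1 / u) - eForm (eta u) 0) (hγ.isBdd_eForm_sub hc hp)
          (pathTail (eta u) (columnPoles u (p :: v) ++ List.replicate n u⁻¹) u⁻¹ (m - n))) := by
  have hL' : IsLogAlong (eta u) u⁻¹ L := ⟨hL.continuousOn, hL.exp_eq, hL.tendsto⟩
  have hq : ∀ ψ ∈ (columnPoles u (p :: v)).map (eForm (eta u)), ψ ∈ Letter := by
    intro ψ hψ
    obtain ⟨a, ha, rfl⟩ := List.mem_map.1 hψ
    exact hγ.eForm_mem (columnPoles_isPole hc hv a ha)
  have h := isRegValue_iterInt_list (hγ.isBdd_eForm_sub hc hp) _ hq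
    (logDiffPrimitive_spec hc hγ h1 hL' m).1
  rw [tail_logDiff hc hγ h1 hL', map_sum, map_sum, List.map_map] at h
  have hw : etaWord u L (p :: v) m = (eForm (eta u) (p.1 / u) - eForm (eta u) 0) ::
      ((columnPoles u (p :: v)).map (eForm (eta u)) ++ [logDiff (eta u) u⁻¹ L m]) := by
    rw [etaWord, etaPrefix, columnPoles, List.map_append, List.map_replicate, List.map_flatMap,
      logDiff]
    simp only [List.map_cons, List.map_replicate, List.cons_append, List.append_assoc]
  rw [hw]
  refine Eq.subst (motive := IsRegValue _) (Finset.sum_congr rfl fun n _ => ?_) h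
  rw [map_smul, map_smul, smul_eq_mul, pathTail_append]
  rfl

/-! ### Sums over compositions -/

/-- Prepend a new first block of size one, or enlarge the first block by one. -/
def compositionExtend {n : ℕ} : Composition (n + 1) ⊕ Composition (n + 1) → Composition (n + 2)
  | .inl c => ⟨1 :: c.blocks, fun h => by
      rcases List.mem_cons.1 h with rfl | h
      · exact one_pos
      · exact c.blocks_pos h, by rw [List.sum_cons, c.blocks_sum]; ring⟩
  | .inr c => ⟨(c.blocks.headD 0 + 1) :: c.blocks.tail, fun h => by
      rcases List.mem_cons.1 h with rfl | h
      · exact Nat.succ_pos _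
      · exact c.blocks_pos (List.mem_of_mem_tail h), by
      have h := c.blocks_sum
      rcases hb : c.blocks with - | ⟨b, bs⟩
      · rw [hb] at h; simp at h
      · rw [hb, List.sum_cons] at h
        rw [List.headD_cons, List.tail_cons, List.sum_cons]
        omega⟩

lemma Composition.exists_blocks_eq {n : ℕ} (c : Composition (n + 1)) :
    ∃ b bs, c.blocks = (b + 1) :: bs := by
  have h := c.blocks_sum
  rcases hb : c.blocks with - | ⟨b, bs⟩
  · rw [hb] at h; simp at h
  · have h1 : 0 < b := c.blocks_pos (hb ▸ List.mem_cons_self)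
    exact ⟨b - 1, bs, by rw [Nat.sub_add_cancel h1]⟩

/-- A composition is recovered by checking whether its first block has size one. -/
lemma compositionExtend_bijective (n : ℕ) : Function.Bijective (compositionExtend (n := n)) := by
  constructor
  · rintro (c | c) (d | d) h
    · have h1 := congrArg Composition.blocks h
      simp only [compositionExtend, List.cons.injEq, true_and] at h1
      rw [Composition.ext h1]
    · obtain ⟨b, bs, hb⟩ := Composition.exists_blocks_eq d
      have h1 := congrArg Composition.blocks h
      simp [compositionExtend, hb] at h1
    · obtain ⟨b, bs, hb⟩ := Composition.exists_blocks_eq c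
      have h1 := congrArg Composition.blocks h
      simp [compositionExtend, hb] at h1
    · obtain ⟨b, bs, hb⟩ := Composition.exists_blocks_eq c
      obtain ⟨b', bs', hb'⟩ := Composition.exists_blocks_eq d
      have h1 := congrArg Composition.blocks h
      simp only [compositionExtend, hb, hb', List.headD_cons, List.tail_cons, List.cons.injEq,
        add_left_inj] at h1
      rw [Composition.ext (by rw [hb, hb', h1.1, h1.2] : c.blocks = d.blocks)]
  · intro c
    obtain ⟨b, bs, hb⟩ := Composition.exists_blocks_eq c
    have hs := c.blocks_sum
    rw [hb, List.sum_cons] at hs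
    have hpos : ∀ i ∈ bs, 0 < i := fun i hi => c.blocks_pos (hb ▸ List.mem_cons_of_mem _ hi)
    rcases b with - | b
    · exact ⟨.inl ⟨bs, fun h => hpos _ h, by omega⟩, Composition.ext hb.symm⟩
    · exact ⟨.inr ⟨(b + 1) :: bs, fun h => by
        rcases List.mem_cons.1 h with rfl | h
        · exact Nat.succ_pos _
        · exact hpos _ h, by rw [List.sum_cons]; omega⟩, Composition.ext hb.symm⟩

lemma sum_composition_succ {M : Type*} [AddCommMonoid M] {n : ℕ} (F : List ℕ → M) :
    ∑ c : Composition (n + 2), F c.blocks = ∑ c : Composition (n + 1),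
      (F (1 :: c.blocks) + F ((c.blocks.headD 0 + 1) :: c.blocks.tail)) := by
  rw [← (compositionExtend_bijective n).sum_comp, Fintype.sum_sum_type, ← Finset.sum_add_distrib]
  rfl

lemma splitWrtComposition_cons {α : Type*} (a : α) (l : List α) {n : ℕ} (c : Composition (n + 1)) :
    ∃ b L, (a :: l).splitWrtComposition c = (a :: b) :: L := by
  obtain ⟨b, bs, hb⟩ := Composition.exists_blocks_eq c
  refine ⟨l.take b, (l.drop b).splitWrtCompositionAux bs, ?_⟩
  rw [List.splitWrtComposition, hb, List.splitWrtCompositionAux_cons, List.take_succ_cons,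
    List.drop_succ_cons]

/-- Summing over all ways to merge neighbouring columns turns each letter `g z` but the first one
into `f - g z`. -/
lemma sum_columnProd_merge {R : Type*} [Ring R] (f : R) (g : ℂ → R) (p : ℂ × ℕ)
    (w : List (ℂ × ℕ)) (hw : ∀ q ∈ p :: w, 1 ≤ q.2) :
    ∑ c : Composition (p :: w).length,
      (-1) ^ ((p :: w).splitWrtComposition c).length *
        columnProd f g (((p :: w).splitWrtComposition c).map merge) =
      -columnProd f (fun z => f - g z) (p :: w) := by
  induction w generalizing p with
  | nil =>
    have : Subsingleton (Composition 1) :=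
      Fintype.card_le_one_iff_subsingleton.1 (by rw [composition_card]; simp)
    have h1 : ∀ c : Composition 1, c.blocks = [1] := fun c => by
      rw [Subsingleton.elim c (Composition.ones 1)]; rfl
    simp only [List.length_cons, List.length_nil, List.splitWrtComposition]
    rw [Fintype.sum_subsingleton _ (Composition.ones 1), h1]
    simp [List.splitWrtCompositionAux, merge, columnProd]
  | cons q w ih =>
    have ih' := ih q fun r hr => hw r (List.mem_cons_of_mem _ hr)
    have hq : 1 ≤ q.2 := hw q (by simp)
    have hp : 1 ≤ p.2 := hw p (by simp)
    have hr : columnProd f (fun z => f - g z) (p :: q :: w) =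
        f ^ (p.2 - 1) * (f - g q.1) * columnProd f (fun z => f - g z) (q :: w) := by
      simp only [columnProd, List.map_cons, List.prod_cons, mul_assoc]
    rw [hr]
    refine (sum_composition_succ (n := w.length) fun bl =>
      (-1) ^ ((p :: q :: w).splitWrtCompositionAux bl).length *
        columnProd f g (((p :: q :: w).splitWrtCompositionAux bl).map merge)).trans ?_
    -- Each composition of `q :: w` has two extensions. Cutting after `p` adds a block, hence a
    -- sign, and prepends `f ^ (p.2 - 1) * g q.1`; merging `p` into the first block prepends `f ^
    -- p.2`. Together they prepend `f ^ (p.2 - 1) * (f - g q.1)`.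
    rw [← mul_neg, ← ih', Finset.mul_sum]
    refine Finset.sum_congr rfl fun c _ => ?_
    obtain ⟨b, bs, hb⟩ := Composition.exists_blocks_eq c
    obtain ⟨i, hi⟩ : ∃ i, p.2 = i + 1 := ⟨p.2 - 1, by omega⟩
    obtain ⟨j, hj⟩ : ∃ j, q.2 = j + 1 := ⟨q.2 - 1, by omega⟩
    rw [List.splitWrtComposition, hb]
    simp only [List.headD_cons, List.tail_cons, List.splitWrtCompositionAux_cons,
      List.take_succ_cons, List.drop_succ_cons, List.take_zero, List.drop_zero, List.map_cons,
      List.length_cons, merge, columnProd, List.map_nil, List.sum_cons, List.sum_nil,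
      List.prod_cons, hi, hj, add_zero, Nat.add_sub_cancel]
    set s := ((w.take b).map Prod.snd).sum
    rw [show j + 1 + s - 1 = j + s by omega, show i + 1 + (j + 1 + s) - 1 = i + 1 + (j + s) by omega]
    generalize (List.map (fun q => g q.1 * f ^ (q.2 - 1))
      (((w.drop b).splitWrtCompositionAux bs).map fun b =>
        ((b.map Prod.fst).headD 0, (b.map Prod.snd).sum))).prod = X
    rw [pow_add f (i + 1), pow_succ f i]
    rcases neg_one_pow_eq_or R ((w.drop b).splitWrtCompositionAux bs).length with h | h <;>
    · rw [pow_succ, pow_succ, h]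
      noncomm_ring

/-! ### Comparison of the two sides -/

lemma neg_sub_sub_self {G : Type*} [AddCommGroup G] (a b : G) : -a - (b - a) = -b := by abel

lemma neg_one_pow_mul_apply (n : ℕ) (T : Module.End ℂ Decay) (k : Decay) :
    ((-1) ^ n * T) k = (-1 : ℂ) ^ n • T k := by
  induction n with
  | zero => rw [pow_zero, pow_zero, one_mul, one_smul]
  | succ n ih =>
    rw [pow_succ', pow_succ', mul_assoc, Module.End.mul_apply, ih, LinearMap.neg_apply,
      Module.End.one_apply, neg_one_mul]
    exact (neg_smul _ _).symm

lemma columnProd_neg {R : Type*} [Ring R] (e : ℂ → R) (u : ℂ) (p : ℂ × ℕ) (v : List (ℂ × ℕ)) :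
    columnProd (-e 0) (fun z => -e (z / u)) (p :: v) =
      (-1) ^ (columnPoles u (p :: v)).length * ((columnPoles u (p :: v)).map e).prod := by
  have h1 : columnProd (-e 0) (fun z => -e (z / u)) (p :: v) =
      (((columnPoles u (p :: v)).map e).map Neg.neg).prod := by
    rw [columnProd, columnPoles, List.map_append, List.map_append, List.prod_append,
      List.map_replicate, List.map_replicate, List.prod_replicate]
    congr 1
    induction v with
    | nil => simp
    | cons q v ih =>
      rw [List.map_cons, List.prod_cons, ih]
      simp [mul_assoc]
  rw [h1, List.prod_map_neg, List.length_map]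

/-- The extra `1` stands for the first letter, which is not among the poles listed. -/
lemma length_columnPoles (u : ℂ) (p : ℂ × ℕ) (v : List (ℂ × ℕ)) (hv : ∀ q ∈ p :: v, 1 ≤ q.2) :
    (columnPoles u (p :: v)).length + 1 = ((p :: v).map Prod.snd).sum := by
  have hp := hv p List.mem_cons_self
  have h1 : (v.flatMap fun q => q.1 / u :: List.replicate (q.2 - 1) 0).length =
      (v.map Prod.snd).sum := by
    rw [List.length_flatMap]
    congr 1
    refine List.map_congr_left fun q hq => ?_
    have := hv q (List.mem_cons_of_mem _ hq)
    rw [List.length_cons, List.length_replicate]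
    omega
  rw [columnPoles, List.length_append, List.length_replicate, h1, List.map_cons, List.sum_cons]
  omega

lemma columnPoles_append_replicate (u : ℂ) (p : ℂ × ℕ) (v : List (ℂ × ℕ)) (n : ℕ) :
    columnPoles u (p :: (v ++ List.replicate n (1, 1))) =
      columnPoles u (p :: v) ++ List.replicate n (1 / u) := by
  rw [columnPoles, columnPoles, List.flatMap_append, List.append_assoc]
  congr 2
  induction n with
  | zero => rfl
  | succ n ih => rw [List.replicate_succ, List.flatMap_cons, ih]; rfl

section

variable {c : ℝ} {u : ℂ}

/-- Merging never changes the first `z`, so all terms share the same functional `T` and the same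
last form. By linearity the sum moves into the operator ring, where `sum_columnProd_merge` evaluates
it. -/
lemma sum_regInt_rsWord (hc0 : 0 < c) (hc : c ≤ 1 / 2) (hu : u ≠ 0) (h1 : IsPole c (1 / u))
    (p : ℂ × ℕ) (v : List (ℂ × ℕ)) (hv : ∀ q ∈ p :: v, IsPole c (q.1 / u) ∧ 1 ≤ q.2) (m : ℕ) :
    ∑ d : Composition (p :: v).length, (-1) ^ ((p :: v).splitWrtComposition d).length *
        regInt (rsWord u (((p :: v).splitWrtComposition d).map merge) m) =
      (-1) ^ ((p :: v).map Prod.snd).sum *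
        total (eForm invBeta (p.1 / u) - eForm invBeta 0)
          ((goodPath_invBeta hc).isBdd_eForm_sub hc0 (hv p List.mem_cons_self).1)
          (pathTail invBeta (columnPoles u (p :: v)) (1 / u) m) := by
  set T := total (eForm invBeta (p.1 / u) - eForm invBeta 0)
    ((goodPath_invBeta hc).isBdd_eForm_sub hc0 (hv p List.mem_cons_self).1)
  set f := -pathOp invBeta 0 with hf
  set g : ℂ → Module.End ℂ Decay := fun z => pathOp invBeta (z / u) - pathOp invBeta 0 with hg
  have h2 : ∀ d : Composition (p :: v).length,
      (-1) ^ ((p :: v).splitWrtComposition d).length *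
        regInt (rsWord u (((p :: v).splitWrtComposition d).map merge) m) =
      T (((-1) ^ ((p :: v).splitWrtComposition d).length *
        columnProd f g (((p :: v).splitWrtComposition d).map merge))
          (pathTail invBeta [] (1 / u) m)) := by
    intro d
    obtain ⟨b, L, hL⟩ := splitWrtComposition_cons p v d
    have hLp : ∀ q ∈ L.map merge, IsPole c (q.1 / u) := by
      intro q hq
      obtain ⟨B, hB, rfl⟩ := List.mem_map.1 hq
      have hB' : B ∈ (p :: v).splitWrtComposition d := hL ▸ List.mem_cons_of_mem _ hB
      have hlen := List.length_pos_of_mem_splitWrtComposition hB'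
      obtain ⟨r, B', rfl⟩ := List.exists_cons_of_length_pos hlen
      have hr : r ∈ p :: v := by
        rw [← List.flatten_splitWrtComposition (p :: v) d]
        exact List.mem_flatten.2 ⟨_, hB', List.mem_cons_self⟩
      exact (hv r hr).1
    rw [neg_one_pow_mul_apply, map_smul, smul_eq_mul, hL, List.map_cons,
      (isRegValue_rsWord hc0 hc hu h1 (p := merge (p :: b)) (hv p List.mem_cons_self).1 hLp
        m).regInt_eq]
    rfl
  rw [Finset.sum_congr rfl fun d _ => h2 d, ← map_sum, ← LinearMap.sum_apply,
    sum_columnProd_merge f g p v fun q hq => (hv q hq).2]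
  -- The cancellation behind the star version: the `e_0` parts drop out and only `-e_{z/u}` remains.
  have h3 : (fun z => f - g z) = fun z => -pathOp invBeta (z / u) := by
    funext z
    exact neg_sub_sub_self (pathOp invBeta 0) (pathOp invBeta (z / u))
  rw [h3, hf, columnProd_neg, ← length_columnPoles u p v fun q hq => (hv q hq).2, pow_succ,
    mul_neg_one, LinearMap.neg_apply, map_neg, neg_one_pow_mul_apply, map_smul, smul_eq_mul,
    ← List.append_nil (columnPoles u (p :: v)), pathTail_append, List.append_nil, neg_mul]

lemma regInt_etaWord (hc0 : 0 < c) (hcu : c < u.re / 2) (hc : c ≤ 1 / 2) (hu1 : u.re / 2 < 1)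
    (hu : u ≠ 0) (h1 : IsPole c (1 / u)) {L : ℝ → ℂ} (hL : IsLogBranch u L)
    (p : ℂ × ℕ) (v : List (ℂ × ℕ)) (hv : ∀ q ∈ p :: v, IsPole c (q.1 / u) ∧ 1 ≤ q.2) (m : ℕ) :
    (-1) ^ ((p :: v).map Prod.snd).sum * regInt (etaWord u L (p :: v) m) =
      ∑ n ∈ Finset.range (m + 1),
        ∑ d : Composition (p :: v ++ List.replicate n (1, 1)).length,
          (-1) ^ ((p :: v ++ List.replicate n (1, 1)).splitWrtComposition d).length *
            regInt (rsWord u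
              (((p :: v ++ List.replicate n (1, 1)).splitWrtComposition d).map merge) (m - n)) := by
  have hp := (hv p List.mem_cons_self).1
  have hv' : ∀ q ∈ v, IsPole c (q.1 / u) := fun q hq => (hv q (List.mem_cons_of_mem _ hq)).1
  have h1' : IsPole c u⁻¹ := by rwa [← one_div]
  have hη := goodPath_eta hc0 hcu hu1
  rw [(isRegValue_etaWord hc0 hη hL h1' hp hv' m).regInt_eq, Finset.mul_sum]
  refine Finset.sum_congr rfl fun n _ => ?_
  have hvn : ∀ q ∈ p :: (v ++ List.replicate n (1, 1)), IsPole c (q.1 / u) ∧ 1 ≤ q.2 := by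
    intro q hq
    rw [← List.cons_append] at hq
    rcases List.mem_append.1 hq with h | h
    · exact hv q h
    · rw [List.eq_of_mem_replicate h]
      exact ⟨h1, le_rfl⟩
  have h2 := sum_regInt_rsWord hc0 hc hu h1 p (v ++ List.replicate n (1, 1)) hvn (m - n)
  have has : ∀ a ∈ columnPoles u (p :: v) ++ List.replicate n (1 / u), IsPole c a := by
    intro a ha
    rcases List.mem_append.1 ha with h | h
    · exact columnPoles_isPole hc0 hv' a h
    · rwa [List.eq_of_mem_replicate h]
  -- The change of contour: `V` is the common value along `1/β` and along `η_u`.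
  obtain ⟨V, hV⟩ := exists_total_pathTail_eq hc0 (by linarith : c < 1) hp has h1 (m - n)
  rw [columnPoles_append_replicate, hV invBeta (goodPath_invBeta hc)] at h2
  refine Eq.trans ?_ h2.symm
  have h3 := hV (eta u) hη
  rw [one_div] at h3
  rw [h3, ← List.cons_append, List.map_append, List.sum_append, List.map_replicate,
    List.sum_replicate, smul_eq_mul, mul_one, pow_add, mul_assoc]

end

lemma coeff_rsStar (Q : Finset ℂ) (α : ℤ) (w : List (ℂ × ℕ)) (n : ℕ) :
    PowerSeries.coeff n (rsStar Q α w) = 1 / (2 * Real.pi * Complex.I) * ∑ u ∈ Q.erase 0, u ^ α *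
      ∑ d : Composition w.length, (-1) ^ (w.splitWrtComposition d).length *
        regInt (rsWord u ((w.splitWrtComposition d).map merge) n) := by
  simp only [rsStar, map_sum, rs, PowerSeries.coeff_mk, List.length_map, Finset.mul_sum]
  rw [Finset.sum_comm]
  exact Finset.sum_congr rfl fun u _ => Finset.sum_congr rfl fun d _ => by ring

end SymMPL

end

/-! ### The generating series identity -/

theorem corollary3p4 (Q : Finset ℂ) (hQ : SymMPL.IsAdmissible Q) (α : ℤ)
    (w : List (ℂ × ℕ)) (hw : w ≠ []) (hwQ : ∀ p ∈ w, p.1 ∈ Q ∧ 1 ≤ p.2)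
    (L : ℂ → ℝ → ℂ) (hL : ∀ u ∈ Q, u ≠ 0 → SymMPL.IsLogBranch u (L u)) :
    -- the regularized integrals on both sides exist
    (∀ u ∈ Q, u ≠ 0 → ∀ v : List (ℂ × ℕ), (∀ p ∈ v, p.1 ∈ Q ∧ 1 ≤ p.2) →
      ∀ n : ℕ, SymMPL.RegExists (SymMPL.rsWord u v n)) ∧
    (∀ u ∈ Q, u ≠ 0 → ∀ m : ℕ, SymMPL.RegExists (SymMPL.etaWord u (L u) w m)) ∧
    -- the identity of formal power series in `t = PowerSeries.X`
    HasSum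
      (fun n : ℕ => SymMPL.rsStar Q α (w ++ List.replicate n (1, 1)) * PowerSeries.X ^ n)
      (((-1) ^ (w.map Prod.snd).sum / (2 * Real.pi * Complex.I) : ℂ) •
        ∑ u ∈ Q.erase 0, u ^ α • SymMPL.etaInt u (L u) w) := by
  obtain ⟨p, v, rfl⟩ := List.exists_cons_of_ne_nil hw
  refine ⟨fun u hu hu0 v hv n => ?_, fun u hu hu0 m => ?_, ?_⟩
  · obtain ⟨c, hc0, -, hc, -, hpole⟩ := hQ.exists_isPole hu hu0
    exact SymMPL.regExists_rsWord hc0 hc hu0 (hpole 1 hQ.one_mem) (fun q hq => hpole _ (hv q hq).1) n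
  · obtain ⟨c, hc0, hcu, -, hu1, hpole⟩ := hQ.exists_isPole hu hu0
    have h1 := hpole 1 hQ.one_mem
    rw [one_div] at h1
    exact (SymMPL.isRegValue_etaWord hc0 (SymMPL.goodPath_eta hc0 hcu hu1) (hL u hu hu0) h1
      (hpole _ (hwQ p List.mem_cons_self).1)
      (fun q hq => hpole _ (hwQ q (List.mem_cons_of_mem _ hq)).1) m).regExists
  · rw [PowerSeries.WithPiTopology.hasSum_iff_hasSum_coeff]
    intro m
    -- The factor `X ^ n` kills all terms with `n > m` in the coefficient of degree `m`, so the
    -- infinite sum is finite in each degree.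
    have h1 : PowerSeries.coeff m (((-1) ^ ((p :: v).map Prod.snd).sum /
        (2 * Real.pi * Complex.I) : ℂ) • ∑ u ∈ Q.erase 0, u ^ α • SymMPL.etaInt u (L u) (p :: v)) =
        ∑ n ∈ Finset.range (m + 1), PowerSeries.coeff m
          (SymMPL.rsStar Q α (p :: v ++ List.replicate n (1, 1)) * PowerSeries.X ^ n) := by
      have h2 : ∀ n ∈ Finset.range (m + 1), PowerSeries.coeff m
          (SymMPL.rsStar Q α (p :: v ++ List.replicate n (1, 1)) * PowerSeries.X ^ n) =
          PowerSeries.coeff (m - n) (SymMPL.rsStar Q α (p :: v ++ List.replicate n (1, 1))) :=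
        fun n hn => by
          rw [PowerSeries.coeff_mul_X_pow', if_pos (Nat.lt_succ_iff.1 (Finset.mem_range.1 hn))]
      rw [Finset.sum_congr rfl h2]
      simp only [SymMPL.coeff_rsStar]
      rw [← Finset.mul_sum, Finset.sum_comm, PowerSeries.coeff_smul, map_sum, smul_eq_mul,
        div_eq_mul_one_div, mul_comm ((-1 : ℂ) ^ _), mul_assoc, Finset.mul_sum]
      congr 1
      refine Finset.sum_congr rfl fun u hu => ?_
      obtain ⟨hu0, huQ⟩ := Finset.mem_erase.1 hu
      obtain ⟨c, hc0, hcu, hc, hu1, hpole⟩ := hQ.exists_isPole huQ hu0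
      rw [← Finset.mul_sum, ← SymMPL.regInt_etaWord hc0 hcu hc hu1 hu0 (hpole 1 hQ.one_mem)
        (hL u huQ hu0) p v (fun q hq => ⟨hpole _ (hwQ q hq).1, (hwQ q hq).2⟩) m,
        PowerSeries.coeff_smul, SymMPL.etaInt, PowerSeries.coeff_mk, smul_eq_mul]
      ring
    rw [h1]
    refine hasSum_sum_of_ne_finset_zero fun n hn => ?_
    rw [PowerSeries.coeff_mul_X_pow', if_neg]
    intro h
    exact hn (Finset.mem_range.2 (Nat.lt_succ_of_le h))
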